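/- Let $d\ge 1$ and let $R$ be a real symmetric $d\times d$ matrix with $R_{ij}\ge 0$ for all $i,j$ and $\sum_i R_{ij}>0$ for each $j$. Let $s_1,\dots,s_d>0$ be initial weights and $y_0\in\{1,\dots,d\}$ an initial state (for instance $s_i=1$ for all $i$ and $y_0=1$). Let $(Y_n)_{n\ge 0}$ be a random process on $\{1,\dots,d\}$ with $Y_0=y_0$ almost surely and $$\mathbf P(Y_{n+1}=j\mid Y_0,\dots,Y_n)=\frac{R_{Y_n,j}\,S_j(n)}{\sum_i R_{Y_n,i}\,S_i(n)},$$ where $S_i(0)=s_i$ and $S_i(n+1)=S_i(n)+\mathbf 1_{\{Y_{n+1}=i\}}$, and let $V(n)=S(n)/\sum_j S_j(n)$, an element of the simplex $\Delta=\{v\in\mathbb R^d: v_i\ge 0,\ \sum_i v_i=1\}$. Put $N_i(v)=\sum_j R_{ij}v_j$, $H(v)=\sum_i v_iN_i(v)$ and, where $H(v)\neq 0$, $\pi_i(v)=v_iN_i(v)/H(v)$. A critical point is a point $v\in\Delta$ with $H(v)>0$ and $\pi(v)=v$. Suppose that $R$ is nonsingular and that $p$ is a critical point in the interior of $\Delta$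 (all $p_i>0$). Then $p$ is the only critical point in the interior of $\Delta$, and if $p$ is not a maximum of $H$ on $\Delta$, then $\mathbf P(V(n)\to p)=0$. Moreover, $\pi-I$ is differentiable at $p$, its derivative $D_p(\pi-I)$ maps $W=\{w\in\mathbb R^d:\sum_i w_i=0\}$ (the linear span of $-p+\Delta$) into itself, and the following are equivalent: (a) $p$ is not a maximum of $H$ on $\Delta$; (b) $R$ has more than one positive eigenvalue, counted with multiplicity; (c) the linear operator $D_p(\pi-I)$ on $W$ has a positive eigenvalue. -/

import Mathlib

open scoped MeasureTheory ProbabilityTheory Topology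

noncomputable section

namespace VRRW

/-- `N_i(v) = ∑_j R_{ij} v_j`. -/
def N {d : ℕ} (R : Matrix (Fin d) (Fin d) ℝ) (v : Fin d → ℝ) (i : Fin d) : ℝ :=
  ∑ j, R i j * v j

/-- The quadratic form `H(v) = ∑_i v_i N_i(v) = ∑_{i,j} R_{ij} v_i v_j`. -/
def H {d : ℕ} (R : Matrix (Fin d) (Fin d) ℝ) (v : Fin d → ℝ) : ℝ :=
  ∑ i, v i * N R v i

/-- `π_i(v) = v_i N_i(v) / H(v)`, meaningful where `H(v) ≠ 0`. -/
def stat {d : ℕ} (R : Matrix (Fin d) (Fin d) ℝ) (v : Fin d → ℝ) : Fin d → ℝ :=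
  fun i => v i * N R v i / H R v

/-- The vector field `π - I`. -/
def drift {d : ℕ} (R : Matrix (Fin d) (Fin d) ℝ) (v : Fin d → ℝ) : Fin d → ℝ :=
  stat R v - v

/-- Critical points: `v` in the simplex with `H(v) > 0` and `π(v) = v`. -/
def IsCritical {d : ℕ} (R : Matrix (Fin d) (Fin d) ℝ) (v : Fin d → ℝ) : Prop :=
  v ∈ stdSimplex ℝ (Fin d) ∧ 0 < H R v ∧ stat R v = v

/-- Critical points in the (relative) interior of the simplex. -/
def IsInteriorCritical {d : ℕ} (R : Matrix (Fin d) (Fin d) ℝ) (v : Fin d → ℝ) : Prop :=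
  IsCritical R v ∧ ∀ i, 0 < v i

/-- The directions of the simplex: the linear span `{w : ∑ w_i = 0}` of `-p + Δ`, for `p`
interior to the simplex `Δ`. -/
def directions (d : ℕ) : Submodule ℝ (Fin d → ℝ) where
  carrier := {w | ∑ i, w i = 0}
  add_mem' := by
    intro a b ha hb
    simp only [Set.mem_ofPred_eq] at ha hb ⊢
    simp [Finset.sum_add_distrib, ha, hb]
  zero_mem' := by simp
  smul_mem' := by
    intro c a ha
    simp only [Set.mem_ofPred_eq] at ha ⊢
    simp [← Finset.mul_sum, ha]

/-- The number of positive eigenvalues of `R`, counted with multiplicity. -/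
def numPosEigenvalues {d : ℕ} (R : Matrix (Fin d) (Fin d) ℝ) : ℕ :=
  (R.charpoly.roots.filter (fun x => 0 < x)).card

/-- The weights `S(n)` along a path `y` with initial weights `s`: the starting state `y 0` is not
counted, and each later visit to `i` adds one to the weight of `i`. -/
def weight {d : ℕ} (s : Fin d → ℝ) (y : ℕ → Fin d) : ℕ → Fin d → ℝ
  | 0, i => s i
  | n + 1, i => weight s y n i + if y (n + 1) = i then 1 else 0

/-- The normalized occupation vector `V(n) = S(n) / ∑_j S_j(n)`. -/
def occupation {d : ℕ} (s : Fin d → ℝ) (y : ℕ → Fin d) (n : ℕ) : Fin d → ℝ :=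
  fun i => weight s y n i / ∑ j, weight s y n j

/-- The sigma-field generated by `Y_0, ..., Y_n`. -/
@[reducible] def history {d : ℕ} {Ω : Type*} (Y : ℕ → Ω → Fin d) (n : ℕ) : MeasurableSpace Ω :=
  ⨆ k : Fin (n + 1), MeasurableSpace.comap (Y k) inferInstance

/-- `Y` is the reinforced process with matrix `R`, initial weights `s` and initial state `y₀`:
given the past, the step from `Y_n` goes to `j` with probability
`R_{Y_n, j} S_j(n) / ∑_i R_{Y_n, i} S_i(n)`. -/
structure IsReinforcedProcess {d : ℕ} {Ω : Type*} [MeasurableSpace Ω]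
    (R : Matrix (Fin d) (Fin d) ℝ) (s : Fin d → ℝ) (y₀ : Fin d)
    (μ : MeasureTheory.Measure Ω) (Y : ℕ → Ω → Fin d) : Prop where
  measurable : ∀ n, Measurable (Y n)
  start : ∀ᵐ ω ∂μ, Y 0 ω = y₀
  step : ∀ (n : ℕ) (j : Fin d),
    μ[(Y (n + 1) ⁻¹' {j}).indicator (fun _ => (1 : ℝ)) | history Y n] =ᵐ[μ]
      fun ω => R (Y n ω) j * weight s (fun k => Y k ω) n j /
        ∑ i, R (Y n ω) i * weight s (fun k => Y k ω) n i

end VRRW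

end

/-! At an interior critical point all `N R p i` equal `H R p`, so `R *ᵥ p` is a constant vector.
Since `R` is nonsingular, this determines `p` up to scale. On the simplex `H R v - H R p` is the
quadratic form of `R` at `v - p`, so `p` fails to be a maximum exactly when that form is positive
somewhere on W. This condition, `HasPositiveDirection`, links all the equivalences. As `p` is
orthogonal to W for the form and the form is positive at `p`, it means that the form is positive
definite on some plane, that is, that `R` has more than one positive eigenvalue. The Jacobian of
`drift R` at `p` is conjugate by diag(√p) to a symmetric matrix, whose form on W/√p is that of `R`
divided by `H R p`; so it has a real eigenbasis, and a positive eigenvalue exactly when a positive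
direction exists.

For nonconvergence, first let the chain with weights frozen at `p` be reducible: some state is then
never visited, which rules out an interior limit. Otherwise the Poisson equation of the frozen chain
gives an O(1/n) correction of the occupation vector whose increments are the step size times drift
plus martingale noise plus an O(1/n) error. If convergence had positive probability, Lévy's 0-1 law
(`exists_atom`) would give a long history, with atom E, nearly filled by a set F on which the
occupation vector stays near `p` forever. Take two independent copies of the path from `μ`
restricted to F. They share their past, so the difference of the corrected vectors starts at zero,
stays bounded, and satisfies a nearly linear recursion.

A bounded solution forces the discounted noise in an unstable direction to be balanced by the
coupling errors, which are small in L² (`PerronSystem.eventually_noise_le`). But visits between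
times n and 2n to a state with positive conditional variance give that noise a second moment of
order μ(E)²/n (`IsReinforcedProcess.le_setIntegral_noise_sq`, `IsNoise.le_integral_prod_sub_sq`).
With the constants chosen in the right order the two bounds are incompatible. -/

namespace VRRW

open Matrix

/-! ### The quadratic form at an interior critical point and the signature of `R`. -/

section LinearAlgebra

variable {d : ℕ}

/-- Spectral decomposition of a real symmetric matrix in coordinates. -/
theorem exists_spectral_basis {A : Matrix (Fin d) (Fin d) ℝ} (hA : A.IsHermitian) :
    ∃ e : Fin d → Fin d → ℝ,
      (∀ j, A *ᵥ e j = hA.eigenvalues j • e j) ∧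
      (∀ i j, e i ⬝ᵥ e j = if i = j then 1 else 0) ∧
      (∀ x, ∑ j, (e j ⬝ᵥ x) • e j = x) := by
  refine ⟨fun j => (hA.eigenvectorBasis j).ofLp, fun j => hA.mulVec_eigenvectorBasis j, ?_, ?_⟩
  · intro i j
    have h := hA.eigenvectorBasis.inner_eq_ite i j
    rw [EuclideanSpace.inner_eq_star_dotProduct] at h
    rw [← h, dotProduct_comm]
    rfl
  · intro x
    have h := hA.eigenvectorBasis.sum_repr' (WithLp.toLp 2 x)
    have h' := congrArg WithLp.ofLp h
    rw [WithLp.ofLp_sum] at h'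
    refine Eq.trans (Finset.sum_congr rfl fun j _ => ?_) h'
    rw [EuclideanSpace.inner_eq_star_dotProduct, dotProduct_comm]
    rfl

theorem dotProduct_mulVec_eq_sum {A : Matrix (Fin d) (Fin d) ℝ} {κ : Fin d → ℝ}
    {e : Fin d → Fin d → ℝ} (he : ∀ j, A *ᵥ e j = κ j • e j)
    (hx : ∀ x, ∑ j, (e j ⬝ᵥ x) • e j = x) (x : Fin d → ℝ) :
    x ⬝ᵥ A *ᵥ x = ∑ j, κ j * (e j ⬝ᵥ x) ^ 2 := by
  have h1 : A *ᵥ x = ∑ j, (e j ⬝ᵥ x) • κ j • e j := by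
    conv_lhs => rw [← hx x]
    rw [mulVec_sum]
    exact Finset.sum_congr rfl fun j _ => by rw [mulVec_smul, he]
  rw [h1, dotProduct_sum]
  refine Finset.sum_congr rfl fun j _ => ?_
  rw [dotProduct_smul, dotProduct_smul, dotProduct_comm x]
  simp only [smul_eq_mul]
  ring

theorem sum_sq_eq_sum_dotProduct_sq {e : Fin d → Fin d → ℝ}
    (hx : ∀ x, ∑ j, (e j ⬝ᵥ x) • e j = x) (x : Fin d → ℝ) :
    ∑ i, x i ^ 2 = ∑ j, (e j ⬝ᵥ x) ^ 2 := by
  have h : x ⬝ᵥ x = ∑ i, x i ^ 2 := by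
    simp only [dotProduct, sq]
  rw [← h]
  conv_lhs => rw [← hx x]
  rw [sum_dotProduct]
  refine Finset.sum_congr rfl fun j _ => ?_
  rw [smul_dotProduct, hx, smul_eq_mul, sq]

theorem numPosEigenvalues_eq_card {R : Matrix (Fin d) (Fin d) ℝ} (hR : R.IsHermitian) :
    numPosEigenvalues R = (Finset.univ.filter fun j => 0 < hR.eigenvalues j).card := by
  unfold numPosEigenvalues
  rw [hR.roots_charpoly_eq_eigenvalues, Multiset.filter_map, Multiset.card_map]
  rfl

theorem H_eq_dotProduct (R : Matrix (Fin d) (Fin d) ℝ) (v : Fin d → ℝ) :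
    H R v = v ⬝ᵥ R *ᵥ v := rfl

theorem mem_directions {w : Fin d → ℝ} : w ∈ directions d ↔ ∑ i, w i = 0 := Iff.rfl

/-- The quadratic form of `R` is positive somewhere on the directions of the simplex. -/
def HasPositiveDirection (R : Matrix (Fin d) (Fin d) ℝ) : Prop :=
  ∃ w ∈ directions d, 0 < w ⬝ᵥ R *ᵥ w

theorem dotProduct_mulVec_comm {R : Matrix (Fin d) (Fin d) ℝ} (hsymm : R.IsSymm)
    (v w : Fin d → ℝ) : v ⬝ᵥ R *ᵥ w = w ⬝ᵥ R *ᵥ v := by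
  rw [dotProduct_mulVec, ← mulVec_transpose, hsymm.eq, dotProduct_comm]

theorem isHermitian_of_isSymm {R : Matrix (Fin d) (Fin d) ℝ} (hsymm : R.IsSymm) :
    R.IsHermitian := by
  rw [IsHermitian, conjTranspose_eq_transpose_of_trivial]
  exact hsymm

namespace IsInteriorCritical

variable {R : Matrix (Fin d) (Fin d) ℝ} {p : Fin d → ℝ}

theorem pos (hp : IsInteriorCritical R p) (i : Fin d) : 0 < p i := hp.2 i

theorem sum_eq_one (hp : IsInteriorCritical R p) : ∑ i, p i = 1 := hp.1.1.2

theorem le_one (hp : IsInteriorCritical R p) (i : Fin d) : p i ≤ 1 := by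
  rw [← hp.sum_eq_one]
  exact Finset.single_le_sum (f := p) (fun j _ => (hp.pos j).le) (Finset.mem_univ i)

theorem H_pos (hp : IsInteriorCritical R p) : 0 < H R p := hp.1.2.1

theorem N_eq (hp : IsInteriorCritical R p) (i : Fin d) : N R p i = H R p := by
  have h : p i * N R p i / H R p = p i := congrFun hp.1.2.2 i
  have hH := hp.H_pos
  rw [div_eq_iff hH.ne'] at h
  exact mul_left_cancel₀ (hp.pos i).ne' h

theorem mulVec_eq (hp : IsInteriorCritical R p) : R *ᵥ p = fun _ => H R p :=
  funext hp.N_eq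

theorem dotProduct_mulVec (hp : IsInteriorCritical R p) (w : Fin d → ℝ) :
    w ⬝ᵥ R *ᵥ p = H R p * ∑ i, w i := by
  rw [hp.mulVec_eq, Finset.mul_sum]
  exact Finset.sum_congr rfl fun i _ => mul_comm _ _

theorem dotProduct_mulVec' (hsymm : R.IsSymm) (hp : IsInteriorCritical R p) (w : Fin d → ℝ) :
    p ⬝ᵥ R *ᵥ w = H R p * ∑ i, w i := by
  rw [dotProduct_mulVec_comm hsymm, hp.dotProduct_mulVec]

/-- Both points are multiples of the solution of `R x = 1`, and the coordinate sum fixes the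
multiple. -/
theorem eq_of_isInteriorCritical (hdet : R.det ≠ 0) (hp : IsInteriorCritical R p)
    {q : Fin d → ℝ} (hq : IsInteriorCritical R q) : q = p := by
  have hP := hp.H_pos
  have hinj : Function.Injective R.mulVec :=
    Matrix.mulVec_injective_of_isUnit ((Matrix.isUnit_iff_isUnit_det R).2 hdet.isUnit)
  have h : H R p • q = H R q • p := by
    apply hinj
    rw [mulVec_smul, mulVec_smul, hp.mulVec_eq, hq.mulVec_eq]
    ext i
    simp [mul_comm]
  have hs := congrArg (fun v : Fin d → ℝ => ∑ i, v i) h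
  simp only [Pi.smul_apply, smul_eq_mul, ← Finset.mul_sum, hp.sum_eq_one, hq.sum_eq_one,
    mul_one] at hs
  rw [hs] at h
  exact smul_right_injective _ hq.H_pos.ne' h

/-- The cross term vanishes because `R *ᵥ p` is constant and the coordinates of `v - p` sum to zero.
-/
theorem H_eq (hsymm : R.IsSymm) (hp : IsInteriorCritical R p) {v : Fin d → ℝ}
    (hv : ∑ i, v i = 1) : H R v = H R p + (v - p) ⬝ᵥ R *ᵥ (v - p) := by
  have h1 := hp.dotProduct_mulVec v
  have h2 := hp.dotProduct_mulVec' hsymm v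
  rw [hv, mul_one] at h1 h2
  have h3 := H_eq_dotProduct R p
  simp only [mulVec_sub, dotProduct_sub, sub_dotProduct, H_eq_dotProduct R v]
  linarith

theorem not_isMaxOn_iff (hsymm : R.IsSymm) (hp : IsInteriorCritical R p) :
    ¬ IsMaxOn (H R) (stdSimplex ℝ (Fin d)) p ↔ HasPositiveDirection R := by
  constructor
  · intro h
    simp only [IsMaxOn, IsMaxFilter, Filter.eventually_principal, not_forall, not_le] at h
    obtain ⟨v, hv, hlt⟩ := h
    refine ⟨v - p, ?_, ?_⟩
    · rw [mem_directions]
      simp [Finset.sum_sub_distrib, hv.2, hp.sum_eq_one]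
    · rw [hp.H_eq hsymm hv.2] at hlt
      linarith
  · rintro ⟨w, hw, hpos⟩ hmax
    -- As `p` is interior, a short move along `w` stays in the simplex.
    have hcont : ∀ i, ∀ᶠ t : ℝ in 𝓝 0, 0 < p i + t * w i := by
      intro i
      have hc : ContinuousAt (fun t : ℝ => p i + t * w i) 0 := by fun_prop
      exact hc.tendsto.eventually (lt_mem_nhds (by simpa using hp.pos i))
    have hev : ∀ᶠ t : ℝ in 𝓝[>] 0, (∀ i, 0 < p i + t * w i) ∧ 0 < t :=
      ((Filter.eventually_all.2 hcont).filter_mono nhdsWithin_le_nhds).and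
        eventually_mem_nhdsWithin
    obtain ⟨t, ht, ht0⟩ := hev.exists
    have hsum : ∑ i, (p + t • w) i = 1 := by
      simp [Finset.sum_add_distrib, ← Finset.mul_sum, mem_directions.1 hw, hp.sum_eq_one]
    have hmem : p + t • w ∈ stdSimplex ℝ (Fin d) := ⟨fun i => (ht i).le, hsum⟩
    have hle : H R (p + t • w) ≤ H R p := hmax hmem
    rw [hp.H_eq hsymm hsum, add_sub_cancel_left, mulVec_smul, dotProduct_smul, smul_dotProduct,
      smul_eq_mul, smul_eq_mul] at hle
    have : 0 < t * (t * w ⬝ᵥ R *ᵥ w) := by positivity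
    linarith

theorem one_lt_numPosEigenvalues_iff (hsymm : R.IsSymm) (hp : IsInteriorCritical R p) :
    1 < numPosEigenvalues R ↔ HasPositiveDirection R := by
  have hR := isHermitian_of_isSymm hsymm
  obtain ⟨e, he, hort, hex⟩ := exists_spectral_basis hR
  rw [numPosEigenvalues_eq_card hR]
  constructor
  · intro h
    obtain ⟨j, hj, k, hk, hjk⟩ := Finset.one_lt_card.1 h
    simp only [Finset.mem_filter, Finset.mem_univ, true_and] at hj hk
    by_cases h0 : ∑ i, e j i = 0
    · refine ⟨e j, h0, ?_⟩
      rw [he, dotProduct_smul, hort, if_pos rfl, smul_eq_mul, mul_one]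
      exact hj
    -- These coefficients cancel the coordinate sum, and the form is positive definite on the span
    -- of two positive eigenvectors.
    · refine ⟨(∑ i, e k i) • e j - (∑ i, e j i) • e k, ?_, ?_⟩
      · rw [mem_directions]
        simp [Finset.sum_sub_distrib, ← Finset.mul_sum]
        ring
      · have : 0 < hR.eigenvalues k * (∑ i, e j i) ^ 2 := by positivity
        have : 0 ≤ hR.eigenvalues j * (∑ i, e k i) ^ 2 := by positivity
        simp only [mulVec_sub, mulVec_smul, he, dotProduct_sub, sub_dotProduct, smul_dotProduct,
          dotProduct_smul, hort, if_pos, if_neg hjk, if_neg hjk.symm, smul_eq_mul]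
        nlinarith
  · rintro ⟨w, hw, hpos⟩
    by_contra hle
    have hle : (Finset.univ.filter fun j => 0 < hR.eigenvalues j).card ≤ 1 := not_lt.1 hle
    have hw0 : ∑ i, w i = 0 := hw
    have hform := dotProduct_mulVec_eq_sum he hex
    obtain ⟨j, hj⟩ : ∃ j, 0 < hR.eigenvalues j := by
      by_contra! hn
      rw [hform] at hpos
      exact hpos.not_ge (Finset.sum_nonpos fun j _ =>
        mul_nonpos_of_nonpos_of_nonneg (hn j) (sq_nonneg _))
    have hother : ∀ k, k ≠ j → hR.eigenvalues k ≤ 0 := by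
      intro k hk
      by_contra! hk'
      exact hk (Finset.card_le_one.1 hle k (by simp [hk']) j (by simp [hj]))
    have hnonpos : ∀ x, e j ⬝ᵥ x = 0 → x ⬝ᵥ R *ᵥ x ≤ 0 := by
      intro x hx
      rw [hform]
      refine Finset.sum_nonpos fun k _ => ?_
      by_cases hk : k = j
      · rw [hk, hx]; simp
      · exact mul_nonpos_of_nonpos_of_nonneg (hother k hk) (sq_nonneg _)
    -- This vector is orthogonal to the only eigenvector with positive eigenvalue, so the form is
    -- nonpositive there. Since `p` and `w` are orthogonal for the form, its value is also a sum of
    -- two nonnegative terms.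
    have hx := hnonpos ((e j ⬝ᵥ w) • p - (e j ⬝ᵥ p) • w) (by
      simp [dotProduct_sub, dotProduct_smul]; ring)
    have h1 := hp.dotProduct_mulVec w
    have h2 := hp.dotProduct_mulVec' hsymm w
    have h3 := hp.dotProduct_mulVec p
    rw [hw0, mul_zero] at h1 h2
    rw [hp.sum_eq_one, mul_one] at h3
    simp only [mulVec_sub, mulVec_smul, dotProduct_sub, sub_dotProduct, smul_dotProduct,
      dotProduct_smul, smul_eq_mul, h1, h2, h3] at hx
    have hH := hp.H_pos
    have ha : e j ⬝ᵥ w = 0 := by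
      by_contra hne
      have : 0 < H R p * (e j ⬝ᵥ w) ^ 2 := by positivity
      have : 0 ≤ (w ⬝ᵥ R *ᵥ w) * (e j ⬝ᵥ p) ^ 2 := by positivity
      nlinarith
    exact hpos.not_ge (hnonpos w ha)

end IsInteriorCritical

end LinearAlgebra

end VRRW

namespace VRRW

open Matrix

/-! ### The Jacobian of the vector field and its eigencoordinates. -/

section Jacobian

variable {d : ℕ}

/-- The Jacobian matrix of `drift R` at an interior critical point `p`. -/
noncomputable def jac (R : Matrix (Fin d) (Fin d) ℝ) (p : Fin d → ℝ) : Matrix (Fin d) (Fin d) ℝ :=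
  Matrix.of fun i j => p i * R i j / H R p - 2 * p i

theorem jac_mulVec (R : Matrix (Fin d) (Fin d) ℝ) (p w : Fin d → ℝ) (i : Fin d) :
    (jac R p *ᵥ w) i = p i * (R *ᵥ w) i / H R p - 2 * p i * ∑ j, w j := by
  simp only [jac, mulVec, dotProduct, Matrix.of_apply, Finset.mul_sum, Finset.sum_div,
    ← Finset.sum_sub_distrib]
  exact Finset.sum_congr rfl fun j _ => by ring

theorem hasStrictFDerivAt_N (R : Matrix (Fin d) (Fin d) ℝ) (p : Fin d → ℝ) (i : Fin d) :
    HasStrictFDerivAt (fun v => N R v i)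
      ((ContinuousLinearMap.proj i).comp (Matrix.mulVecLin R).toContinuousLinearMap) p :=
  ((ContinuousLinearMap.proj (R := ℝ) (φ := fun _ : Fin d => ℝ) i).comp
    (Matrix.mulVecLin R).toContinuousLinearMap).hasStrictFDerivAt

namespace IsInteriorCritical

variable {R : Matrix (Fin d) (Fin d) ℝ} {p : Fin d → ℝ}

/-- Strict differentiability is needed later, where two trajectories near `p` are compared with each
other and neither sits at `p`. -/
theorem hasStrictFDerivAt_drift (hsymm : R.IsSymm) (hp : IsInteriorCritical R p) :
    HasStrictFDerivAt (drift R) (Matrix.mulVecLin (jac R p)).toContinuousLinearMap p := by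
  have hH := hp.H_pos
  have hproj : ∀ i, HasStrictFDerivAt (fun v : Fin d → ℝ => v i)
      (ContinuousLinearMap.proj (R := ℝ) (φ := fun _ : Fin d => ℝ) i) p := fun i =>
    (ContinuousLinearMap.proj (R := ℝ) (φ := fun _ : Fin d => ℝ) i).hasStrictFDerivAt
  have hvN : ∀ i, HasStrictFDerivAt (fun v : Fin d → ℝ => v i * N R v i) _ p := fun i =>
    (hproj i).mul (hasStrictFDerivAt_N R p i)
  have hHd : HasStrictFDerivAt (H R) _ p :=
    HasStrictFDerivAt.fun_sum (u := Finset.univ) fun i _ => hvN i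
  rw [hasStrictFDerivAt_pi']
  intro i
  have hinv := (hasStrictDerivAt_inv hH.ne').comp_hasStrictFDerivAt p hHd
  refine HasStrictFDerivAt.congr_fderiv (((hvN i).mul hinv).sub (hproj i)) ?_
  ext1 w
  have hsum : ∑ j, p j * (R *ᵥ w) j = H R p * ∑ j, w j := hp.dotProduct_mulVec' hsymm w
  simp [jac_mulVec, hp.N_eq, Finset.sum_add_distrib, hsum, ← Finset.mul_sum]
  field_simp
  ring

/-- This makes W invariant and gives any eigenvector outside W the eigenvalue -1, so positive
eigenvalues live on W. -/
theorem sum_jac_mulVec (hsymm : R.IsSymm) (hp : IsInteriorCritical R p) (w : Fin d → ℝ) :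
    ∑ i, (jac R p *ᵥ w) i = - ∑ i, w i := by
  have hH := hp.H_pos
  have hsum : ∑ j, p j * (R *ᵥ w) j = H R p * ∑ j, w j := hp.dotProduct_mulVec' hsymm w
  simp only [jac_mulVec, Finset.sum_sub_distrib, ← Finset.sum_div, ← Finset.sum_mul,
    ← Finset.mul_sum, hsum, hp.sum_eq_one]
  field_simp
  ring

/-- Here nonsingularity of `R` enters the dynamics: with no zero eigenvalue, every eigendirection is
strictly stable or strictly unstable. -/
theorem jac_mulVec_ne_zero (hsymm : R.IsSymm) (hdet : R.det ≠ 0) (hp : IsInteriorCritical R p)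
    {w : Fin d → ℝ} (hw : jac R p *ᵥ w = 0) : w = 0 := by
  have hs : ∑ i, w i = 0 := by
    have := hp.sum_jac_mulVec hsymm w
    rw [hw] at this
    simpa using this.symm
  have hRw : R *ᵥ w = 0 := by
    ext i
    have h := congrFun hw i
    rw [jac_mulVec, hs, mul_zero, sub_zero, Pi.zero_apply, div_eq_zero_iff, mul_eq_zero] at h
    rcases h with (h | h) | h
    · exact absurd h (hp.pos i).ne'
    · exact h
    · exact absurd h hp.H_pos.ne'
  exact Matrix.eq_zero_of_mulVec_eq_zero hdet hRw

/-- The Jacobian at an interior critical point is diagonalizable with real eigenvalues: there are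
left eigenvectors `ℓ j`, orthonormal for the weights `p`. -/
theorem exists_eigencoordinates (hsymm : R.IsSymm) (hdet : R.det ≠ 0)
    (hp : IsInteriorCritical R p) :
    ∃ (κ : Fin d → ℝ) (ℓ : Fin d → Fin d → ℝ),
      (∀ j w, ℓ j ⬝ᵥ jac R p *ᵥ w = κ j * (ℓ j ⬝ᵥ w)) ∧
      (∀ w : Fin d → ℝ, ∑ i, w i ^ 2 ≤ ∑ j, (ℓ j ⬝ᵥ w) ^ 2) ∧
      (∀ j, κ j ≠ 0) ∧
      (∀ j, ∑ i, p i * ℓ j i ^ 2 = 1) ∧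
      (∀ j, jac R p *ᵥ (fun i => p i * ℓ j i) = κ j • fun i => p i * ℓ j i) ∧
      (HasPositiveDirection R → ∃ j, 0 < κ j) := by
  have hH := hp.H_pos
  set q : Fin d → ℝ := fun i => √(p i) with hq
  have hq0 : ∀ i, 0 < q i := fun i => Real.sqrt_pos.2 (hp.pos i)
  have hqq : ∀ i, q i * q i = p i := fun i => Real.mul_self_sqrt (hp.pos i).le
  -- `A` is `D⁻¹ (jac R p) D` with `D = diag(√p)`. Its orthonormal eigenvectors `e` give the left
  -- eigenvectors `e / √p` and the right eigenvectors `√p e`, which are `p` times the left ones.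
  let A : Matrix (Fin d) (Fin d) ℝ := Matrix.of fun i j => q i * R i j * q j / H R p - 2 * q i * q j
  have hA : A.IsHermitian := by
    apply isHermitian_of_isSymm
    ext i j
    simp only [A, Matrix.transpose_apply, Matrix.of_apply, hsymm.apply i j]
    ring
  have hAj : ∀ i k, A i k * q i = q k * jac R p i k := by
    intro i k
    simp only [A, jac, Matrix.of_apply]
    rw [← hqq i]
    ring
  obtain ⟨e, he, hort, hex⟩ := exists_spectral_basis hA
  have hAe : ∀ j i, ∑ k, A i k * e j k = hA.eigenvalues j * e j i := fun j i =>
    congrFun (he j) i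
  have hAsym : ∀ i k, A i k = A k i := fun i k => by
    have := hA.apply i k
    simpa using this.symm
  have hleft : ∀ j w, (fun i => e j i / q i) ⬝ᵥ jac R p *ᵥ w
      = hA.eigenvalues j * ((fun i => e j i / q i) ⬝ᵥ w) := by
    intro j w
    have h1 : ∀ k, ∑ i, e j i / q i * jac R p i k = hA.eigenvalues j * (e j k / q k) := by
      intro k
      have hterm : ∀ i, e j i / q i * jac R p i k = A k i * e j i / q k := by
        intro i
        have hi := (hq0 i).ne'
        have hk := (hq0 k).ne'
        rw [div_mul_eq_mul_div, div_eq_div_iff hi hk, hAsym k i]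
        linear_combination (- e j i) * hAj i k
      rw [Finset.sum_congr rfl fun i _ => hterm i, ← Finset.sum_div, hAe, mul_div_assoc]
    rw [Matrix.dotProduct_mulVec]
    simp only [dotProduct, vecMul, h1, Finset.mul_sum]
    exact Finset.sum_congr rfl fun k _ => by ring
  have hright : ∀ j, jac R p *ᵥ (fun i => p i * (e j i / q i))
      = hA.eigenvalues j • fun i => p i * (e j i / q i) := by
    intro j
    have h2 : ∀ i, p i * (e j i / q i) = q i * e j i := fun i => by
      have hi := (hq0 i).ne'
      rw [← hqq i]
      field_simp
    ext i
    simp only [h2, mulVec, dotProduct, Pi.smul_apply, smul_eq_mul]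
    have h3 : ∀ k, jac R p i k * (q k * e j k) = A i k * e j k * q i := fun k => by
      linear_combination (- e j k) * hAj i k
    rw [Finset.sum_congr rfl fun k _ => h3 k, ← Finset.sum_mul, hAe]
    ring
  have hnorm : ∀ j, ∑ i, p i * (e j i / q i) ^ 2 = 1 := by
    intro j
    have h2 : ∀ i, p i * (e j i / q i) ^ 2 = e j i * e j i := fun i => by
      have hi := (hq0 i).ne'
      rw [← hqq i]
      field_simp
    rw [Finset.sum_congr rfl fun i _ => h2 i]
    simpa [dotProduct] using hort j j
  refine ⟨hA.eigenvalues, fun j i => e j i / q i, hleft, ?_, ?_, hnorm, hright, ?_⟩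
  · intro w
    have h := sum_sq_eq_sum_dotProduct_sq hex (fun i => w i / q i)
    have h1 : ∀ j, (fun i => e j i / q i) ⬝ᵥ w = e j ⬝ᵥ fun i => w i / q i := by
      intro j
      simp only [dotProduct]
      exact Finset.sum_congr rfl fun i _ => by ring
    simp only [h1, ← h]
    refine Finset.sum_le_sum fun i _ => ?_
    rw [div_pow, sq (q i), hqq, le_div_iff₀ (hp.pos i)]
    exact mul_le_of_le_one_right (sq_nonneg _) (hp.le_one i)
  · intro j hj
    have h0 := hright j
    rw [hj, zero_smul] at h0
    have h1 := hp.jac_mulVec_ne_zero hsymm hdet h0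
    have h2 := hnorm j
    have h3 : ∀ i, e j i / q i = 0 := fun i => by
      have := congrFun h1 i
      simpa [(hp.pos i).ne'] using this
    simp [h3] at h2
  · rintro ⟨w, hw, hpos⟩
    by_contra! hn
    have hform := dotProduct_mulVec_eq_sum he hex (fun i => w i / q i)
    have hle : (fun i => w i / q i) ⬝ᵥ A *ᵥ (fun i => w i / q i) ≤ 0 := by
      rw [hform]
      exact Finset.sum_nonpos fun j _ => mul_nonpos_of_nonpos_of_nonneg (hn j) (sq_nonneg _)
    -- On W the rank-one part of `A` contributes nothing, since √p pairs with `w / √p` to the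
    -- coordinate sum of `w`.
    have heq : (fun i => w i / q i) ⬝ᵥ A *ᵥ (fun i => w i / q i) = w ⬝ᵥ R *ᵥ w / H R p := by
      have h1 : ∀ i, w i / q i * ∑ k, A i k * (w k / q k) = w i * ∑ k, R i k * w k / H R p := by
        intro i
        have h2 : ∀ k, A i k * (w k / q k) = q i * (R i k * w k / H R p) - 2 * q i * w k := by
          intro k
          have hk := (hq0 k).ne'
          simp only [A, Matrix.of_apply]
          field_simp
        simp only [h2, Finset.sum_sub_distrib, ← Finset.mul_sum, mem_directions.1 hw, mul_zero,
          sub_zero]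
        have hi := (hq0 i).ne'
        field_simp
      simp only [dotProduct, mulVec, h1]
      simp only [← Finset.sum_div, ← mul_div_assoc]
    rw [heq] at hle
    exact (div_pos hpos hH).not_ge hle

/-- On W the eigenvalue equation reads `R w = c H(p) w / p`, so the form at `w` is a positively
weighted sum of squares. -/
theorem hasPositiveDirection_of_eigenvector (hp : IsInteriorCritical R p) {w : Fin d → ℝ}
    (hw : w ∈ directions d) (hw0 : w ≠ 0) {c : ℝ} (hc : 0 < c) (h : jac R p *ᵥ w = c • w) :
    HasPositiveDirection R := by
  have hH := hp.H_pos
  refine ⟨w, hw, ?_⟩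
  have h1 : ∀ i, (R *ᵥ w) i = c * H R p * w i / p i := by
    intro i
    have h2 := congrFun h i
    rw [jac_mulVec, mem_directions.1 hw, mul_zero, sub_zero, Pi.smul_apply, smul_eq_mul] at h2
    rw [div_eq_iff hH.ne'] at h2
    rw [eq_div_iff (hp.pos i).ne']
    linarith
  obtain ⟨i, hi⟩ := Function.ne_iff.1 hw0
  have hterm : ∀ k, w k * (R *ᵥ w) k = c * H R p / p k * w k ^ 2 := fun k => by
    rw [h1]; ring
  have hpk := hp.pos
  refine Finset.sum_pos' (fun k _ => ?_) ⟨i, Finset.mem_univ i, ?_⟩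
  · rw [hterm]
    have := hpk k
    positivity
  · rw [hterm]
    have := hpk i
    have hi' : w i ≠ 0 := hi
    positivity

theorem sum_eq_zero_of_eigenvector (hsymm : R.IsSymm) (hp : IsInteriorCritical R p)
    {w : Fin d → ℝ} {c : ℝ} (hc : 0 < c) (h : jac R p *ᵥ w = c • w) : ∑ i, w i = 0 := by
  have hs := hp.sum_jac_mulVec hsymm w
  rw [h] at hs
  simp only [Pi.smul_apply, smul_eq_mul, ← Finset.mul_sum] at hs
  have : (c + 1) * ∑ i, w i = 0 := by linarith
  exact (mul_eq_zero.1 this).resolve_left (by linarith)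

theorem fderiv_drift (hsymm : R.IsSymm) (hp : IsInteriorCritical R p) (w : Fin d → ℝ) :
    (fderiv ℝ (drift R) p).toLinearMap w = jac R p *ᵥ w := by
  rw [(hp.hasStrictFDerivAt_drift hsymm).hasFDerivAt.fderiv]
  rfl

theorem fderiv_drift_mem_directions (hsymm : R.IsSymm) (hp : IsInteriorCritical R p)
    (w : Fin d → ℝ) (hw : w ∈ directions d) :
    (fderiv ℝ (drift R) p).toLinearMap w ∈ directions d := by
  rw [hp.fderiv_drift hsymm, mem_directions, hp.sum_jac_mulVec hsymm, mem_directions.1 hw, neg_zero]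

theorem hasPositiveDirection_iff_hasEigenvalue (hsymm : R.IsSymm) (hdet : R.det ≠ 0)
    (hp : IsInteriorCritical R p)
    (hW : ∀ w ∈ directions d, (fderiv ℝ (drift R) p).toLinearMap w ∈ directions d) :
    HasPositiveDirection R ↔ ∃ c : ℝ, 0 < c ∧
      Module.End.HasEigenvalue ((fderiv ℝ (drift R) p).toLinearMap.restrict hW) c := by
  constructor
  · intro h
    obtain ⟨κ, ℓ, -, -, -, hnorm, hright, hpos⟩ := hp.exists_eigencoordinates hsymm hdet
    obtain ⟨j, hj⟩ := hpos h
    have hmem : (fun i => p i * ℓ j i) ∈ directions d :=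
      hp.sum_eq_zero_of_eigenvector hsymm hj (hright j)
    refine ⟨κ j, hj, Module.End.hasEigenvalue_of_hasEigenvector (x := ⟨_, hmem⟩) ⟨?_, ?_⟩⟩
    · rw [Module.End.mem_eigenspace_iff]
      ext1
      rw [LinearMap.coe_restrict_apply, hp.fderiv_drift hsymm, hright]
      rfl
    · intro h0
      have h1 : ∀ i, ℓ j i = 0 := fun i => by
        have := congrFun (congrArg Subtype.val h0) i
        simpa [(hp.pos i).ne'] using this
      have := hnorm j
      simp [h1] at this
  · rintro ⟨c, hc, hev⟩
    obtain ⟨⟨w, hw⟩, hwe⟩ := hev.exists_hasEigenvector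
    refine hp.hasPositiveDirection_of_eigenvector hw (fun h0 => hwe.2 (Subtype.ext h0)) hc ?_
    have := congrArg Subtype.val hwe.apply_eq_smul
    rw [LinearMap.coe_restrict_apply, hp.fderiv_drift hsymm] at this
    exact this

end IsInteriorCritical

end Jacobian

end VRRW

namespace VRRW

open Matrix

/-! ### The chain with frozen weights, its Poisson equation, and uniform estimates near `p`. -/

section Frozen

variable {d : ℕ}

/-- The transition matrix of the chain with the weights frozen at `v`. -/
noncomputable def trans (R : Matrix (Fin d) (Fin d) ℝ) (v : Fin d → ℝ) :
    Matrix (Fin d) (Fin d) ℝ :=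
  Matrix.of fun i j => R i j * v j / N R v i

/-- The fundamental matrix of the frozen chain, which solves its Poisson equation. -/
noncomputable def fund (R : Matrix (Fin d) (Fin d) ℝ) (p v : Fin d → ℝ) :
    Matrix (Fin d) (Fin d) ℝ :=
  (1 - trans R v + Matrix.of fun _ j => p j)⁻¹

/-- The one-step conditional expectation of the fundamental matrix. -/
noncomputable def fundStep (R : Matrix (Fin d) (Fin d) ℝ) (p v : Fin d → ℝ) :
    Matrix (Fin d) (Fin d) ℝ :=
  trans R v * fund R p v

/-- The chain frozen at `p` has only constant harmonic functions. -/
def IsErgodicAt (R : Matrix (Fin d) (Fin d) ℝ) (p : Fin d → ℝ) : Prop :=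
  ∀ x : Fin d → ℝ, trans R p *ᵥ x = x → ∀ i j, x i = x j

theorem sum_trans {R : Matrix (Fin d) (Fin d) ℝ} {v : Fin d → ℝ} {i : Fin d}
    (h : N R v i ≠ 0) : ∑ j, trans R v i j = 1 := by
  simp only [trans, Matrix.of_apply, ← Finset.sum_div]
  exact div_self h

theorem stat_vecMul_trans {R : Matrix (Fin d) (Fin d) ℝ} (hsymm : R.IsSymm) {v : Fin d → ℝ}
    (h : ∀ i, N R v i ≠ 0) : stat R v ᵥ* trans R v = stat R v := by
  ext j
  simp only [vecMul, dotProduct, trans, stat, Matrix.of_apply]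
  have h1 : ∀ i, v i * N R v i / H R v * (R i j * v j / N R v i)
      = R j i * v i * (v j / H R v) := fun i => by
    have := h i
    rw [hsymm.apply j i]
    field_simp
  rw [Finset.sum_congr rfl fun i _ => h1 i, ← Finset.sum_mul]
  change N R v j * _ = _
  ring

theorem sum_stat {R : Matrix (Fin d) (Fin d) ℝ} {v : Fin d → ℝ} (h : H R v ≠ 0) :
    ∑ j, stat R v j = 1 := by
  simp only [stat, ← Finset.sum_div]
  exact div_self h

/-- The Poisson equation solved by `fund`. -/
theorem fund_sub_fundStep {R : Matrix (Fin d) (Fin d) ℝ} (hsymm : R.IsSymm) {p v : Fin d → ℝ}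
    (hN : ∀ i, N R v i ≠ 0) (hH : H R v ≠ 0)
    (hdet : (1 - trans R v + Matrix.of fun _ j => p j).det ≠ 0) (i j : Fin d) :
    fund R p v i j - fundStep R p v i j = (if i = j then 1 else 0) - stat R v j := by
  set B : Matrix (Fin d) (Fin d) ℝ := 1 - trans R v + Matrix.of fun _ j => p j with hB
  have hBZ : B * fund R p v = 1 := Matrix.mul_nonsing_inv B hdet.isUnit
  -- `stat R v` is stationary for the chain frozen at `v`. This is why the rank-one term can use the
  -- fixed vector `p` for every `v`.
  have hpi : stat R v ᵥ* B = p := by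
    rw [hB, vecMul_add, vecMul_sub, vecMul_one, stat_vecMul_trans hsymm hN, sub_self, zero_add]
    ext k
    simp only [vecMul, dotProduct, Matrix.of_apply, ← Finset.sum_mul, sum_stat hH, one_mul]
  have hpZ : p ᵥ* fund R p v = stat R v := by
    conv_lhs => rw [← hpi]
    rw [vecMul_vecMul, hpi, hBZ, vecMul_one]
  have h1 := congrFun (congrFun hBZ i) j
  have h2 := congrFun hpZ j
  rw [hB, add_mul, sub_mul, one_mul, Matrix.add_apply, Matrix.sub_apply, Matrix.one_apply] at h1
  have h3 : ((Matrix.of fun _ j => p j : Matrix (Fin d) (Fin d) ℝ) * fund R p v) i j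
      = stat R v j := h2
  rw [h3] at h1
  rw [fundStep]
  linarith

theorem contDiffAt_det {E : Type*} [NormedAddCommGroup E] [NormedSpace ℝ E]
    {A : E → Matrix (Fin d) (Fin d) ℝ} {x : E} (h : ∀ i j, ContDiffAt ℝ 1 (fun v => A v i j) x) :
    ContDiffAt ℝ 1 (fun v => (A v).det) x := by
  simp only [Matrix.det_apply]
  refine ContDiffAt.sum fun σ _ => ?_
  refine ContDiffAt.const_smul _ ?_
  exact contDiffAt_prod fun i _ => h _ _

/-- Cramer's rule expresses the entries of the inverse as quotients of determinants. -/
theorem contDiffAt_inv_apply {E : Type*} [NormedAddCommGroup E] [NormedSpace ℝ E]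
    {A : E → Matrix (Fin d) (Fin d) ℝ} {x : E} (h : ∀ i j, ContDiffAt ℝ 1 (fun v => A v i j) x)
    (hdet : (A x).det ≠ 0) (i j : Fin d) :
    ContDiffAt ℝ 1 (fun v => (A v)⁻¹ i j) x := by
  simp only [Matrix.inv_def, Ring.inverse_eq_inv', Matrix.smul_apply, Matrix.adjugate_apply,
    smul_eq_mul]
  refine ((contDiffAt_det h).inv hdet).mul (contDiffAt_det fun a b => ?_)
  by_cases hab : a = j
  · subst hab
    simpa only [Matrix.updateRow_self] using contDiffAt_const
  · simpa only [Matrix.updateRow_ne hab] using h a b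

theorem contDiffAt_N (R : Matrix (Fin d) (Fin d) ℝ) (p : Fin d → ℝ) (i : Fin d) :
    ContDiffAt ℝ 1 (fun v => N R v i) p := by
  unfold N
  fun_prop

namespace IsInteriorCritical

variable {R : Matrix (Fin d) (Fin d) ℝ} {p : Fin d → ℝ}

theorem N_ne_zero (hp : IsInteriorCritical R p) (i : Fin d) : N R p i ≠ 0 := by
  rw [hp.N_eq]; exact hp.H_pos.ne'

theorem contDiffAt_trans (hp : IsInteriorCritical R p) (i j : Fin d) :
    ContDiffAt ℝ 1 (fun v => trans R v i j) p := by
  simp only [trans, Matrix.of_apply]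
  refine ContDiffAt.div ?_ (contDiffAt_N R p i) (hp.N_ne_zero i)
  fun_prop

theorem contDiffAt_one_sub_trans (hp : IsInteriorCritical R p) (i j : Fin d) :
    ContDiffAt ℝ 1 (fun v =>
      (1 - trans R v + Matrix.of fun _ j => p j : Matrix (Fin d) (Fin d) ℝ) i j) p := by
  simp only [Matrix.add_apply, Matrix.sub_apply, Matrix.of_apply]
  exact (contDiffAt_const.sub (hp.contDiffAt_trans i j)).add contDiffAt_const

theorem vecMul_trans (hsymm : R.IsSymm) (hp : IsInteriorCritical R p) : p ᵥ* trans R p = p := by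
  have h := stat_vecMul_trans hsymm hp.N_ne_zero
  rwa [hp.1.2.2] at h

/-- Pairing a null vector with the stationary `p` shows that its mean is zero. It is then harmonic,
so constant by ergodicity, so zero. -/
theorem det_ne_zero (hsymm : R.IsSymm) (hp : IsInteriorCritical R p) (herg : IsErgodicAt R p) :
    (1 - trans R p + Matrix.of fun _ j => p j).det ≠ 0 := by
  intro h0
  obtain ⟨x, hx, hBx⟩ := Matrix.exists_mulVec_eq_zero_iff.2 h0
  have hconst : (Matrix.of fun _ j => p j : Matrix (Fin d) (Fin d) ℝ) *ᵥ x
      = fun _ => p ⬝ᵥ x := rfl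
  rw [add_mulVec, sub_mulVec, one_mulVec, hconst] at hBx
  have hpx : p ⬝ᵥ x = 0 := by
    have h1 : p ⬝ᵥ (x - trans R p *ᵥ x + fun _ => p ⬝ᵥ x) = 0 := by rw [hBx, dotProduct_zero]
    rw [dotProduct_add, dotProduct_sub, Matrix.dotProduct_mulVec p, hp.vecMul_trans hsymm, sub_self,
      zero_add] at h1
    simpa only [dotProduct, ← Finset.sum_mul, hp.sum_eq_one, one_mul] using h1
  have hfix : trans R p *ᵥ x = x := by
    rw [hpx] at hBx
    ext i
    have := congrFun hBx i
    simp only [Pi.add_apply, Pi.sub_apply, Pi.zero_apply, add_zero] at this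
    linarith
  have hc := herg x hfix
  apply hx
  ext i
  have : p ⬝ᵥ x = x i := by
    simp only [dotProduct]
    rw [Finset.sum_congr rfl fun j _ => by rw [hc j i], ← Finset.sum_mul, hp.sum_eq_one, one_mul]
  rw [← this, hpx, Pi.zero_apply]

theorem contDiffAt_fund (hsymm : R.IsSymm) (hp : IsInteriorCritical R p)
    (herg : IsErgodicAt R p) (i j : Fin d) : ContDiffAt ℝ 1 (fun v => fund R p v i j) p :=
  contDiffAt_inv_apply hp.contDiffAt_one_sub_trans (hp.det_ne_zero hsymm herg) i j

theorem contDiffAt_fundStep (hsymm : R.IsSymm) (hp : IsInteriorCritical R p)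
    (herg : IsErgodicAt R p) (i j : Fin d) : ContDiffAt ℝ 1 (fun v => fundStep R p v i j) p := by
  simp only [fundStep, Matrix.mul_apply]
  exact ContDiffAt.sum fun k _ => (hp.contDiffAt_trans i k).mul (hp.contDiffAt_fund hsymm herg k j)

end IsInteriorCritical

/-- The conditional variance of `g` after one step from `i`, for transition probabilities `P`. -/
theorem sum_mul_sq_sub_sq {P g : Fin d → ℝ} (hP : ∑ j, P j = 1) :
    ∑ j, P j * g j ^ 2 - (∑ j, P j * g j) ^ 2 = ∑ j, P j * (g j - ∑ k, P k * g k) ^ 2 := by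
  set m := ∑ k, P k * g k with hm
  have h : ∀ j, P j * (g j - m) ^ 2 = P j * g j ^ 2 - 2 * m * (P j * g j) + m ^ 2 * P j :=
    fun j => by ring
  rw [Finset.sum_congr rfl fun j _ => h j, Finset.sum_add_distrib, Finset.sum_sub_distrib,
    ← Finset.mul_sum, ← Finset.mul_sum, ← hm, hP]
  ring

namespace IsInteriorCritical

variable {R : Matrix (Fin d) (Fin d) ℝ} {p : Fin d → ℝ}

/-- On W the Jacobian sends `p ℓ` to `p` times the frozen transition matrix applied to `ℓ`, so its
eigenvectors there come from eigenfunctions of the chain. -/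
theorem trans_mulVec (hp : IsInteriorCritical R p) {ℓ : Fin d → ℝ} {c : ℝ}
    (hsum : ∑ i, p i * ℓ i = 0)
    (h : jac R p *ᵥ (fun i => p i * ℓ i) = c • fun i => p i * ℓ i) :
    trans R p *ᵥ ℓ = c • ℓ := by
  ext i
  have h1 := congrFun h i
  rw [jac_mulVec, hsum, mul_zero, sub_zero, Pi.smul_apply, smul_eq_mul, mul_div_assoc,
    mul_left_comm] at h1
  have h2 := mul_left_cancel₀ (hp.pos i).ne' h1
  rw [Pi.smul_apply, smul_eq_mul, ← h2]
  simp only [trans, mulVec, dotProduct, Matrix.of_apply, Finset.sum_div, hp.N_eq]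
  exact Finset.sum_congr rfl fun j _ => by ring

/-- At some state, the noise in an unstable direction has positive conditional variance. -/
theorem exists_variance_pos (hsymm : R.IsSymm) (hnonneg : ∀ i j, 0 ≤ R i j)
    (hp : IsInteriorCritical R p) (herg : IsErgodicAt R p) {ℓ : Fin d → ℝ} {c : ℝ} (hc : 0 < c)
    (hnorm : ∑ i, p i * ℓ i ^ 2 = 1)
    (h : jac R p *ᵥ (fun i => p i * ℓ i) = c • fun i => p i * ℓ i) :
    ∃ i, 0 < ∑ j, trans R p i j * (fund R p p *ᵥ ℓ) j ^ 2
      - (∑ j, trans R p i j * (fund R p p *ᵥ ℓ) j) ^ 2 := by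
  have hsum : ∑ i, p i * ℓ i = 0 := hp.sum_eq_zero_of_eigenvector hsymm hc h
  have hM := hp.trans_mulVec hsum h
  have hMi : ∀ i, ∑ j, trans R p i j * ℓ j = c * ℓ i := fun i => congrFun hM i
  have hstat : ∀ j, ∑ i, p i * trans R p i j = p j := fun j =>
    congrFun (hp.vecMul_trans hsymm) j
  -- Under the stationary law `p`, the mean conditional variance of `ℓ` is its total variance 1
  -- minus the variance `c ^ 2` of its conditional mean.
  have htot : ∑ i, p i * (∑ j, trans R p i j * ℓ j ^ 2 - (∑ j, trans R p i j * ℓ j) ^ 2)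
      = 1 - c ^ 2 := by
    have h1 : ∑ i, p i * ∑ j, trans R p i j * ℓ j ^ 2 = 1 := by
      simp only [Finset.mul_sum]
      rw [Finset.sum_comm, ← hnorm]
      refine Finset.sum_congr rfl fun j _ => ?_
      rw [← hstat j, Finset.sum_mul]
      exact Finset.sum_congr rfl fun i _ => by ring
    simp only [mul_sub, Finset.sum_sub_distrib, h1, hMi]
    rw [Finset.sum_congr rfl fun i _ => show p i * (c * ℓ i) ^ 2 = c ^ 2 * (p i * ℓ i ^ 2) by ring,
      ← Finset.mul_sum, hnorm, mul_one]
  have htn : ∀ i j, 0 ≤ trans R p i j := fun i j => by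
    simp only [trans, Matrix.of_apply, hp.N_eq]
    have := hp.pos j
    have := hp.H_pos
    have := hnonneg i j
    positivity
  have hc1 : c ^ 2 ≤ 1 := by
    have : 0 ≤ 1 - c ^ 2 := by
      rw [← htot]
      refine Finset.sum_nonneg fun i _ => mul_nonneg (hp.pos i).le ?_
      rw [sum_mul_sq_sub_sq (sum_trans (hp.N_ne_zero i))]
      exact Finset.sum_nonneg fun j _ => mul_nonneg (htn i j) (sq_nonneg _)
    linarith
  have hcne : c ≠ 1 := by
    rintro rfl
    rw [one_smul] at hM
    have hconst := herg ℓ hM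
    have h0 : ∀ i, ℓ i = 0 := by
      intro i
      rw [← hsum, Finset.sum_congr rfl fun j _ => by rw [hconst j i], ← Finset.sum_mul,
        hp.sum_eq_one, one_mul]
    simp [h0] at hnorm
  -- Positivity of `c` excludes `c = -1`.
  have hc1' : c ^ 2 < 1 := lt_of_le_of_ne hc1 fun h1 => hcne (by nlinarith)
  have hc2 : 1 - c ≠ 0 := sub_ne_zero.2 hcne.symm
  -- The fundamental matrix only rescales the centered eigenfunction `ℓ`, so positive variance for
  -- `ℓ` suffices.
  have hfund : fund R p p *ᵥ ℓ = (1 - c)⁻¹ • ℓ := by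
    have hB : (1 - trans R p + Matrix.of fun _ j => p j) *ᵥ ℓ = (1 - c) • ℓ := by
      have hconst : (Matrix.of fun _ j => p j : Matrix (Fin d) (Fin d) ℝ) *ᵥ ℓ
          = fun _ => 0 := funext fun _ => hsum
      rw [add_mulVec, sub_mulVec, one_mulVec, hconst, hM]
      ext i
      simp [sub_mul]
    have h2 : fund R p p *ᵥ ((1 - trans R p + Matrix.of fun _ j => p j) *ᵥ ℓ) = ℓ := by
      rw [mulVec_mulVec, fund, Matrix.nonsing_inv_mul _ (hp.det_ne_zero hsymm herg).isUnit,
        one_mulVec]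
    rw [hB, mulVec_smul] at h2
    rw [← h2, smul_smul, inv_mul_cancel₀ hc2, one_smul, h2]
  have hex : ∃ i, 0 < ∑ j, trans R p i j * ℓ j ^ 2 - (∑ j, trans R p i j * ℓ j) ^ 2 := by
    by_contra! hle
    have : 1 - c ^ 2 ≤ 0 := by
      rw [← htot]
      exact Finset.sum_nonpos fun i _ => mul_nonpos_of_nonneg_of_nonpos (hp.pos i).le (hle i)
    linarith
  obtain ⟨i, hi⟩ := hex
  refine ⟨i, ?_⟩
  rw [hfund]
  have heq : ∑ j, trans R p i j * ((1 - c)⁻¹ • ℓ) j ^ 2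
      - (∑ j, trans R p i j * ((1 - c)⁻¹ • ℓ) j) ^ 2
      = ((1 - c)⁻¹) ^ 2 * (∑ j, trans R p i j * ℓ j ^ 2 - (∑ j, trans R p i j * ℓ j) ^ 2) := by
    have e1 : ∀ j, trans R p i j * ((1 - c)⁻¹ • ℓ) j ^ 2
        = ((1 - c)⁻¹) ^ 2 * (trans R p i j * ℓ j ^ 2) := fun j => by
      simp only [Pi.smul_apply, smul_eq_mul]; ring
    have e2 : ∀ j, trans R p i j * ((1 - c)⁻¹ • ℓ) j
        = (1 - c)⁻¹ * (trans R p i j * ℓ j) := fun j => by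
      simp only [Pi.smul_apply, smul_eq_mul]; ring
    simp only [e1, e2, ← Finset.mul_sum]
    ring
  rw [heq]
  positivity

end IsInteriorCritical

/-- What the frozen chains look like, uniformly for weights in the ball of radius `δ` about `p`. -/
structure LocalEstimates (R : Matrix (Fin d) (Fin d) ℝ) (p ℓ : Fin d → ℝ) (C σ : ℝ) (i₀ : Fin d)
    (ε δ : ℝ) : Prop where
  pos : 0 < δ
  -- This margin guarantees frequent visits to `i₀` in `le_sum_visits`.
  le : δ ≤ p i₀ / 10
  fund_le : ∀ v ∈ Metric.ball p δ, ∀ i j, |fund R p v i j| ≤ C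
  fundStep_le : ∀ v ∈ Metric.ball p δ, ∀ i j, |fundStep R p v i j| ≤ C
  poisson : ∀ v ∈ Metric.ball p δ, ∀ i j,
    fund R p v i j - fundStep R p v i j = (if i = j then 1 else 0) - stat R v j
  variance : ∀ v ∈ Metric.ball p δ, σ ≤ ∑ j, trans R v i₀ j * (fund R p v *ᵥ ℓ) j ^ 2
      - (∑ j, trans R v i₀ j * (fund R p v *ᵥ ℓ) j) ^ 2
  lipschitz : ∀ v ∈ Metric.ball p δ, ∀ v' ∈ Metric.ball p δ, ∀ i j,
    |fundStep R p v i j - fundStep R p v' i j| ≤ C * ‖v - v'‖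
  linearize : ∀ v ∈ Metric.ball p δ, ∀ v' ∈ Metric.ball p δ,
    ‖drift R v - drift R v' - jac R p *ᵥ (v - v')‖ ≤ ε * ‖v - v'‖

theorem exists_eventually_abs_le {E : Type*} [TopologicalSpace E] {f : E → ℝ} {x : E}
    (h : ContinuousAt f x) : ∀ᶠ v in 𝓝 x, |f v| ≤ |f x| + 1 :=
  (h.abs.tendsto.eventually (gt_mem_nhds (lt_add_one |f x|))).mono fun _ hv => hv.le

/-- The order of the quantifiers matters: `C`, `σ` and `i₀` are fixed before `ε`, which is later
taken small in terms of them. The bounds come from continuity at `p`, the Lipschitz estimate from C¹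
regularity, the linearization from the strict derivative. -/
theorem IsInteriorCritical.exists_localEstimates {R : Matrix (Fin d) (Fin d) ℝ} {p : Fin d → ℝ}
    (hsymm : R.IsSymm) (hnonneg : ∀ i j, 0 ≤ R i j)
    (hp : IsInteriorCritical R p) (herg : IsErgodicAt R p) {ℓ : Fin d → ℝ} {c : ℝ} (hc : 0 < c)
    (hnorm : ∑ i, p i * ℓ i ^ 2 = 1)
    (h : jac R p *ᵥ (fun i => p i * ℓ i) = c • fun i => p i * ℓ i) :
    ∃ C σ : ℝ, 0 < C ∧ 0 < σ ∧ ∃ i₀, ∀ ε > 0, ∃ δ, LocalEstimates R p ℓ C σ i₀ ε δ := by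
  obtain ⟨i₀, hi₀⟩ := hp.exists_variance_pos hsymm hnonneg herg hc hnorm h
  set s₀ := ∑ j, trans R p i₀ j * (fund R p p *ᵥ ℓ) j ^ 2
      - (∑ j, trans R p i₀ j * (fund R p p *ᵥ ℓ) j) ^ 2 with hs₀
  have hfc : ∀ i j, ContinuousAt (fun v => fund R p v i j) p := fun i j =>
    (hp.contDiffAt_fund hsymm herg i j).continuousAt
  have hsc : ∀ i j, ContinuousAt (fun v => fundStep R p v i j) p := fun i j =>
    (hp.contDiffAt_fundStep hsymm herg i j).continuousAt
  have htc : ∀ i j, ContinuousAt (fun v => trans R v i j) p := fun i j =>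
    (hp.contDiffAt_trans i j).continuousAt
  have hlip : ∀ i j, ∃ K : NNReal, ∃ t ∈ 𝓝 p, LipschitzOnWith K (fun v => fundStep R p v i j) t :=
    fun i j => (hp.contDiffAt_fundStep hsymm herg i j).exists_lipschitzOnWith
  choose K t ht hK using hlip
  let C : ℝ := 1 + ∑ i, ∑ j, (|fund R p p i j| + 1 + (|fundStep R p p i j| + 1) + (K i j : ℝ))
  have hterm : ∀ i j, |fund R p p i j| + 1 + (|fundStep R p p i j| + 1) + (K i j : ℝ) ≤ C := by
    intro i j
    have hnn : ∀ i j, 0 ≤ |fund R p p i j| + 1 + (|fundStep R p p i j| + 1) + (K i j : ℝ) :=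
      fun i j => by positivity
    have h1 := Finset.single_le_sum
      (f := fun j => |fund R p p i j| + 1 + (|fundStep R p p i j| + 1) + (K i j : ℝ))
      (fun j _ => hnn i j) (Finset.mem_univ j)
    have h2 := Finset.single_le_sum
      (f := fun i => ∑ j, (|fund R p p i j| + 1 + (|fundStep R p p i j| + 1) + (K i j : ℝ)))
      (fun i _ => Finset.sum_nonneg fun j _ => hnn i j) (Finset.mem_univ i)
    exact (h1.trans h2).trans (by simp only [C]; linarith)
  have hCpos : 0 < C := by
    have := hterm i₀ i₀
    refine lt_of_lt_of_le ?_ this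
    positivity
  refine ⟨C, s₀ / 2, hCpos, by positivity, i₀, fun ε hε => ?_⟩
  have hvar : ContinuousAt (fun v => ∑ j, trans R v i₀ j * (fund R p v *ᵥ ℓ) j ^ 2
      - (∑ j, trans R v i₀ j * (fund R p v *ᵥ ℓ) j) ^ 2) p := by
    have hg : ∀ j, ContinuousAt (fun v => (fund R p v *ᵥ ℓ) j) p := fun j => by
      simp only [mulVec, dotProduct]
      exact tendsto_finsetSum _ fun k _ => (hfc j k).mul continuousAt_const
    refine ContinuousAt.sub ?_ (ContinuousAt.pow ?_ 2)
    · exact tendsto_finsetSum _ fun j _ => (htc i₀ j).mul ((hg j).pow 2)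
    · exact tendsto_finsetSum _ fun j _ => (htc i₀ j).mul (hg j)
  have hNe : ∀ᶠ v in 𝓝 p, ∀ i, N R v i ≠ 0 := Filter.eventually_all.2 fun i =>
    (contDiffAt_N R p i).continuousAt.eventually_ne (hp.N_ne_zero i)
  have hHe : ∀ᶠ v in 𝓝 p, H R v ≠ 0 := by
    have : ContinuousAt (H R) p :=
      tendsto_finsetSum _ fun i _ =>
        (continuousAt_apply i p).mul (contDiffAt_N R p i).continuousAt
    exact this.eventually_ne hp.H_pos.ne'
  have hde : ∀ᶠ v in 𝓝 p, (1 - trans R v + Matrix.of fun _ j => p j).det ≠ 0 :=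
    (contDiffAt_det hp.contDiffAt_one_sub_trans).continuousAt.eventually_ne
      (hp.det_ne_zero hsymm herg)
  have hf : ∀ᶠ v in 𝓝 p, ∀ i j, |fund R p v i j| ≤ C := by
    refine Filter.eventually_all.2 fun i => Filter.eventually_all.2 fun j => ?_
    filter_upwards [exists_eventually_abs_le (hfc i j)] with v hv
    have := hterm i j
    have := abs_nonneg (fundStep R p p i j)
    have := (K i j).coe_nonneg
    linarith
  have hs : ∀ᶠ v in 𝓝 p, ∀ i j, |fundStep R p v i j| ≤ C := by
    refine Filter.eventually_all.2 fun i => Filter.eventually_all.2 fun j => ?_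
    filter_upwards [exists_eventually_abs_le (hsc i j)] with v hv
    have := hterm i j
    have := abs_nonneg (fund R p p i j)
    have := (K i j).coe_nonneg
    linarith
  have hve : ∀ᶠ v in 𝓝 p, s₀ / 2 ≤ ∑ j, trans R v i₀ j * (fund R p v *ᵥ ℓ) j ^ 2
      - (∑ j, trans R v i₀ j * (fund R p v *ᵥ ℓ) j) ^ 2 :=
    (hvar.tendsto.eventually (lt_mem_nhds (half_lt_self hi₀))).mono fun _ hv => hv.le
  have hte : ∀ᶠ v in 𝓝 p, ∀ i j, v ∈ t i j :=
    Filter.eventually_all.2 fun i => Filter.eventually_all.2 fun j => ht i j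
  obtain ⟨u, hu, happ⟩ := (hp.hasStrictFDerivAt_drift hsymm).approximates_deriv_on_nhds
    (c := ⟨ε, hε.le⟩) (Or.inr (by exact hε))
  obtain ⟨δ, hδ, hball⟩ := Metric.eventually_nhds_iff_ball.1
    (hNe.and (hHe.and (hde.and (hf.and (hs.and (hve.and (hte.and hu)))))))
  have hp0 := hp.pos i₀
  refine ⟨min δ (p i₀ / 10), by positivity, min_le_right _ _, ?_, ?_, ?_, ?_, ?_, ?_⟩
  all_goals
    intro v hv
    obtain ⟨h1, h2, h3, h4, h5, h6, h7, h8⟩ :=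
      hball v (Metric.ball_subset_ball (min_le_left _ _) hv)
  · exact h4
  · exact h5
  · exact fund_sub_fundStep hsymm h1 h2 h3
  · exact h6
  · intro v' hv' i j
    obtain ⟨-, -, -, -, -, -, h7', -⟩ := hball v' (Metric.ball_subset_ball (min_le_left _ _) hv')
    have hl := (hK i j).dist_le_mul v (h7 i j) v' (h7' i j)
    rw [Real.dist_eq, dist_eq_norm] at hl
    refine hl.trans (mul_le_mul_of_nonneg_right ?_ (norm_nonneg _))
    have := hterm i j
    have := abs_nonneg (fund R p p i j)
    have := abs_nonneg (fundStep R p p i j)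
    linarith
  · intro v' hv'
    obtain ⟨-, -, -, -, -, -, -, h8'⟩ := hball v' (Metric.ball_subset_ball (min_le_left _ _) hv')
    exact happ v h8 v' h8'

end Frozen

end VRRW

namespace VRRW

open MeasureTheory

/-! ### Scalar linear recursions and L² bounds for their bounded solutions. -/

section Perron

/-- The product of the growth factors `1 + κ γ_i` for `a ≤ i < b`. -/
noncomputable def growth (κ : ℝ) (γ : ℕ → ℝ) (a b : ℕ) : ℝ := ∏ i ∈ Finset.Ico a b, (1 + κ * γ i)

theorem growth_self (κ : ℝ) (γ : ℕ → ℝ) (a : ℕ) : growth κ γ a a = 1 := by simp [growth]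

theorem growth_succ (κ : ℝ) (γ : ℕ → ℝ) {a b : ℕ} (h : a ≤ b) :
    growth κ γ a (b + 1) = growth κ γ a b * (1 + κ * γ b) :=
  Finset.prod_Ico_succ_top h _

variable {κ : ℝ} {γ : ℕ → ℝ}

/-- Variation of constants, forward in time. -/
theorem eq_growth_mul_add_sum {w f : ℕ → ℝ} {n : ℕ}
    (h : ∀ k, n ≤ k → w (k + 1) = w k + γ k * (κ * w k + f k)) {k : ℕ} (hk : n ≤ k) :
    w k = growth κ γ n k * w n + ∑ l ∈ Finset.Ico n k, growth κ γ (l + 1) k * γ l * f l := by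
  induction k, hk using Nat.le_induction with
  | base => simp [growth_self]
  | succ k hk ih =>
    have h1 : ∑ l ∈ Finset.Ico n k, growth κ γ (l + 1) (k + 1) * γ l * f l
        = (1 + κ * γ k) * ∑ l ∈ Finset.Ico n k, growth κ γ (l + 1) k * γ l * f l := by
      rw [Finset.mul_sum]
      refine Finset.sum_congr rfl fun l hl => ?_
      rw [growth_succ _ _ (Finset.mem_Ico.1 hl).2]
      ring
    rw [Finset.sum_Ico_succ_top hk, h1, growth_self, growth_succ _ _ hk, h k hk]
    linear_combination (1 + κ * γ k) * ih

/-- Variation of constants, backward in time. -/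
theorem eq_inv_growth_mul_sub_sum {w f : ℕ → ℝ} {n : ℕ} (hpos : ∀ k, n ≤ k → 0 < 1 + κ * γ k)
    (h : ∀ k, n ≤ k → w (k + 1) = w k + γ k * (κ * w k + f k)) {m : ℕ} (hm : n ≤ m) :
    w n = (growth κ γ n m)⁻¹ * w m
      - ∑ l ∈ Finset.Ico n m, (growth κ γ n (l + 1))⁻¹ * γ l * f l := by
  induction m, hm using Nat.le_induction with
  | base => simp [growth_self]
  | succ m hm ih =>
    have hm' := (hpos m hm).ne'
    rw [Finset.sum_Ico_succ_top hm, growth_succ _ _ hm, h m hm, mul_inv]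
    have : (growth κ γ n m)⁻¹ * (1 + κ * γ m)⁻¹ * (w m + γ m * (κ * w m + f m))
        = (growth κ γ n m)⁻¹ * w m
          + (growth κ γ n m)⁻¹ * (1 + κ * γ m)⁻¹ * γ m * f m := by
      field_simp
      ring
    linear_combination ih - this

theorem growth_pos {n : ℕ} (hpos : ∀ k, n ≤ k → 0 < 1 + κ * γ k) {a : ℕ} (ha : n ≤ a) (b : ℕ) :
    0 < growth κ γ a b :=
  Finset.prod_pos fun i hi => hpos i (ha.trans (Finset.mem_Ico.1 hi).1)

theorem growth_le_one {n : ℕ} (hκ : κ ≤ 0) (hγ : ∀ k, 0 ≤ γ k)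
    (hpos : ∀ k, n ≤ k → 0 < 1 + κ * γ k) {a : ℕ} (ha : n ≤ a) (b : ℕ) : growth κ γ a b ≤ 1 :=
  Finset.prod_le_one (fun i hi => (hpos i (ha.trans (Finset.mem_Ico.1 hi).1)).le) fun i _ => by
    nlinarith [hγ i]

theorem one_le_growth (hκ : 0 ≤ κ) (hγ : ∀ k, 0 ≤ γ k) (a b : ℕ) : 1 ≤ growth κ γ a b :=
  Finset.one_le_prod fun i _ => by nlinarith [mul_nonneg hκ (hγ i)]

/-- The left side is `1 - growth κ γ n k`, so the bound does not depend on the number of steps. -/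
theorem abs_mul_sum_growth_le {n : ℕ} (hκ : κ ≤ 0) (hpos : ∀ k, n ≤ k → 0 < 1 + κ * γ k)
    {k : ℕ} (hk : n ≤ k) : |κ| * ∑ l ∈ Finset.Ico n k, growth κ γ (l + 1) k * γ l ≤ 1 := by
  induction k, hk using Nat.le_induction with
  | base => simp
  | succ k hk ih =>
    have h1 : ∑ l ∈ Finset.Ico n k, growth κ γ (l + 1) (k + 1) * γ l
        = (1 + κ * γ k) * ∑ l ∈ Finset.Ico n k, growth κ γ (l + 1) k * γ l := by
      rw [Finset.mul_sum]
      refine Finset.sum_congr rfl fun l hl => ?_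
      rw [growth_succ _ _ (Finset.mem_Ico.1 hl).2]
      ring
    rw [Finset.sum_Ico_succ_top hk, h1, growth_self]
    have h2 := hpos k hk
    have h3 := mul_le_mul_of_nonneg_left ih h2.le
    rw [abs_of_nonpos hκ] at h3 ⊢
    linarith

theorem mul_sum_inv_growth_le {n : ℕ} (hκ : 0 ≤ κ) (hγ : ∀ k, 0 ≤ γ k) {m : ℕ} (hm : n ≤ m) :
    κ * ∑ l ∈ Finset.Ico n m, (growth κ γ n (l + 1))⁻¹ * γ l ≤ 1 := by
  have hpos : ∀ k, n ≤ k → 0 < 1 + κ * γ k := fun k _ => by nlinarith [hγ k]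
  have hP : 0 < growth κ γ n m := growth_pos hpos le_rfl m
  have h : κ * ∑ l ∈ Finset.Ico n m, (growth κ γ n (l + 1))⁻¹ * γ l
      = 1 - (growth κ γ n m)⁻¹ := by
    -- The constant 1 solves the recursion with forcing `-κ`.
    have := eq_inv_growth_mul_sub_sum (w := fun _ => 1) (f := fun _ => -κ) hpos
      (fun k _ => by ring) hm
    rw [← Finset.sum_mul] at this
    linarith
  rw [h]
  have := inv_pos.2 hP
  linarith

theorem one_add_sum_le_growth (hκ : 0 ≤ κ) (hγ : ∀ k, 0 ≤ γ k) (n m : ℕ) :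
    1 + κ * ∑ l ∈ Finset.Ico n m, γ l ≤ growth κ γ n m := by
  rcases le_or_gt n m with h | h
  · induction m, h using Nat.le_induction with
    | base => simp [growth_self]
    | succ m h ih =>
      rw [Finset.sum_Ico_succ_top h, growth_succ _ _ h]
      nlinarith [mul_nonneg hκ (hγ m), one_le_growth hκ hγ n m]
  · simp [growth, Finset.Ico_eq_empty_of_le h.le]

theorem tendsto_inv_growth {n : ℕ} (hκ : 0 < κ) (hγ : ∀ k, 0 ≤ γ k)
    (hdiv : Filter.Tendsto (fun m => ∑ l ∈ Finset.Ico n m, γ l) Filter.atTop Filter.atTop) :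
    Filter.Tendsto (fun m => (growth κ γ n m)⁻¹) Filter.atTop (𝓝 0) := by
  refine Filter.Tendsto.inv_tendsto_atTop ?_
  refine Filter.tendsto_atTop_mono (one_add_sum_le_growth hκ.le hγ n) ?_
  exact Filter.tendsto_atTop_add_const_left _ _ (hdiv.const_mul_atTop hκ)

variable {Ω : Type*} [MeasurableSpace Ω] {ν : Measure Ω}

/-- Weighted Cauchy–Schwarz. It uses no orthogonality between the `r l`, so it serves for coupling
errors, which are not martingale differences. -/
theorem integral_sq_weighted_sum_le {s : Finset ℕ} {α : ℕ → ℝ} (hα : ∀ l ∈ s, 0 ≤ α l) {L : ℝ}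
    (hL : ∑ l ∈ s, α l ≤ L) {r : ℕ → Ω → ℝ} (hr : ∀ l, MemLp (r l) 2 ν) {ρ : ℝ} (hρ : 0 ≤ ρ)
    (hrρ : ∀ l ∈ s, ∫ ω, r l ω ^ 2 ∂ν ≤ ρ) :
    ∫ ω, (∑ l ∈ s, α l * r l ω) ^ 2 ∂ν ≤ L ^ 2 * ρ := by
  have hL0 : 0 ≤ ∑ l ∈ s, α l := Finset.sum_nonneg hα
  have hint : ∀ l ∈ s, Integrable (fun ω => α l * r l ω ^ 2) ν := fun l _ =>
    (hr l).integrable_sq.const_mul _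
  calc ∫ ω, (∑ l ∈ s, α l * r l ω) ^ 2 ∂ν
      ≤ ∫ ω, (∑ l ∈ s, α l) * ∑ l ∈ s, α l * r l ω ^ 2 ∂ν := by
        refine integral_mono ?_ ((integrable_finsetSum s hint).const_mul _) fun ω => ?_
        · exact (memLp_finsetSum s fun l _ => (hr l).const_mul (α l)).integrable_sq
        · exact Finset.sum_sq_le_sum_mul_sum_of_sq_le_mul s hα
            (fun l hl => mul_nonneg (hα l hl) (sq_nonneg _)) fun l _ => le_of_eq (by ring)
    _ = (∑ l ∈ s, α l) * ∑ l ∈ s, α l * ∫ ω, r l ω ^ 2 ∂ν := by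
        rw [integral_const_mul, integral_finsetSum s hint]
        simp only [integral_const_mul]
    _ ≤ (∑ l ∈ s, α l) * ∑ l ∈ s, α l * ρ :=
        mul_le_mul_of_nonneg_left (Finset.sum_le_sum fun l hl =>
          mul_le_mul_of_nonneg_left (hrρ l hl) (hα l hl)) hL0
    _ = (∑ l ∈ s, α l) ^ 2 * ρ := by rw [← Finset.sum_mul]; ring
    _ ≤ L ^ 2 * ρ := by gcongr

/-- A family of scalar linear recursions with small coupling `r` and noise `ξ`, started from `0`
and bounded in `L²`. -/
structure PerronSystem {ι : Type*} [Fintype ι] (ν : Measure Ω) (n : ℕ) (γ : ℕ → ℝ) (κ : ι → ℝ)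
    (L ε a b : ℝ) (w r ξ : ι → ℕ → Ω → ℝ) : Prop where
  step_pos : ∀ k, 0 < γ k
  diverges : ∀ k, Filter.Tendsto (fun m => ∑ i ∈ Finset.Ico k m, γ i) Filter.atTop Filter.atTop
  le_rate : ∀ j, 1 ≤ L * |κ j|
  factor_pos : ∀ j k, n ≤ k → 0 < 1 + κ j * γ k
  coupling_nonneg : 0 ≤ ε
  error_nonneg : 0 ≤ a
  memLp : ∀ j k, MemLp (w j k) 2 ν
  memLp_noise : ∀ j k, MemLp (ξ j k) 2 ν
  memLp_rest : ∀ j k, MemLp (r j k) 2 ν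
  -- The value of `S` enters no estimate. It only makes the supremum in `integral_sq_le` finite,
  -- without which that supremum could not be absorbed.
  bounded : ∃ S, ∀ j k, n ≤ k → ∫ ω, w j k ω ^ 2 ∂ν ≤ S
  start : ∀ j, ∀ᵐ ω ∂ν, w j n ω = 0
  recursion : ∀ j k, n ≤ k → ∀ ω,
    w j (k + 1) ω = w j k ω + γ k * (κ j * w j k ω + (r j k ω + ξ j k ω))
  rest_le : ∀ j k, n ≤ k →
    ∫ ω, r j k ω ^ 2 ∂ν ≤ ε * ∑ i, ∫ ω, w i k ω ^ 2 ∂ν + a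
  noise_le : ∀ j (c : ℕ → ℝ) (k m : ℕ), n ≤ k → (∀ l ∈ Finset.Ico k m, |c l| ≤ 1) →
    ∫ ω, (∑ l ∈ Finset.Ico k m, c l * γ l * ξ j l ω) ^ 2 ∂ν ≤ b

namespace PerronSystem

variable {ι : Type*} [Fintype ι] {n : ℕ} {κ : ι → ℝ} {L ε a b : ℝ} {w r ξ : ι → ℕ → Ω → ℝ}

theorem sum_le_rate (hS : PerronSystem ν n γ κ L ε a b w r ξ) (j : ι) {t : ℝ}
    (h : |κ j| * t ≤ 1) : t ≤ L := by
  have h1 := hS.le_rate j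
  have hκ : 0 < |κ j| := by
    by_contra! h0
    have h2 := le_antisymm h0 (abs_nonneg _)
    rw [h2, mul_zero] at h1
    linarith
  by_contra! hlt
  nlinarith

theorem rest_le_of_bound (hS : PerronSystem ν n γ κ L ε a b w r ξ) {s : ℝ}
    (hs : ∀ j k, n ≤ k → ∫ ω, w j k ω ^ 2 ∂ν ≤ s) (j : ι) {k : ℕ} (hk : n ≤ k) :
    ∫ ω, r j k ω ^ 2 ∂ν ≤ ε * (Fintype.card ι * s) + a := by
  refine (hS.rest_le j k hk).trans ?_
  have h1 : ∑ i, ∫ ω, w i k ω ^ 2 ∂ν ≤ ∑ _i : ι, s := Finset.sum_le_sum fun i _ => hs i k hk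
  rw [Finset.sum_const, Finset.card_univ, nsmul_eq_mul] at h1
  have := mul_le_mul_of_nonneg_left h1 hS.coupling_nonneg
  linarith

theorem integral_sq_add_le {f g : Ω → ℝ} (hf : MemLp f 2 ν) (hg : MemLp g 2 ν) :
    ∫ ω, (f ω + g ω) ^ 2 ∂ν ≤ 2 * ∫ ω, f ω ^ 2 ∂ν + 2 * ∫ ω, g ω ^ 2 ∂ν := by
  rw [← integral_const_mul, ← integral_const_mul,
    ← integral_add (hf.integrable_sq.const_mul 2) (hg.integrable_sq.const_mul 2)]
  refine integral_mono (hf.add hg).integrable_sq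
    ((hf.integrable_sq.const_mul 2).add (hg.integrable_sq.const_mul 2)) fun ω => ?_
  simp only
  nlinarith [sq_nonneg (f ω - g ω)]

theorem memLp_sum {s : Finset ℕ} {α : ℕ → ℝ} {f : ℕ → Ω → ℝ} (hf : ∀ l, MemLp (f l) 2 ν) :
    MemLp (fun ω => ∑ l ∈ s, α l * f l ω) 2 ν :=
  memLp_finsetSum s fun l _ => (hf l).const_mul (α l)

/-- A stable direction is solved forward from its zero start: the propagators are at most 1, and
their sum against the step sizes is at most `L`. -/
theorem bound_stable (hS : PerronSystem ν n γ κ L ε a b w r ξ) {s : ℝ} (hs0 : 0 ≤ s)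
    (hs : ∀ j k, n ≤ k → ∫ ω, w j k ω ^ 2 ∂ν ≤ s) {j : ι} (hj : κ j ≤ 0) {k : ℕ} (hk : n ≤ k) :
    ∫ ω, w j k ω ^ 2 ∂ν ≤ 2 * (L ^ 2 * (ε * (Fintype.card ι * s) + a)) + 2 * b := by
  have hpos := hS.factor_pos j
  have hγ : ∀ k, 0 ≤ γ k := fun k => (hS.step_pos k).le
  have hρ : 0 ≤ ε * (Fintype.card ι * s) + a := by
    have := hS.coupling_nonneg
    have := hS.error_nonneg
    positivity
  have hsol : ∀ᵐ ω ∂ν, w j k ω ^ 2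
      = (∑ l ∈ Finset.Ico n k, growth (κ j) γ (l + 1) k * γ l * r j l ω
        + ∑ l ∈ Finset.Ico n k, growth (κ j) γ (l + 1) k * γ l * ξ j l ω) ^ 2 := by
    filter_upwards [hS.start j] with ω hω
    have h1 := eq_growth_mul_add_sum (w := fun k => w j k ω) (f := fun k => r j k ω + ξ j k ω)
      (κ := κ j) (fun k hk => hS.recursion j k hk ω) hk
    simp only [hω, mul_zero, zero_add, mul_add, Finset.sum_add_distrib] at h1
    rw [h1]
  rw [integral_congr_ae hsol]
  refine (integral_sq_add_le (memLp_sum (hS.memLp_rest j)) (memLp_sum (hS.memLp_noise j))).trans ?_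
  have h1 := integral_sq_weighted_sum_le (s := Finset.Ico n k) (r := r j) (ν := ν)
    (α := fun l => growth (κ j) γ (l + 1) k * γ l) (L := L)
    (fun l hl => mul_nonneg (growth_pos hpos ((Finset.mem_Ico.1 hl).1.trans (Nat.le_succ l)) k).le
      (hγ l)) (hS.sum_le_rate j (abs_mul_sum_growth_le hj hpos hk)) (hS.memLp_rest j) hρ
    (fun l hl => hS.rest_le_of_bound hs j (Finset.mem_Ico.1 hl).1)
  have h2 := hS.noise_le j (fun l => growth (κ j) γ (l + 1) k) n k le_rfl (fun l hl => by
    have hl' := (Finset.mem_Ico.1 hl).1.trans (Nat.le_succ l)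
    rw [abs_of_pos (growth_pos hpos hl' k)]
    exact growth_le_one hj hγ hpos hl' k)
  linarith

theorem rest_unstable (hS : PerronSystem ν n γ κ L ε a b w r ξ) {s : ℝ} (hs0 : 0 ≤ s)
    (hs : ∀ j k, n ≤ k → ∫ ω, w j k ω ^ 2 ∂ν ≤ s) {j : ι} (hj : 0 < κ j) {k m : ℕ} (hk : n ≤ k)
    (hm : k ≤ m) :
    ∫ ω, (∑ l ∈ Finset.Ico k m, (growth (κ j) γ k (l + 1))⁻¹ * γ l * r j l ω) ^ 2 ∂ν
      ≤ L ^ 2 * (ε * (Fintype.card ι * s) + a) := by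
  have hγ : ∀ k, 0 ≤ γ k := fun k => (hS.step_pos k).le
  have hpos : ∀ l, k ≤ l → 0 < 1 + κ j * γ l := fun l hl => hS.factor_pos j l (hk.trans hl)
  have hρ : 0 ≤ ε * (Fintype.card ι * s) + a := by
    have := hS.coupling_nonneg
    have := hS.error_nonneg
    positivity
  refine integral_sq_weighted_sum_le (α := fun l => (growth (κ j) γ k (l + 1))⁻¹ * γ l)
    (fun l _ => mul_nonneg (inv_nonneg.2 (growth_pos hpos le_rfl _).le) (hγ l))
    (hS.sum_le_rate j ?_) (hS.memLp_rest j) hρ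
    (fun l hl => hS.rest_le_of_bound hs j (hk.trans (Finset.mem_Ico.1 hl).1))
  rw [abs_of_pos hj]
  exact mul_sum_inv_growth_le hj.le hγ hm

/-- An unstable direction is solved backward from a late time `m`. As `m` grows, the terminal value
is bounded in L² and its factor tends to zero, so only coupling and noise remain. -/
theorem bound_unstable (hS : PerronSystem ν n γ κ L ε a b w r ξ) {s : ℝ} (hs0 : 0 ≤ s)
    (hs : ∀ j k, n ≤ k → ∫ ω, w j k ω ^ 2 ∂ν ≤ s) {j : ι} (hj : 0 < κ j) {k : ℕ} (hk : n ≤ k) :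
    ∫ ω, w j k ω ^ 2 ∂ν ≤ 4 * (L ^ 2 * (ε * (Fintype.card ι * s) + a)) + 4 * b := by
  have hγ : ∀ k, 0 ≤ γ k := fun k => (hS.step_pos k).le
  have hpos : ∀ l, k ≤ l → 0 < 1 + κ j * γ l := fun l hl => hS.factor_pos j l (hk.trans hl)
  have hfin : ∀ m, k ≤ m → ∫ ω, w j k ω ^ 2 ∂ν ≤
      2 * (((growth (κ j) γ k m)⁻¹) ^ 2 * s)
        + (4 * (L ^ 2 * (ε * (Fintype.card ι * s) + a)) + 4 * b) := by
    intro m hm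
    have hsol : ∀ ω, w j k ω ^ 2
        = ((growth (κ j) γ k m)⁻¹ * w j m ω
          + (-1) * (∑ l ∈ Finset.Ico k m, (growth (κ j) γ k (l + 1))⁻¹ * γ l * r j l ω
          + ∑ l ∈ Finset.Ico k m, (growth (κ j) γ k (l + 1))⁻¹ * γ l * ξ j l ω)) ^ 2 := by
      intro ω
      have h1 := eq_inv_growth_mul_sub_sum (w := fun k => w j k ω)
        (f := fun k => r j k ω + ξ j k ω) (κ := κ j) hpos
        (fun l hl => hS.recursion j l (hk.trans hl) ω) hm
      simp only [mul_add, Finset.sum_add_distrib] at h1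
      rw [h1]
      ring
    simp only [hsol]
    have hA := memLp_sum (s := Finset.Ico k m) (α := fun l => (growth (κ j) γ k (l + 1))⁻¹ * γ l)
      (hS.memLp_rest j)
    have hB := memLp_sum (s := Finset.Ico k m) (α := fun l => (growth (κ j) γ k (l + 1))⁻¹ * γ l)
      (hS.memLp_noise j)
    refine (integral_sq_add_le ((hS.memLp j m).const_mul _) ((hA.add hB).const_mul _)).trans ?_
    have h1 := integral_sq_add_le hA hB
    have h2 := hS.rest_unstable hs0 hs hj hk hm
    have h3 := hS.noise_le j (fun l => (growth (κ j) γ k (l + 1))⁻¹) k m hk (fun l _ => by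
      rw [abs_of_pos (inv_pos.2 (growth_pos hpos le_rfl _))]
      exact inv_le_one_of_one_le₀ (one_le_growth hj.le hγ _ _))
    have h4 := hs j m (hk.trans hm)
    simp only [mul_pow, Pi.add_apply, integral_const_mul]
    have h5 := mul_le_mul_of_nonneg_left h4 (sq_nonneg (growth (κ j) γ k m)⁻¹)
    linarith
  have hlim : Filter.Tendsto (fun m => 2 * (((growth (κ j) γ k m)⁻¹) ^ 2 * s)
        + (4 * (L ^ 2 * (ε * (Fintype.card ι * s) + a)) + 4 * b)) Filter.atTop
      (𝓝 (2 * (0 ^ 2 * s) + (4 * (L ^ 2 * (ε * (Fintype.card ι * s) + a)) + 4 * b))) :=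
    ((((tendsto_inv_growth hj hγ (hS.diverges k)).pow 2).mul_const s).const_mul 2).add_const _
  have := ge_of_tendsto hlim (Filter.eventually_atTop.2 ⟨k, hfin⟩)
  simpa using this

/-- The `L²` size of a bounded solution is controlled by the noise. -/
theorem integral_sq_le [Nonempty ι] (hS : PerronSystem ν n γ κ L ε a b w r ξ) (hb : 0 ≤ b)
    (hε : 8 * (L ^ 2 * (ε * Fintype.card ι)) ≤ 1) (j : ι) {k : ℕ} (hk : n ≤ k) :
    ∫ ω, w j k ω ^ 2 ∂ν ≤ 8 * (L ^ 2 * a + b) := by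
  obtain ⟨S, hSb⟩ := hS.bounded
  let f : ι × {k // n ≤ k} → ℝ := fun x => ∫ ω, w x.1 x.2 ω ^ 2 ∂ν
  have hbdd : BddAbove (Set.range f) := ⟨S, by rintro _ ⟨x, rfl⟩; exact hSb x.1 x.2 x.2.2⟩
  have hle : ∀ j k, n ≤ k → ∫ ω, w j k ω ^ 2 ∂ν ≤ iSup f := fun j k hk =>
    le_ciSup hbdd (⟨j, ⟨k, hk⟩⟩ : ι × {k // n ≤ k})
  have h0 : 0 ≤ iSup f := (integral_nonneg fun ω => sq_nonneg _).trans (hle j n le_rfl)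
  have hne : Nonempty (ι × {k // n ≤ k}) := ⟨⟨j, ⟨n, le_rfl⟩⟩⟩
  have hρ : 0 ≤ L ^ 2 * (ε * (Fintype.card ι * iSup f) + a) := by
    have := hS.coupling_nonneg
    have := hS.error_nonneg
    positivity
  -- By `hε` the coupling contributes at most half of the supremum, which is absorbed on the left.
  have hsup : iSup f ≤ 4 * (L ^ 2 * (ε * (Fintype.card ι * iSup f) + a)) + 4 * b := by
    refine ciSup_le fun x => ?_
    rcases le_or_gt (κ x.1) 0 with h | h
    · refine (hS.bound_stable h0 hle h x.2.2).trans ?_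
      linarith
    · exact hS.bound_unstable h0 hle h x.2.2
  have h1 := mul_le_mul_of_nonneg_right hε h0
  have h2 := hle j k hk
  linarith

/-- The discounted noise in an unstable direction is small compared to the total noise. -/
theorem eventually_noise_le [Nonempty ι] (hS : PerronSystem ν n γ κ L ε a b w r ξ) (hb : 0 ≤ b)
    (hε : 8 * (L ^ 2 * (ε * Fintype.card ι)) ≤ 1) {j : ι} (hj : 0 < κ j) {η : ℝ} (hη : 0 < η) :
    ∀ᶠ m in Filter.atTop,
      ∫ ω, (∑ l ∈ Finset.Ico n m, (growth (κ j) γ n (l + 1))⁻¹ * γ l * ξ j l ω) ^ 2 ∂ν ≤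
        η + 2 * (L ^ 2 * (ε * (Fintype.card ι * (8 * (L ^ 2 * a + b))) + a)) := by
  have hγ : ∀ k, 0 ≤ γ k := fun k => (hS.step_pos k).le
  have hs : ∀ j k, n ≤ k → ∫ ω, w j k ω ^ 2 ∂ν ≤ 8 * (L ^ 2 * a + b) := fun j k hk =>
    hS.integral_sq_le hb hε j hk
  have hs0 : 0 ≤ 8 * (L ^ 2 * a + b) := by
    have := hS.error_nonneg
    positivity
  have hlim : Filter.Tendsto (fun m => 2 * (((growth (κ j) γ n m)⁻¹) ^ 2 * (8 * (L ^ 2 * a + b))))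
      Filter.atTop (𝓝 (2 * (0 ^ 2 * (8 * (L ^ 2 * a + b))))) :=
    (((tendsto_inv_growth hj hγ (hS.diverges n)).pow 2).mul_const _).const_mul 2
  have hlt : 2 * (0 ^ 2 * (8 * (L ^ 2 * a + b))) < η := by simpa using hη
  filter_upwards [hlim.eventually (gt_mem_nhds hlt), Filter.eventually_ge_atTop n] with m hm hnm
  -- The solution vanishes at time `n`, so the backward formula equates the discounted noise with
  -- the discounted endpoint minus the discounted coupling.
  have hsol : ∀ᵐ ω ∂ν, (∑ l ∈ Finset.Ico n m, (growth (κ j) γ n (l + 1))⁻¹ * γ l * ξ j l ω) ^ 2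
      = ((growth (κ j) γ n m)⁻¹ * w j m ω
        + (-1) * ∑ l ∈ Finset.Ico n m, (growth (κ j) γ n (l + 1))⁻¹ * γ l * r j l ω) ^ 2 := by
    filter_upwards [hS.start j] with ω hω
    have h1 := eq_inv_growth_mul_sub_sum (w := fun k => w j k ω)
      (f := fun k => r j k ω + ξ j k ω) (κ := κ j) (hS.factor_pos j)
      (fun l hl => hS.recursion j l hl ω) hnm
    simp only [hω, mul_add, Finset.sum_add_distrib] at h1
    congr 1
    linarith
  rw [integral_congr_ae hsol]
  refine (integral_sq_add_le ((hS.memLp j m).const_mul _)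
    ((memLp_sum (hS.memLp_rest j)).const_mul _)).trans ?_
  have h2 := hS.rest_unstable hs0 hs hj le_rfl hnm
  have h5 := mul_le_mul_of_nonneg_left (hs j m hnm) (sq_nonneg (growth (κ j) γ n m)⁻¹)
  simp only [mul_pow, integral_const_mul]
  linarith

end PerronSystem

end Perron

end VRRW

namespace VRRW

open MeasureTheory

/-! ### Weights and occupation vectors along a path. -/

section Path

variable {d : ℕ} {s : Fin d → ℝ} {y : ℕ → Fin d}

theorem weight_succ (s : Fin d → ℝ) (y : ℕ → Fin d) (n : ℕ) (i : Fin d) :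
    weight s y (n + 1) i = weight s y n i + if y (n + 1) = i then 1 else 0 := rfl

theorem sum_weight (s : Fin d → ℝ) (y : ℕ → Fin d) (n : ℕ) :
    ∑ j, weight s y n j = ∑ j, s j + n := by
  induction n with
  | zero => simp [weight]
  | succ n ih =>
    simp only [weight_succ, Finset.sum_add_distrib, ih, Finset.sum_ite_eq, Finset.mem_univ,
      if_true]
    push_cast
    ring

theorem weight_pos (hs : ∀ i, 0 < s i) (n : ℕ) (i : Fin d) : 0 < weight s y n i := by
  induction n with
  | zero => exact hs i
  | succ n ih =>
    rw [weight_succ]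
    split_ifs <;> linarith

theorem weight_congr {y' : ℕ → Fin d} {n : ℕ} (h : ∀ k ≤ n, y k = y' k) (i : Fin d) :
    weight s y n i = weight s y' n i := by
  induction n with
  | zero => rfl
  | succ n ih =>
    rw [weight_succ, weight_succ, ih fun k hk => h k (hk.trans (Nat.le_succ n)), h _ le_rfl]

theorem occupation_congr {y' : ℕ → Fin d} {n : ℕ} (h : ∀ k ≤ n, y k = y' k) :
    occupation s y n = occupation s y' n := by
  ext i
  simp only [occupation, weight_congr h]

theorem occupation_eq (s : Fin d → ℝ) (y : ℕ → Fin d) (n : ℕ) (i : Fin d) :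
    occupation s y n i = weight s y n i / (∑ j, s j + n) := by
  rw [occupation, sum_weight]

theorem sum_pos_of_pos (hs : ∀ i, 0 < s i) (i : Fin d) : 0 < ∑ j, s j :=
  Finset.sum_pos (fun j _ => hs j) ⟨i, Finset.mem_univ i⟩

theorem occupation_succ_sub (hs : ∀ i, 0 < s i) (n : ℕ) (i : Fin d) :
    occupation s y (n + 1) i - occupation s y n i
      = ((if y (n + 1) = i then 1 else 0) - occupation s y n i) / (∑ j, s j + (n + 1)) := by
  have h0 := sum_pos_of_pos hs i
  have h1 : (∑ j, s j + n) ≠ 0 := by positivity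
  have h2 : (∑ j, s j + (n + 1)) ≠ 0 := by positivity
  rw [occupation_eq, occupation_eq, weight_succ]
  push_cast
  field_simp
  ring

theorem occupation_nonneg (hs : ∀ i, 0 < s i) (n : ℕ) (i : Fin d) : 0 ≤ occupation s y n i := by
  have h0 := sum_pos_of_pos hs i
  have := weight_pos (y := y) hs n i
  rw [occupation_eq]
  positivity

theorem occupation_le_one (hs : ∀ i, 0 < s i) (n : ℕ) (i : Fin d) : occupation s y n i ≤ 1 := by
  have h0 := sum_pos_of_pos hs i
  rw [occupation_eq, div_le_one (by positivity), ← sum_weight s y n]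
  exact Finset.single_le_sum (f := fun i => weight s y n i) (fun j _ => (weight_pos hs n j).le)
    (Finset.mem_univ i)

theorem abs_occupation_succ_sub_le (hs : ∀ i, 0 < s i) (n : ℕ) (i : Fin d) :
    |occupation s y (n + 1) i - occupation s y n i| ≤ 1 / (∑ j, s j + (n + 1)) := by
  have h0 := sum_pos_of_pos hs i
  rw [occupation_succ_sub hs, abs_div, abs_of_pos (show 0 < ∑ j, s j + (n + 1 : ℝ) by positivity)]
  refine div_le_div_of_nonneg_right ?_ (by positivity)
  have h1 := occupation_nonneg (y := y) hs n i
  have h2 := occupation_le_one (y := y) hs n i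
  rw [abs_le]
  split_ifs <;> constructor <;> linarith

theorem step_eq_trans {R : Matrix (Fin d) (Fin d) ℝ} (hs : ∀ i, 0 < s i) (n : ℕ) (i j : Fin d) :
    R i j * weight s y n j / ∑ k, R i k * weight s y n k = trans R (occupation s y n) i j := by
  have h0 := sum_pos_of_pos hs i
  have h1 : (∑ j, s j + n) ≠ 0 := by positivity
  simp only [trans, Matrix.of_apply, N, occupation_eq, ← mul_div_assoc, ← Finset.sum_div]
  rw [div_div_div_cancel_right₀ h1]

theorem sum_trans_occupation {R : Matrix (Fin d) (Fin d) ℝ} (hsymm : R.IsSymm)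
    (hnonneg : ∀ i j, 0 ≤ R i j) (hcol : ∀ j, 0 < ∑ i, R i j) (hs : ∀ i, 0 < s i) (n : ℕ)
    (i : Fin d) : ∑ j, trans R (occupation s y n) i j = 1 := by
  apply sum_trans
  apply ne_of_gt
  have h0 := sum_pos_of_pos hs i
  have hpos : ∀ j, 0 < occupation s y n j := fun j => by
    have := weight_pos (y := y) hs n j
    rw [occupation_eq]
    positivity
  have hrow : ∃ j ∈ Finset.univ, 0 < R i j := by
    apply Finset.exists_lt_of_sum_lt (f := fun _ => (0 : ℝ))
    rw [Finset.sum_const_zero]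
    exact (hcol i).trans_eq (Finset.sum_congr rfl fun j _ => hsymm.apply i j)
  obtain ⟨j, hj, hRj⟩ := hrow
  exact Finset.sum_pos' (fun k _ => mul_nonneg (hnonneg i k) (hpos k).le)
    ⟨j, hj, mul_pos hRj (hpos j)⟩

theorem trans_occupation_nonneg {R : Matrix (Fin d) (Fin d) ℝ}
    (hnonneg : ∀ i j, 0 ≤ R i j) (hs : ∀ i, 0 < s i) (n : ℕ)
    (i j : Fin d) : 0 ≤ trans R (occupation s y n) i j := by
  simp only [trans, Matrix.of_apply, N]
  have h := fun j => occupation_nonneg (y := y) hs n j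
  exact div_nonneg (mul_nonneg (hnonneg i j) (h j))
    (Finset.sum_nonneg fun k _ => mul_nonneg (hnonneg i k) (h k))

end Path

/-! ### Functions of finitely many states of the process. -/

section Past

variable {d : ℕ} {Ω : Type*}

/-- `G` is a function of `Y_0, …, Y_k`. -/
def DependsOnPast {α : Type*} (Y : ℕ → Ω → Fin d) (k : ℕ) (G : Ω → α) : Prop :=
  ∀ ω ω', (∀ i ≤ k, Y i ω = Y i ω') → G ω = G ω'

namespace DependsOnPast

variable {α : Type*} {Y : ℕ → Ω → Fin d} {k : ℕ}

theorem mono {G : Ω → α} (h : DependsOnPast Y k G) {l : ℕ} (hkl : k ≤ l) : DependsOnPast Y l G :=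
  fun ω ω' hω => h ω ω' fun i hi => hω i (hi.trans hkl)

theorem comp₂ {β δ : Type*} {F : Ω → α} {G : Ω → β} (hF : DependsOnPast Y k F)
    (hG : DependsOnPast Y k G) (f : α → β → δ) : DependsOnPast Y k (fun ω => f (F ω) (G ω)) :=
  fun ω ω' hω => by simp only [hF ω ω' hω, hG ω ω' hω]

theorem comp {β : Type*} {F : Ω → α} (hF : DependsOnPast Y k F) (f : α → β) :
    DependsOnPast Y k (fun ω => f (F ω)) :=
  fun ω ω' hω => by simp only [hF ω ω' hω]

theorem mul {F G : Ω → ℝ} (hF : DependsOnPast Y k F) (hG : DependsOnPast Y k G) :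
    DependsOnPast Y k (fun ω => F ω * G ω) := hF.comp₂ hG _

theorem sum {ι : Type*} {t : Finset ι} {F : ι → Ω → ℝ} (hF : ∀ i ∈ t, DependsOnPast Y k (F i)) :
    DependsOnPast Y k (fun ω => ∑ i ∈ t, F i ω) :=
  fun ω ω' hω => Finset.sum_congr rfl fun i hi => hF i hi ω ω' hω

theorem self {i : ℕ} (hi : i ≤ k) : DependsOnPast Y k (Y i) := fun _ _ hω => hω i hi

/-- The vector of the first `k + 1` states. -/
def past (Y : ℕ → Ω → Fin d) (k : ℕ) (ω : Ω) : Fin (k + 1) → Fin d := fun i => Y i ω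

/-- The past takes finitely many values, so measurability, boundedness and integrability follow from
this factorization. -/
theorem exists_eq_comp_past {G : Ω → ℝ} (h : DependsOnPast Y k G) :
    ∃ g : (Fin (k + 1) → Fin d) → ℝ, G = g ∘ past Y k := by
  have hf : Function.FactorsThrough G (past Y k) := fun ω ω' hω =>
    h ω ω' fun i hi => congrFun hω ⟨i, Nat.lt_succ_of_le hi⟩
  exact ⟨Function.extend (past Y k) G fun _ => 0, (hf.extend_comp _).symm⟩

theorem measurable_past_history (Y : ℕ → Ω → Fin d) (k : ℕ) :
    Measurable[history Y k] (past Y k) := by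
  refine @measurable_pi_lambda _ _ _ (history Y k) _ _ fun i => ?_
  exact (comap_measurable (Y i)).mono (le_iSup (fun i : Fin (k + 1) =>
    MeasurableSpace.comap (Y i) inferInstance) i) le_rfl

theorem measurable_history {G : Ω → ℝ} (h : DependsOnPast Y k G) : Measurable[history Y k] G := by
  obtain ⟨g, rfl⟩ := h.exists_eq_comp_past
  exact (measurable_of_finite g).comp (measurable_past_history Y k)

theorem exists_abs_le {G : Ω → ℝ} (h : DependsOnPast Y k G) : ∃ C, ∀ ω, |G ω| ≤ C := by
  obtain ⟨g, rfl⟩ := h.exists_eq_comp_past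
  refine ⟨∑ x, |g x|, fun ω => ?_⟩
  exact Finset.single_le_sum (f := fun x => |g x|) (fun x _ => abs_nonneg _)
    (Finset.mem_univ (past Y k ω))

end DependsOnPast

theorem dependsOnPast_occupation (s : Fin d → ℝ) (Y : ℕ → Ω → Fin d) (k : ℕ) :
    DependsOnPast Y k (fun ω => occupation s (fun n => Y n ω) k) :=
  fun _ _ hω => occupation_congr hω

theorem history_le [mΩ : MeasurableSpace Ω] {Y : ℕ → Ω → Fin d} (hY : ∀ n, Measurable (Y n))
    (k : ℕ) : history Y k ≤ mΩ :=
  iSup_le fun i => (hY i).comap_le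

namespace DependsOnPast

variable [mΩ : MeasurableSpace Ω] {Y : ℕ → Ω → Fin d} {k : ℕ} {μ : Measure Ω} [IsFiniteMeasure μ]

theorem measurable {G : Ω → ℝ} (h : DependsOnPast Y k G) (hY : ∀ n, Measurable (Y n)) :
    Measurable G :=
  h.measurable_history.mono (history_le hY k) le_rfl

theorem integrable {G : Ω → ℝ} (h : DependsOnPast Y k G) (hY : ∀ n, Measurable (Y n)) :
    Integrable G μ := by
  obtain ⟨C, hC⟩ := h.exists_abs_le
  exact Integrable.of_bound (h.measurable hY).aestronglyMeasurable C
    (Filter.Eventually.of_forall fun ω => hC ω)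

end DependsOnPast

end Past

/-! ### The Markov property in integrated form. -/

section OneStep

variable {d : ℕ} {Ω : Type*} [mΩ : MeasurableSpace Ω] {R : Matrix (Fin d) (Fin d) ℝ}
  {s : Fin d → ℝ} {y₀ : Fin d} {μ : Measure Ω} [IsProbabilityMeasure μ] {Y : ℕ → Ω → Fin d}

/-- The Markov property of the reinforced process, integrated against the past. -/
theorem IsReinforcedProcess.integral_step (hY : IsReinforcedProcess R s y₀ μ Y)
    (hs : ∀ i, 0 < s i) {k : ℕ} {F : Fin d → Ω → ℝ} (hF : ∀ j, DependsOnPast Y k (F j)) :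
    ∫ ω, F (Y (k + 1) ω) ω ∂μ
      = ∫ ω, ∑ j, trans R (occupation s (fun n => Y n ω) k) (Y k ω) j * F j ω ∂μ := by
  have hm := hY.measurable
  have htr : ∀ j, DependsOnPast Y k
      (fun ω => trans R (occupation s (fun n => Y n ω) k) (Y k ω) j) := fun j =>
    (dependsOnPast_occupation s Y k).comp₂ (DependsOnPast.self le_rfl) fun v i => trans R v i j
  have hind : ∀ j, DependsOnPast Y (k + 1)
      ((Y (k + 1) ⁻¹' {j}).indicator fun _ => (1 : ℝ)) := fun j ω ω' hω => by
    have h1 := hω (k + 1) le_rfl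
    simp only [Set.indicator, Set.mem_preimage, Set.mem_singleton_iff, h1]
  -- After splitting by the next state, each coefficient depends on the past and can be pulled out
  -- of the conditional expectation.
  have hsplit : ∀ ω, F (Y (k + 1) ω) ω
      = ∑ j, F j ω * (Y (k + 1) ⁻¹' {j}).indicator (fun _ => (1 : ℝ)) ω := by
    intro ω
    rw [Finset.sum_eq_single (Y (k + 1) ω)]
    · simp
    · intro j _ hj
      simp [Set.indicator, hj.symm]
    · simp
  have hFind : ∀ j, DependsOnPast Y (k + 1)
      (fun ω => F j ω * (Y (k + 1) ⁻¹' {j}).indicator (fun _ => (1 : ℝ)) ω) := fun j =>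
    ((hF j).mono (Nat.le_succ k)).mul (hind j)
  simp only [hsplit]
  rw [integral_finsetSum _ fun j _ => (hFind j).integrable hm,
    integral_finsetSum _ fun j _ => ((htr j).mul (hF j)).integrable hm]
  refine Finset.sum_congr rfl fun j _ => ?_
  have hle := history_le hm k
  rw [← integral_condExp hle]
  refine integral_congr_ae ?_
  have hpull : μ[fun ω => F j ω * (Y (k + 1) ⁻¹' {j}).indicator (fun _ => (1 : ℝ)) ω | history Y k]
      =ᵐ[μ] fun ω => F j ω * (μ[(Y (k + 1) ⁻¹' {j}).indicator (fun _ => (1 : ℝ)) | history Y k]) ω :=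
    condExp_mul_of_stronglyMeasurable_left (hF j).measurable_history.stronglyMeasurable
      ((hFind j).integrable hm) ((hind j).integrable hm)
  filter_upwards [hpull, hY.step k j] with ω h1 h2
  rw [h1, h2, step_eq_trans hs, mul_comm]

end OneStep

/-! ### Second and fourth moments of weighted martingale sums. -/

section Noise

variable {d : ℕ} {Ω : Type*} [mΩ : MeasurableSpace Ω]

/-- A bounded sequence of martingale differences, `ξ l` being revealed at time `l + 1`. -/
structure IsNoise (μ : Measure Ω) (Y : ℕ → Ω → Fin d) (ξ : ℕ → Ω → ℝ) (C : ℝ) : Prop where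
  dep : ∀ l, DependsOnPast Y (l + 1) (ξ l)
  bound : ∀ l ω, |ξ l ω| ≤ C
  centered : ∀ l (G : Ω → ℝ), DependsOnPast Y l G → ∫ ω, G ω * ξ l ω ∂μ = 0

namespace IsNoise

variable {μ : Measure Ω} {Y : ℕ → Ω → Fin d} {ξ : ℕ → Ω → ℝ} {C : ℝ} {n : ℕ} {I : Ω → ℝ}

theorem sq_le (hξ : IsNoise μ Y ξ C) (l : ℕ) (ω : Ω) : ξ l ω ^ 2 ≤ C ^ 2 := by
  have h1 := hξ.bound l ω
  rw [← sq_abs]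
  gcongr

theorem dep_sum (hξ : IsNoise μ Y ξ C) (α : ℕ → ℝ) (k m : ℕ) :
    DependsOnPast Y m (fun ω => ∑ l ∈ Finset.Ico k m, α l * ξ l ω) :=
  DependsOnPast.sum fun l hl =>
    ((hξ.dep l).mono (Finset.mem_Ico.1 hl).2).comp fun x => α l * x

variable [IsProbabilityMeasure μ]

theorem integral_sum (hξ : IsNoise μ Y ξ C) (hY : ∀ n, Measurable (Y n))
    (hI : DependsOnPast Y n I) (α : ℕ → ℝ) {k m : ℕ} (hk : n ≤ k) :
    ∫ ω, I ω * ∑ l ∈ Finset.Ico k m, α l * ξ l ω ∂μ = 0 := by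
  simp only [Finset.mul_sum]
  rw [integral_finsetSum]
  · refine Finset.sum_eq_zero fun l hl => ?_
    have h := hξ.centered l (fun ω => I ω * α l)
      ((hI.mono (hk.trans (Finset.mem_Ico.1 hl).1)).comp fun x => x * α l)
    simpa only [mul_assoc] using h
  · intro l hl
    exact ((hI.mono ((hk.trans (Finset.mem_Ico.1 hl).1).trans (Nat.le_succ l))).mul
      ((hξ.dep l).comp fun x => α l * x)).integrable hY

/-- Martingale increments are orthogonal. The weight `I`, known at time `n`, localizes the identity
to an atom. -/
theorem integral_sum_sq (hξ : IsNoise μ Y ξ C) (hY : ∀ n, Measurable (Y n))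
    (hI : DependsOnPast Y n I) (α : ℕ → ℝ) {k m : ℕ} (hk : n ≤ k) (hm : k ≤ m) :
    ∫ ω, I ω * (∑ l ∈ Finset.Ico k m, α l * ξ l ω) ^ 2 ∂μ
      = ∑ l ∈ Finset.Ico k m, α l ^ 2 * ∫ ω, I ω * ξ l ω ^ 2 ∂μ := by
  induction m, hm using Nat.le_induction with
  | base => simp
  | succ m hm ih =>
    rw [Finset.sum_Ico_succ_top hm, ← ih]
    simp only [Finset.sum_Ico_succ_top hm]
    have hIm := hI.mono (hk.trans hm)
    have hIm' := hI.mono ((hk.trans hm).trans (Nat.le_succ m))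
    have hM := hξ.dep_sum α k m
    set M := fun ω => ∑ l ∈ Finset.Ico k m, α l * ξ l ω with hMdef
    have hM' := hM.mono (Nat.le_succ m)
    have hx := hξ.dep m
    have h1 : ∀ ω, I ω * (M ω + α m * ξ m ω) ^ 2
        = I ω * M ω ^ 2 + ((2 * α m * (I ω * M ω)) * ξ m ω + α m ^ 2 * (I ω * ξ m ω ^ 2)) :=
      fun ω => by ring
    have hcen := hξ.centered m (fun ω => 2 * α m * (I ω * M ω)) ((hIm.mul hM).comp _)
    have i1 : Integrable (fun ω => I ω * M ω ^ 2) μ :=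
      (hIm.comp₂ hM fun x y => x * y ^ 2).integrable hY
    have i2 : Integrable (fun ω => (2 * α m * (I ω * M ω)) * ξ m ω) μ :=
      (((hIm'.mul hM').comp fun x => 2 * α m * x).mul hx).integrable hY
    have i3 : Integrable (fun ω => α m ^ 2 * (I ω * ξ m ω ^ 2)) μ :=
      ((hIm'.comp₂ hx fun x y => α m ^ 2 * (x * y ^ 2))).integrable hY
    change ∫ ω, I ω * (M ω + α m * ξ m ω) ^ 2 ∂μ = _
    simp only [h1]
    have i23 : Integrable (fun ω => (2 * α m * (I ω * M ω)) * ξ m ω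
        + α m ^ 2 * (I ω * ξ m ω ^ 2)) μ := i2.add i3
    rw [integral_add i1 i23, integral_add i2 i3, hcen, integral_const_mul, zero_add]

theorem integral_sum_sq_le (hξ : IsNoise μ Y ξ C) (hY : ∀ n, Measurable (Y n))
    (hI : DependsOnPast Y n I) (hI0 : ∀ ω, 0 ≤ I ω) (α : ℕ → ℝ) {k m : ℕ} (hk : n ≤ k)
    (hm : k ≤ m) :
    ∫ ω, I ω * (∑ l ∈ Finset.Ico k m, α l * ξ l ω) ^ 2 ∂μ
      ≤ C ^ 2 * (∑ l ∈ Finset.Ico k m, α l ^ 2) * ∫ ω, I ω ∂μ := by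
  rw [hξ.integral_sum_sq hY hI α hk hm, Finset.mul_sum, Finset.sum_mul]
  refine Finset.sum_le_sum fun l hl => ?_
  have hIl := hI.mono ((hk.trans (Finset.mem_Ico.1 hl).1).trans (Nat.le_succ l))
  have h1 : ∫ ω, I ω * ξ l ω ^ 2 ∂μ ≤ ∫ ω, C ^ 2 * I ω ∂μ := by
    refine integral_mono ((hIl.comp₂ (hξ.dep l) fun x y => x * y ^ 2).integrable hY)
      ((hI.integrable hY).const_mul _) fun ω => ?_
    simp only
    rw [mul_comm]
    exact mul_le_mul_of_nonneg_right (hξ.sq_le l ω) (hI0 ω)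
  rw [integral_const_mul] at h1
  nlinarith [sq_nonneg (α l)]

/-- In the expansion of `(M + x)⁴` the term linear in `x` is centered, and `4 M x³ ≤ 2 M² x² + 2 x⁴`
leaves `8 M² x² + 3 x⁴`; the constant 11 is not optimal. The fourth moment is needed to discard the
small part of an atom where the path leaves the ball. -/
theorem integral_sum_pow_four_le (hξ : IsNoise μ Y ξ C) (hY : ∀ n, Measurable (Y n))
    (hI : DependsOnPast Y n I) (hI0 : ∀ ω, 0 ≤ I ω) (α : ℕ → ℝ) {k m : ℕ} (hk : n ≤ k)
    (hm : k ≤ m) :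
    ∫ ω, I ω * (∑ l ∈ Finset.Ico k m, α l * ξ l ω) ^ 4 ∂μ
      ≤ 11 * C ^ 4 * (∑ l ∈ Finset.Ico k m, α l ^ 2) ^ 2 * ∫ ω, I ω ∂μ := by
  induction m, hm using Nat.le_induction with
  | base => simp
  | succ m hm ih =>
    have hsq := hξ.integral_sum_sq_le hY hI hI0 α hk hm
    simp only [Finset.sum_Ico_succ_top hm]
    have hIm := hI.mono (hk.trans hm)
    have hIm' := hI.mono ((hk.trans hm).trans (Nat.le_succ m))
    have hM := hξ.dep_sum α k m
    set M := fun ω => ∑ l ∈ Finset.Ico k m, α l * ξ l ω with hMdef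
    set A := ∑ l ∈ Finset.Ico k m, α l ^ 2 with hA
    have hA0 : 0 ≤ A := Finset.sum_nonneg fun l _ => sq_nonneg _
    have hM' := hM.mono (Nat.le_succ m)
    have hx := hξ.dep m
    have hcen := hξ.centered m (fun ω => 4 * α m * (I ω * M ω ^ 3))
      (hIm.comp₂ hM fun x y => 4 * α m * (x * y ^ 3))
    have i1 : Integrable (fun ω => I ω * M ω ^ 4) μ :=
      (hIm.comp₂ hM fun x y => x * y ^ 4).integrable hY
    have i2 : Integrable (fun ω => (4 * α m * (I ω * M ω ^ 3)) * ξ m ω) μ :=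
      ((hIm'.comp₂ hM' fun x y => 4 * α m * (x * y ^ 3)).mul hx).integrable hY
    have i3 : Integrable (fun ω => 8 * C ^ 2 * α m ^ 2 * (I ω * M ω ^ 2)) μ :=
      (hIm.comp₂ hM fun x y => 8 * C ^ 2 * α m ^ 2 * (x * y ^ 2)).integrable hY
    have i4 : Integrable (fun ω => 3 * C ^ 4 * α m ^ 4 * I ω) μ :=
      (hI.integrable hY).const_mul _
    have hptw : ∀ ω, I ω * (M ω + α m * ξ m ω) ^ 4
        ≤ I ω * M ω ^ 4 + ((4 * α m * (I ω * M ω ^ 3)) * ξ m ω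
          + (8 * C ^ 2 * α m ^ 2 * (I ω * M ω ^ 2) + 3 * C ^ 4 * α m ^ 4 * I ω)) := by
      intro ω
      have hx2 := hξ.sq_le m ω
      have hx4 : ξ m ω ^ 4 ≤ C ^ 4 := by
        have := pow_le_pow_left₀ (sq_nonneg (ξ m ω)) hx2 2
        nlinarith
      have key : (M ω + α m * ξ m ω) ^ 4 ≤ M ω ^ 4 + 4 * α m * M ω ^ 3 * ξ m ω
          + (8 * C ^ 2 * α m ^ 2 * M ω ^ 2 + 3 * C ^ 4 * α m ^ 4) := by
        have e1 : (M ω + α m * ξ m ω) ^ 4 ≤ M ω ^ 4 + 4 * α m * M ω ^ 3 * ξ m ω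
            + (8 * (M ω * α m) ^ 2 * ξ m ω ^ 2 + 3 * α m ^ 4 * ξ m ω ^ 4) := by
          nlinarith [mul_nonneg (sq_nonneg (α m * ξ m ω)) (sq_nonneg (M ω - α m * ξ m ω))]
        have e2 := mul_le_mul_of_nonneg_left hx2 (sq_nonneg (M ω * α m))
        have e3 := mul_le_mul_of_nonneg_left hx4 (show 0 ≤ α m ^ 4 by positivity)
        nlinarith
      have := mul_le_mul_of_nonneg_left key (hI0 ω)
      linarith
    have hint := integral_mono
      ((hIm'.comp₂ (hM'.comp₂ hx fun x y => x + α m * y) fun x y => x * y ^ 4).integrable hY)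
      (i1.add (i2.add (i3.add i4))) hptw
    rw [integral_add' i1 (i2.add (i3.add i4)), integral_add' i2 (i3.add i4), integral_add' i3 i4,
      hcen, integral_const_mul, integral_const_mul] at hint
    refine hint.trans ?_
    have hI' : 0 ≤ ∫ ω, I ω ∂μ := integral_nonneg hI0
    have h8 := mul_le_mul_of_nonneg_left hsq (show 0 ≤ 8 * C ^ 2 * α m ^ 2 by positivity)
    have hA2 : 0 ≤ C ^ 4 * (∫ ω, I ω ∂μ) * (A * α m ^ 2) := by positivity
    have hA4 : 0 ≤ C ^ 4 * (∫ ω, I ω ∂μ) * α m ^ 4 := by positivity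
    nlinarith

end IsNoise

end Noise

end VRRW

namespace VRRW

open MeasureTheory

/-! ### Atoms of the history and Lévy's 0-1 law. -/

section Levy

variable {d : ℕ} {Ω : Type*}

/-- The set of outcomes with the same first `n + 1` states as `ω₀`. -/
def atom (Y : ℕ → Ω → Fin d) (n : ℕ) (ω₀ : Ω) : Set Ω := {ω | ∀ i ≤ n, Y i ω₀ = Y i ω}

theorem atom_eq_preimage (Y : ℕ → Ω → Fin d) (n : ℕ) (ω₀ : Ω) :
    atom Y n ω₀ = DependsOnPast.past Y n ⁻¹' {DependsOnPast.past Y n ω₀} := by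
  ext ω
  simp only [atom, Set.mem_ofPred_eq, Set.mem_preimage, Set.mem_singleton_iff]
  constructor
  · intro h
    ext1 i
    exact (h i (Nat.le_of_lt_succ i.2)).symm
  · intro h i hi
    exact (congrFun h ⟨i, Nat.lt_succ_of_le hi⟩).symm

theorem measurableSet_history_atom (Y : ℕ → Ω → Fin d) (n : ℕ) (ω₀ : Ω) :
    MeasurableSet[history Y n] (atom Y n ω₀) := by
  rw [atom_eq_preimage]
  exact DependsOnPast.measurable_past_history Y n (measurableSet_singleton _)

theorem history_mono (Y : ℕ → Ω → Fin d) : Monotone (history Y) := fun _ m hnm =>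
  iSup_le fun i => le_iSup (fun i : Fin (m + 1) => MeasurableSpace.comap (Y i) inferInstance)
    (⟨i, i.2.trans_le (Nat.succ_le_succ hnm)⟩ : Fin (m + 1))

/-- Sets of `history Y n` are preimages under the finite past, so they cannot separate two outcomes
with equal past. -/
theorem dependsOnPast_of_measurable {Y : ℕ → Ω → Fin d} {n : ℕ} {f : Ω → ℝ}
    (hf : Measurable[history Y n] f) : DependsOnPast Y n f := by
  intro ω ω' h
  have hle : history Y n ≤ MeasurableSpace.comap (DependsOnPast.past Y n) ⊤ := by
    refine iSup_le fun i => ?_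
    rintro _ ⟨t, -, rfl⟩
    exact ⟨(fun x => x i) ⁻¹' t, trivial, rfl⟩
  obtain ⟨t, -, ht⟩ := hle _ (hf (measurableSet_singleton (f ω)))
  have h1 : ω ∈ f ⁻¹' {f ω} := rfl
  rw [← ht] at h1
  have hpast : DependsOnPast.past Y n ω' = DependsOnPast.past Y n ω := by
    ext1 i
    exact (h i (Nat.le_of_lt_succ i.2)).symm
  have h2 : ω' ∈ f ⁻¹' {f ω} := by
    rw [← ht]
    change DependsOnPast.past Y n ω' ∈ t
    rw [hpast]
    exact h1
  exact h2.symm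

theorem dependsOnPast_indicator_atom (Y : ℕ → Ω → Fin d) (n : ℕ) (ω₀ : Ω) :
    DependsOnPast Y n ((atom Y n ω₀).indicator fun _ => (1 : ℝ)) := by
  refine dependsOnPast_of_measurable ?_
  exact (@measurable_const _ _ _ (history Y n) (1 : ℝ)).indicator (measurableSet_history_atom Y n ω₀)

variable [mΩ : MeasurableSpace Ω] {μ : Measure Ω} {Y : ℕ → Ω → Fin d}

theorem ae_atom_ne_zero (Y : ℕ → Ω → Fin d) (n : ℕ) : ∀ᵐ ω ∂μ, μ (atom Y n ω) ≠ 0 := by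
  rw [ae_iff]
  have hsub : {ω | ¬ μ (atom Y n ω) ≠ 0} ⊆ ⋃ x ∈ {x : Fin (n + 1) → Fin d |
      μ (DependsOnPast.past Y n ⁻¹' {x}) = 0}, DependsOnPast.past Y n ⁻¹' {x} := by
    intro ω hω
    simp only [ne_eq, not_not, Set.mem_ofPred_eq, atom_eq_preimage] at hω
    exact Set.mem_biUnion (x := DependsOnPast.past Y n ω) hω rfl
  refine measure_mono_null hsub ?_
  rw [measure_biUnion_null_iff (Set.to_countable _)]
  exact fun x hx => hx

variable [IsProbabilityMeasure μ]

/-- An event of positive probability determined by the whole path has conditional probability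
arbitrarily close to `1` given some long history. -/
theorem exists_atom (hY : ∀ n, Measurable (Y n)) {A : Set Ω}
    (hA : MeasurableSet[⨆ n, history Y n] A) (hpos : μ A ≠ 0) {ε : ℝ} (hε : 0 < ε) (n₀ : ℕ) :
    ∃ n ≥ n₀, ∃ ω₀, 0 < μ.real (atom Y n ω₀) ∧
      μ.real (atom Y n ω₀ \ A) ≤ ε * μ.real (atom Y n ω₀) := by
  let ℱ : Filtration ℕ mΩ := ⟨history Y, history_mono Y, history_le hY⟩
  have hAm : MeasurableSet A := (iSup_le (history_le hY)) A hA
  let f : Ω → ℝ := A.indicator fun _ => 1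
  have hfi : Integrable f μ := (integrable_const 1).indicator hAm
  have hfm : StronglyMeasurable[⨆ n, history Y n] f :=
    (@stronglyMeasurable_const _ _ (⨆ n, history Y n) _ 1).indicator hA
  -- Lévy's upward theorem.
  have hlim : ∀ᵐ ω ∂μ, Filter.Tendsto (fun n => (μ[f | ℱ n]) ω) Filter.atTop (𝓝 (f ω)) :=
    hfi.tendsto_ae_condExp hfm
  have hatom : ∀ᵐ ω ∂μ, ∀ n, μ (atom Y n ω) ≠ 0 := ae_all_iff.2 fun n => ae_atom_ne_zero Y n
  obtain ⟨ω₀, hω₀, hlimω, hatomω⟩ : ∃ ω ∈ A, Filter.Tendsto (fun n => (μ[f | ℱ n]) ω)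
      Filter.atTop (𝓝 (f ω)) ∧ ∀ n, μ (atom Y n ω) ≠ 0 := by
    by_contra! hcon
    apply hpos
    refine measure_mono_null (t := {ω | ¬ (Filter.Tendsto (fun n => (μ[f | ℱ n]) ω)
      Filter.atTop (𝓝 (f ω)) ∧ ∀ n, μ (atom Y n ω) ≠ 0)}) ?_ (ae_iff.1 (hlim.and hatom))
    rintro ω hω ⟨h1, h2⟩
    obtain ⟨n, hn⟩ := hcon ω hω h1
    exact h2 n hn
  have hf1 : f ω₀ = 1 := Set.indicator_of_mem hω₀ _
  rw [hf1] at hlimω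
  obtain ⟨n, hn1, hn2⟩ := ((hlimω.eventually (lt_mem_nhds (show 1 - ε < 1 by linarith))).and
    (Filter.eventually_ge_atTop n₀)).exists
  have hEm : MeasurableSet (atom Y n ω₀) := history_le hY n _ (measurableSet_history_atom Y n ω₀)
  refine ⟨n, hn2, ω₀, ENNReal.toReal_pos (hatomω n) (measure_ne_top _ _), ?_⟩
  have hdep : DependsOnPast Y n (μ[f | ℱ n]) :=
    dependsOnPast_of_measurable (stronglyMeasurable_condExp (m := ℱ n)).measurable
  have h1 : ∫ ω in atom Y n ω₀, (μ[f | ℱ n]) ω ∂μ = ∫ ω in atom Y n ω₀, f ω ∂μ :=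
    setIntegral_condExp (ℱ.le n) hfi (measurableSet_history_atom Y n ω₀)
  -- The conditional expectation is constant on the atom, so its value at `ω₀` is the conditional
  -- probability of `A` given the atom.
  have h2 : ∫ ω in atom Y n ω₀, (μ[f | ℱ n]) ω ∂μ
      = (μ[f | ℱ n]) ω₀ * μ.real (atom Y n ω₀) := by
    rw [setIntegral_congr_fun hEm (g := fun _ => (μ[f | ℱ n]) ω₀)
      (fun ω hω => (hdep ω₀ ω hω).symm), setIntegral_const, smul_eq_mul, mul_comm]
  have h3 : ∫ ω in atom Y n ω₀, f ω ∂μ = μ.real (atom Y n ω₀ ∩ A) := by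
    rw [setIntegral_indicator hAm, setIntegral_const, smul_eq_mul, mul_one]
  have h4 := measureReal_inter_add_sdiff (μ := μ) (s := atom Y n ω₀) hAm
  have h5 : 0 ≤ μ.real (atom Y n ω₀) := measureReal_nonneg
  rw [h2, h3] at h1
  nlinarith

end Levy

/-! ### The case of a reducible frozen chain. -/

section Reducible

variable {d : ℕ} {Ω : Type*} [mΩ : MeasurableSpace Ω] {R : Matrix (Fin d) (Fin d) ℝ}
  {s p : Fin d → ℝ} {y₀ : Fin d} {μ : Measure Ω} [IsProbabilityMeasure μ] {Y : ℕ → Ω → Fin d}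

open Matrix in
/-- A harmonic function of the chain frozen at `p` is constant along possible transitions. -/
theorem IsInteriorCritical.eq_of_harmonic (hsymm : R.IsSymm) (hnonneg : ∀ i j, 0 ≤ R i j)
    (hp : IsInteriorCritical R p) {x : Fin d → ℝ} (hx : trans R p *ᵥ x = x) {i j : Fin d}
    (hij : R i j ≠ 0) : x i = x j := by
  have hH := hp.H_pos
  have hxi : ∀ i, ∑ j, trans R p i j * x j = x i := fun i => congrFun hx i
  have hstat : ∀ j, ∑ i, p i * trans R p i j = p j := fun j => congrFun (hp.vecMul_trans hsymm) j
  have htn : ∀ i j, 0 ≤ trans R p i j := fun i j => by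
    simp only [trans, Matrix.of_apply, hp.N_eq]
    have := hp.pos j
    have := hnonneg i j
    positivity
  -- A harmonic function has the same stationary second moment as its one-step mean, so its mean
  -- conditional variance is zero.
  have hvar : ∑ i, p i * ∑ j, trans R p i j * (x j - x i) ^ 2 = 0 := by
    have h1 : ∀ i, ∑ j, trans R p i j * (x j - x i) ^ 2
        = ∑ j, trans R p i j * x j ^ 2 - x i ^ 2 := fun i => by
      have := sum_mul_sq_sub_sq (g := x) (sum_trans (hp.N_ne_zero i))
      rw [hxi] at this
      exact this.symm
    simp only [h1, mul_sub, Finset.sum_sub_distrib, Finset.mul_sum]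
    rw [Finset.sum_comm, sub_eq_zero]
    refine Finset.sum_congr rfl fun j _ => ?_
    conv_rhs => rw [← hstat j, Finset.sum_mul]
    exact Finset.sum_congr rfl fun i _ => by ring
  have hterm : ∀ i j, 0 ≤ trans R p i j * (x j - x i) ^ 2 := fun i j =>
    mul_nonneg (htn i j) (sq_nonneg _)
  have h2 := (Finset.sum_eq_zero_iff_of_nonneg fun i _ => mul_nonneg (hp.pos i).le
    (Finset.sum_nonneg fun j _ => hterm i j)).1 hvar i (Finset.mem_univ i)
  have h3 := (mul_eq_zero.1 h2).resolve_left (hp.pos i).ne'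
  have h4 := (Finset.sum_eq_zero_iff_of_nonneg fun j _ => hterm i j).1 h3 j (Finset.mem_univ j)
  have h5 : trans R p i j ≠ 0 := by
    simp only [trans, Matrix.of_apply, hp.N_eq]
    exact div_ne_zero (mul_ne_zero hij (hp.pos j).ne') hH.ne'
  have h6 := pow_eq_zero_iff (two_ne_zero) |>.1 ((mul_eq_zero.1 h4).resolve_left h5)
  linarith

theorem IsReinforcedProcess.ae_step_ne_zero (hY : IsReinforcedProcess R s y₀ μ Y)
    (hs : ∀ i, 0 < s i) (k : ℕ) : ∀ᵐ ω ∂μ, R (Y k ω) (Y (k + 1) ω) ≠ 0 := by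
  have hdep : ∀ j, DependsOnPast Y k (fun ω => if R (Y k ω) j = 0 then (1 : ℝ) else 0) := fun j =>
    (DependsOnPast.self le_rfl).comp fun i => if R i j = 0 then (1 : ℝ) else 0
  have h := hY.integral_step hs hdep
  have h0 : ∀ ω, ∑ j, trans R (occupation s (fun n => Y n ω) k) (Y k ω) j
      * (if R (Y k ω) j = 0 then (1 : ℝ) else 0) = 0 := by
    intro ω
    refine Finset.sum_eq_zero fun j _ => ?_
    split_ifs with hR
    · simp [trans, hR]
    · simp
  simp only [h0, integral_zero] at h
  have hdep' : DependsOnPast Y (k + 1)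
      (fun ω => if R (Y k ω) (Y (k + 1) ω) = 0 then (1 : ℝ) else 0) :=
    (DependsOnPast.self (Nat.le_succ k)).comp₂ (DependsOnPast.self le_rfl)
      fun i j => if R i j = 0 then (1 : ℝ) else 0
  rw [integral_eq_zero_iff_of_nonneg (fun ω => by simp only [Pi.zero_apply]; split_ifs <;> simp)
    (hdep'.integrable hY.measurable)] at h
  filter_upwards [h] with ω hω hR
  simp [hR] at hω

theorem weight_eq_of_forall_ne {y : ℕ → Fin d} {i : Fin d} (h : ∀ k, y (k + 1) ≠ i) (n : ℕ) :
    weight s y n i = s i := by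
  induction n with
  | zero => rfl
  | succ n ih => rw [weight_succ, ih, if_neg (h n), add_zero]

/-- If the chain frozen at `p` is reducible then some state is never visited, so the occupation
vector cannot converge to an interior point. -/
theorem IsReinforcedProcess.measure_tendsto_of_not_isErgodicAt (hsymm : R.IsSymm)
    (hnonneg : ∀ i j, 0 ≤ R i j) (hp : IsInteriorCritical R p)
    (hY : IsReinforcedProcess R s y₀ μ Y) (hs : ∀ i, 0 < s i) (herg : ¬ IsErgodicAt R p) :
    μ {ω | Filter.Tendsto (fun n => occupation s (fun k => Y k ω) n) Filter.atTop (𝓝 p)} = 0 := by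
  simp only [IsErgodicAt, not_forall] at herg
  obtain ⟨x, hx, i, j, hij⟩ := herg
  obtain ⟨k, hk⟩ : ∃ k, x k ≠ x y₀ := by
    by_contra! hall
    exact hij (by rw [hall i, hall j])
  have hae : ∀ᵐ ω ∂μ, ¬ Filter.Tendsto (fun n => occupation s (fun k => Y k ω) n)
      Filter.atTop (𝓝 p) := by
    filter_upwards [ae_all_iff.2 (hY.ae_step_ne_zero hs), hY.start] with ω hω h0 hlim
    -- The harmonic function keeps its initial value along the path, so the state `k` is never
    -- visited after time 0 and its share of the weight tends to zero.
    have hconst : ∀ n, x (Y n ω) = x y₀ := by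
      intro n
      induction n with
      | zero => rw [h0]
      | succ n ih => rw [← hp.eq_of_harmonic hsymm hnonneg hx (hω n), ih]
    have hw : ∀ n, occupation s (fun k => Y k ω) n k = s k / (∑ j, s j + n) := fun n => by
      rw [occupation_eq, weight_eq_of_forall_ne]
      intro m hm
      exact hk (by rw [← hm]; exact hconst (m + 1))
    have hlimk := (tendsto_pi_nhds.1 hlim) k
    simp only [hw] at hlimk
    have hzero : Filter.Tendsto (fun n : ℕ => s k / (∑ j, s j + n)) Filter.atTop (𝓝 0) :=
      Filter.Tendsto.const_div_atTop
        (Filter.tendsto_atTop_add_const_left _ _ tendsto_natCast_atTop_atTop) _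
    exact (hp.pos k).ne' (tendsto_nhds_unique hlimk hzero)
  simpa only [ae_iff, not_not] using hae

end Reducible

end VRRW

namespace VRRW

open MeasureTheory

/-! ### Two independent copies of a random variable on a restricted measure. -/

section TwoCopies

variable {Ω : Type*} [MeasurableSpace Ω]

theorem integral_prod_sub_sq {ρ : Measure Ω} [IsFiniteMeasure ρ] {M : Ω → ℝ} (hM : MemLp M 2 ρ) :
    ∫ x, (M x.1 - M x.2) ^ 2 ∂(ρ.prod ρ)
      = 2 * ρ.real Set.univ * ∫ ω, M ω ^ 2 ∂ρ - 2 * (∫ ω, M ω ∂ρ) ^ 2 := by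
  have hM1 : Integrable M ρ := hM.integrable one_le_two
  have hM2 := hM.integrable_sq
  have h1 : Integrable (fun x : Ω × Ω => M x.1 ^ 2) (ρ.prod ρ) := hM2.comp_fst ρ
  have h2 : Integrable (fun x : Ω × Ω => M x.2 ^ 2) (ρ.prod ρ) := hM2.comp_snd ρ
  have h3 : Integrable (fun x : Ω × Ω => 2 * (M x.1 * M x.2)) (ρ.prod ρ) :=
    (hM1.mul_prod hM1).const_mul 2
  have heq : ∀ x : Ω × Ω, (M x.1 - M x.2) ^ 2
      = M x.1 ^ 2 + M x.2 ^ 2 - 2 * (M x.1 * M x.2) := fun x => by ring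
  simp only [heq]
  have h12 : Integrable (fun x : Ω × Ω => M x.1 ^ 2 + M x.2 ^ 2) (ρ.prod ρ) := h1.add h2
  rw [integral_sub h12 h3, integral_add h1 h2, integral_const_mul, integral_prod_mul,
    integral_fun_fst (fun ω => M ω ^ 2), integral_fun_snd (fun ω => M ω ^ 2)]
  simp only [smul_eq_mul]
  ring

theorem integral_prod_sub_sq_le {ρ : Measure Ω} [IsFiniteMeasure ρ] {M : Ω → ℝ}
    (hM : MemLp M 2 ρ) :
    ∫ x, (M x.1 - M x.2) ^ 2 ∂(ρ.prod ρ) ≤ 2 * ρ.real Set.univ * ∫ ω, M ω ^ 2 ∂ρ := by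
  rw [integral_prod_sub_sq hM]
  linarith [sq_nonneg (∫ ω, M ω ∂ρ)]

/-- Cauchy–Schwarz, by integrating `(M - c / g)²`. Using an upper bound `g` for the measure allows
`G` to be null. -/
theorem sq_setIntegral_le {μ : Measure Ω} {M : Ω → ℝ} {G : Set Ω} [IsFiniteMeasure μ]
    (hM : Integrable M μ) (hM2 : Integrable (fun ω => M ω ^ 2) μ) {g : ℝ} (hg : 0 < g)
    (hG : μ.real G ≤ g) : (∫ ω in G, M ω ∂μ) ^ 2 ≤ g * ∫ ω in G, M ω ^ 2 ∂μ := by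
  set c := ∫ ω in G, M ω ∂μ with hc
  have h : 0 ≤ ∫ ω in G, (M ω ^ 2 - 2 * (c / g) * M ω + (c / g) ^ 2) ∂μ := by
    refine integral_nonneg fun ω => ?_
    simp only [Pi.zero_apply]
    nlinarith [sq_nonneg (M ω - c / g)]
  have i2 : Integrable (fun ω => 2 * (c / g) * M ω) (μ.restrict G) :=
    (hM.const_mul _).integrableOn
  have i1 : Integrable (fun ω => M ω ^ 2 - 2 * (c / g) * M ω) (μ.restrict G) :=
    hM2.integrableOn.sub i2
  rw [integral_add i1 (integrable_const _), integral_sub hM2.integrableOn i2, integral_const_mul,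
    ← hc, integral_const, measureReal_restrict_apply_univ, smul_eq_mul] at h
  have h2 : μ.real G * (c / g) ^ 2 ≤ g * (c / g) ^ 2 := by gcongr
  have h3 : g * (c / g) ^ 2 = c ^ 2 / g := by field_simp
  have h4 : 2 * (c / g) * c = 2 * (c ^ 2 / g) := by ring
  have h5 : c ^ 2 / g ≤ ∫ ω in G, M ω ^ 2 ∂μ := by linarith
  rwa [div_le_iff₀' hg] at h5

theorem setIntegral_eq_integral_indicator_mul {μ : Measure Ω} {E : Set Ω} (hE : MeasurableSet E) (f : Ω → ℝ) :
    ∫ ω in E, f ω ∂μ = ∫ ω, E.indicator (fun _ => (1 : ℝ)) ω * f ω ∂μ := by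
  rw [← integral_indicator hE]
  congr 1
  ext ω
  by_cases h : ω ∈ E <;> simp [h]

end TwoCopies

section NoiseLowerBound

variable {d : ℕ} {Ω : Type*} [mΩ : MeasurableSpace Ω] {μ : Measure Ω} [IsProbabilityMeasure μ]
  {Y : ℕ → Ω → Fin d} {ξ : ℕ → Ω → ℝ} {C : ℝ} {n : ℕ} {ω₀ : Ω}

/-- Two independent copies of a sum of noise, restricted to an event that nearly fills an atom,
differ about as much as they do on the whole atom. -/
theorem IsNoise.le_integral_prod_sub_sq (hξ : IsNoise μ Y ξ C) (hY : ∀ n, Measurable (Y n))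
    {F : Set Ω} (hF : MeasurableSet F) (hFE : F ⊆ atom Y n ω₀) {α : ℕ → ℝ} {m : ℕ} (hm : n ≤ m)
    {q t ε v : ℝ} (ht : 0 < t) (hε : 0 < ε) (hE0 : 0 < μ.real (atom Y n ω₀))
    (hq : ∑ l ∈ Finset.Ico n m, α l ^ 2 ≤ q)
    (hEF : μ.real (atom Y n ω₀ \ F) ≤ ε * μ.real (atom Y n ω₀))
    (hv : v ≤ ∫ ω in atom Y n ω₀, (∑ l ∈ Finset.Ico n m, α l * ξ l ω) ^ 2 ∂μ) :
    2 * μ.real F * (v - (t * ε + 11 * C ^ 4 * q ^ 2 / (4 * t)) * μ.real (atom Y n ω₀))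
      - 2 * (ε * (C ^ 2 * q)) * μ.real (atom Y n ω₀) ^ 2
      ≤ ∫ x, (∑ l ∈ Finset.Ico n m, α l * ξ l x.1 - ∑ l ∈ Finset.Ico n m, α l * ξ l x.2) ^ 2
          ∂((μ.restrict F).prod (μ.restrict F)) := by
  set E := atom Y n ω₀ with hEdef
  set M : Ω → ℝ := fun ω => ∑ l ∈ Finset.Ico n m, α l * ξ l ω with hMdef
  set e := μ.real E
  have hEm : MeasurableSet E := history_le hY n _ (measurableSet_history_atom Y n ω₀)
  have hM := hξ.dep_sum α n m
  have hI := dependsOnPast_indicator_atom Y n ω₀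
  have hI0 : ∀ ω, 0 ≤ (atom Y n ω₀).indicator (fun _ => (1 : ℝ)) ω := fun ω =>
    Set.indicator_nonneg (fun _ _ => zero_le_one) ω
  have hIint : ∫ ω, (atom Y n ω₀).indicator (fun _ => (1 : ℝ)) ω ∂μ = e := by
    rw [integral_indicator hEm, setIntegral_const, smul_eq_mul, mul_one]
  have i1 : Integrable M μ := hM.integrable hY
  have i2 : Integrable (fun ω => M ω ^ 2) μ := (hM.comp fun x => x ^ 2).integrable hY
  have i4 : Integrable (fun ω => M ω ^ 4) μ := (hM.comp fun x => x ^ 4).integrable hY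
  have hsum0 : 0 ≤ ∑ l ∈ Finset.Ico n m, α l ^ 2 := Finset.sum_nonneg fun l _ => sq_nonneg _
  have hq0 : 0 ≤ q := hsum0.trans hq
  have hmean : ∫ ω in E, M ω ∂μ = 0 := by
    rw [setIntegral_eq_integral_indicator_mul hEm]
    exact hξ.integral_sum hY hI α le_rfl
  have hsq : ∫ ω in E, M ω ^ 2 ∂μ ≤ C ^ 2 * q * e := by
    rw [setIntegral_eq_integral_indicator_mul hEm, ← hIint]
    refine (hξ.integral_sum_sq_le hY hI hI0 α le_rfl hm).trans ?_
    rw [hIint]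
    gcongr
  have hfour : ∫ ω in E, M ω ^ 4 ∂μ ≤ 11 * C ^ 4 * q ^ 2 * e := by
    rw [setIntegral_eq_integral_indicator_mul hEm, ← hIint]
    refine (hξ.integral_sum_pow_four_le hY hI hI0 α le_rfl hm).trans ?_
    rw [hIint]
    gcongr
  have hsplit1 : ∫ ω in F, M ω ∂μ + ∫ ω in E \ F, M ω ∂μ = 0 := by
    rw [← hmean, ← setIntegral_union Set.disjoint_sdiff_right (hEm.diff hF) i1.integrableOn
      i1.integrableOn, Set.union_sdiff_cancel hFE]
  have hsplit2 : ∫ ω in F, M ω ^ 2 ∂μ + ∫ ω in E \ F, M ω ^ 2 ∂μ = ∫ ω in E, M ω ^ 2 ∂μ := by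
    rw [← setIntegral_union Set.disjoint_sdiff_right (hEm.diff hF) i2.integrableOn
      i2.integrableOn, Set.union_sdiff_cancel hFE]
  have hrest2 : ∫ ω in E \ F, M ω ^ 2 ∂μ ≤ ∫ ω in E, M ω ^ 2 ∂μ :=
    setIntegral_mono_set i2.integrableOn (Filter.Eventually.of_forall fun ω => sq_nonneg _)
      Set.sdiff_subset.eventuallyLE
  have hrest4 : ∫ ω in E \ F, M ω ^ 4 ∂μ ≤ ∫ ω in E, M ω ^ 4 ∂μ :=
    setIntegral_mono_set i4.integrableOn (Filter.Eventually.of_forall fun ω => by positivity)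
      Set.sdiff_subset.eventuallyLE
  -- Truncation at level `t`: `M² ≤ t + M⁴ / (4 t)` pointwise, with the fourth moment taken over the
  -- whole atom.
  have hsmall : ∫ ω in E \ F, M ω ^ 2 ∂μ ≤ (t * ε + 11 * C ^ 4 * q ^ 2 / (4 * t)) * e := by
    have h1 : ∫ ω in E \ F, M ω ^ 2 ∂μ ≤ ∫ ω in E \ F, (t + 1 / (4 * t) * M ω ^ 4) ∂μ := by
      refine integral_mono i2.integrableOn
        ((integrable_const t).add (i4.integrableOn.const_mul _)) fun ω => ?_
      have h2 : t + 1 / (4 * t) * M ω ^ 4 - M ω ^ 2 = (M ω ^ 2 - 2 * t) ^ 2 / (4 * t) := by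
        field_simp
        ring
      have h3 : 0 ≤ (M ω ^ 2 - 2 * t) ^ 2 / (4 * t) := by positivity
      simp only
      linarith
    rw [integral_add (integrable_const t) (i4.integrableOn.const_mul _), integral_const,
      measureReal_restrict_apply_univ, smul_eq_mul, integral_const_mul] at h1
    have h2 : 1 / (4 * t) * ∫ ω in E \ F, M ω ^ 4 ∂μ ≤ 1 / (4 * t) * (11 * C ^ 4 * q ^ 2 * e) :=
      mul_le_mul_of_nonneg_left (hrest4.trans hfour) (by positivity)
    have h3 : μ.real (E \ F) * t ≤ ε * e * t := by gcongr
    have h4 : 1 / (4 * t) * (11 * C ^ 4 * q ^ 2 * e) = 11 * C ^ 4 * q ^ 2 / (4 * t) * e := by ring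
    rw [add_mul]
    linarith
  -- The mean over the atom is zero, so the mean over `F` is minus the mean over the small set `E \
  -- F`.
  have hcs : (∫ ω in F, M ω ∂μ) ^ 2 ≤ ε * e * (C ^ 2 * q * e) := by
    have h1 := sq_setIntegral_le i1 i2 (mul_pos hε hE0) hEF
    have h2 : ∫ ω in F, M ω ∂μ = - ∫ ω in E \ F, M ω ∂μ := by linarith
    rw [h2, neg_sq]
    exact h1.trans (mul_le_mul_of_nonneg_left (hrest2.trans hsq) (mul_pos hε hE0).le)
  have hML : MemLp M 2 (μ.restrict F) :=
    (memLp_two_iff_integrable_sq (hM.measurable hY).aestronglyMeasurable).2 i2.integrableOn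
  have hprod := integral_prod_sub_sq hML
  rw [measureReal_restrict_apply_univ] at hprod
  change _ ≤ ∫ x, (M x.1 - M x.2) ^ 2 ∂((μ.restrict F).prod (μ.restrict F))
  rw [hprod]
  have hf0 : 0 ≤ μ.real F := measureReal_nonneg
  have h5 : μ.real F * (v - (t * ε + 11 * C ^ 4 * q ^ 2 / (4 * t)) * e)
      ≤ μ.real F * ∫ ω in F, M ω ^ 2 ∂μ := by
    refine mul_le_mul_of_nonneg_left ?_ hf0
    linarith
  linarith

end NoiseLowerBound

end VRRW

namespace VRRW

open MeasureTheory Matrix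

/-! ### The corrected occupation vector and its linearized recursion. -/

section Corrected

variable {d : ℕ}

/-- The occupation vector, corrected so that its increments are drift plus martingale noise up to
an error of second order. -/
noncomputable def corrected (R : Matrix (Fin d) (Fin d) ℝ) (p s : Fin d → ℝ) (y : ℕ → Fin d)
    (k : ℕ) : Fin d → ℝ :=
  fun i => occupation s y k i + fundStep R p (occupation s y k) (y k) i / (∑ j, s j + k)

/-- The second order error in the increments of `corrected`. -/
noncomputable def remainder (R : Matrix (Fin d) (Fin d) ℝ) (p s : Fin d → ℝ) (y : ℕ → Fin d)
    (k : ℕ) : Fin d → ℝ :=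
  fun i => fundStep R p (occupation s y (k + 1)) (y (k + 1)) i
    - fundStep R p (occupation s y k) (y (k + 1)) i
    - fundStep R p (occupation s y k) (y k) i / (∑ j, s j + k)

/-- The martingale noise in the increments of `corrected`, cut off outside a ball about `p`. -/
noncomputable def noise (R : Matrix (Fin d) (Fin d) ℝ) (p s : Fin d → ℝ) (δ : ℝ) (ℓ : Fin d → ℝ)
    (y : ℕ → Fin d) (k : ℕ) : ℝ :=
  (Metric.ball p δ).indicator
    (fun v => (fund R p v *ᵥ ℓ) (y (k + 1)) - (fundStep R p v *ᵥ ℓ) (y k)) (occupation s y k)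

/-- The step sizes of the occupation vector. -/
noncomputable def stepSize (s : Fin d → ℝ) (k : ℕ) : ℝ := 1 / (∑ j, s j + (k + 1))

variable {R : Matrix (Fin d) (Fin d) ℝ} {p s ℓ : Fin d → ℝ} {y : ℕ → Fin d} {C σ ε δ : ℝ}
  {i₀ : Fin d}

theorem abs_dotProduct_le {v w : Fin d → ℝ} {c : ℝ} (h : ∀ i, |w i| ≤ c) :
    |v ⬝ᵥ w| ≤ (∑ i, |v i|) * c := by
  rw [Finset.sum_mul]
  refine (Finset.abs_sum_le_sum_abs _ _).trans (Finset.sum_le_sum fun i _ => ?_)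
  rw [abs_mul]
  exact mul_le_mul_of_nonneg_left (h i) (abs_nonneg _)

/-- The Poisson equation replaces the indicator of the next state by `stat` plus `fund` minus
`fundStep`. With `T = ∑ s + k` and step size `γ`, the last term of `remainder` comes from `1 / T - γ
= γ / T`. -/
theorem corrected_succ {v : Fin d → ℝ} (hs : ∀ i, 0 < s i)
    (hloc : LocalEstimates R p v C σ i₀ ε δ) {k : ℕ} (hk : occupation s y k ∈ Metric.ball p δ)
    (ℓ : Fin d → ℝ) :
    ℓ ⬝ᵥ corrected R p s y (k + 1) = ℓ ⬝ᵥ corrected R p s y k + stepSize s k *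
      (ℓ ⬝ᵥ drift R (occupation s y k) + ℓ ⬝ᵥ remainder R p s y k + noise R p s δ ℓ y k) := by
  have hnoise : noise R p s δ ℓ y k = ℓ ⬝ᵥ fun i => fund R p (occupation s y k) (y (k + 1)) i
      - fundStep R p (occupation s y k) (y k) i := by
    rw [noise, Set.indicator_of_mem hk]
    simp only [mulVec, dotProduct, ← Finset.sum_sub_distrib]
    exact Finset.sum_congr rfl fun i _ => by ring
  rw [hnoise]
  simp only [dotProduct, ← Finset.sum_add_distrib, Finset.mul_sum]
  refine Finset.sum_congr rfl fun i _ => ?_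
  have h0 := sum_pos_of_pos hs i
  have h1 : (∑ j, s j + (k : ℝ)) ≠ 0 := by positivity
  have h2 : (∑ j, s j + ((k : ℝ) + 1)) ≠ 0 := by positivity
  have hocc := occupation_succ_sub (y := y) hs k i
  have hpo := hloc.poisson _ hk (y (k + 1)) i
  have hocc' : occupation s y (k + 1) i = occupation s y k i
      + ((if y (k + 1) = i then 1 else 0) - occupation s y k i) / (∑ j, s j + ((k : ℝ) + 1)) := by
    linarith
  have hif : (if y (k + 1) = i then (1 : ℝ) else 0) = fund R p (occupation s y k) (y (k + 1)) i
      - fundStep R p (occupation s y k) (y (k + 1)) i + stat R (occupation s y k) i := by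
    linarith
  rw [hif] at hocc'
  simp only [corrected, remainder, stepSize, drift, Pi.sub_apply]
  rw [hocc']
  push_cast
  field_simp
  ring

theorem abs_remainder_le {v : Fin d → ℝ} (hs : ∀ i, 0 < s i) (hC : 0 < C)
    (hloc : LocalEstimates R p v C σ i₀ ε δ) {k : ℕ} (hk : occupation s y k ∈ Metric.ball p δ)
    (hk' : occupation s y (k + 1) ∈ Metric.ball p δ) (i : Fin d) :
    |remainder R p s y k i| ≤ 2 * C / (∑ j, s j + k) := by
  have h0 := sum_pos_of_pos hs i
  have h1 : 0 < (∑ j, s j + (k : ℝ)) := by positivity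
  have hnorm : ‖occupation s y (k + 1) - occupation s y k‖ ≤ 1 / (∑ j, s j + k) := by
    rw [pi_norm_le_iff_of_nonneg (by positivity)]
    intro j
    refine (abs_occupation_succ_sub_le hs k j).trans ?_
    apply one_div_le_one_div_of_le h1
    linarith
  have h2 := hloc.lipschitz _ hk' _ hk (y (k + 1)) i
  have h3 := hloc.fundStep_le _ hk (y k) i
  have h4 : |fundStep R p (occupation s y k) (y k) i / (∑ j, s j + k)| ≤ C / (∑ j, s j + k) := by
    rw [abs_div, abs_of_pos h1]
    gcongr
  have h5 : C * ‖occupation s y (k + 1) - occupation s y k‖ ≤ C / (∑ j, s j + k) := by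
    rw [div_eq_mul_one_div C]
    gcongr
  refine (abs_sub _ _).trans ?_
  have h6 : 2 * C / (∑ j, s j + (k : ℝ)) = C / (∑ j, s j + k) + C / (∑ j, s j + k) := by ring
  linarith

theorem abs_corrected_sub_le {v : Fin d → ℝ} (hs : ∀ i, 0 < s i)
    (hloc : LocalEstimates R p v C σ i₀ ε δ) {k : ℕ} (hk : occupation s y k ∈ Metric.ball p δ)
    (i : Fin d) : |corrected R p s y k i - occupation s y k i| ≤ C / (∑ j, s j + k) := by
  have h0 := sum_pos_of_pos hs i
  have h1 : 0 < (∑ j, s j + (k : ℝ)) := by positivity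
  rw [corrected, add_sub_cancel_left, abs_div, abs_of_pos h1]
  have := hloc.fundStep_le _ hk (y k) i
  gcongr

theorem abs_noise_le {v : Fin d → ℝ} (hC : 0 < C) (hloc : LocalEstimates R p v C σ i₀ ε δ)
    (ℓ : Fin d → ℝ) (k : ℕ) : |noise R p s δ ℓ y k| ≤ 2 * C * ∑ i, |ℓ i| := by
  have hpos : 0 ≤ ∑ i, |ℓ i| := Finset.sum_nonneg fun i _ => abs_nonneg _
  by_cases hk : occupation s y k ∈ Metric.ball p δ
  · rw [noise, Set.indicator_of_mem hk]
    refine (abs_sub _ _).trans ?_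
    have h1 : |(fund R p (occupation s y k) *ᵥ ℓ) (y (k + 1))| ≤ (∑ i, |ℓ i|) * C := by
      rw [mulVec, dotProduct_comm]
      exact abs_dotProduct_le (hloc.fund_le _ hk _)
    have h2 : |(fundStep R p (occupation s y k) *ᵥ ℓ) (y k)| ≤ (∑ i, |ℓ i|) * C := by
      rw [mulVec, dotProduct_comm]
      exact abs_dotProduct_le (hloc.fundStep_le _ hk _)
    linarith
  · rw [noise, Set.indicator_of_notMem hk, abs_zero]
    positivity

/-- The error in the linearized recursion, compared along two paths. -/
theorem sq_rest_le {v κ : Fin d → ℝ} {ℓ : Fin d → Fin d → ℝ} {y' : ℕ → Fin d} {B K τ : ℝ}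
    (hs : ∀ i, 0 < s i) (hC : 0 < C) (hε : 0 < ε) (hε1 : ε ≤ 1)
    (hloc : LocalEstimates R p v C σ i₀ ε δ)
    (heig : ∀ j w, ℓ j ⬝ᵥ jac R p *ᵥ w = κ j * (ℓ j ⬝ᵥ w))
    (hnorm : ∀ w : Fin d → ℝ, ∑ i, w i ^ 2 ≤ ∑ j, (ℓ j ⬝ᵥ w) ^ 2)
    (hB : ∀ j, ∑ i, |ℓ j i| ≤ B) (hK : ∀ j, |κ j| ≤ K) {k : ℕ} (hτ : 0 < τ)
    (hτk : τ ≤ ∑ j, s j + k)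
    (hk : occupation s y k ∈ Metric.ball p δ) (hk1 : occupation s y (k + 1) ∈ Metric.ball p δ)
    (hk' : occupation s y' k ∈ Metric.ball p δ)
    (hk1' : occupation s y' (k + 1) ∈ Metric.ball p δ) (j : Fin d) :
    ((ℓ j ⬝ᵥ drift R (occupation s y k) + ℓ j ⬝ᵥ remainder R p s y k)
      - (ℓ j ⬝ᵥ drift R (occupation s y' k) + ℓ j ⬝ᵥ remainder R p s y' k)
      - κ j * (ℓ j ⬝ᵥ corrected R p s y k - ℓ j ⬝ᵥ corrected R p s y' k)) ^ 2
      ≤ 2 * (B * ε) ^ 2 *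
          ∑ i, (ℓ i ⬝ᵥ corrected R p s y k - ℓ i ⬝ᵥ corrected R p s y' k) ^ 2
        + 2 * (B * C * (6 + 2 * K)) ^ 2 / τ ^ 2 := by
  set V := occupation s y k
  set V' := occupation s y' k
  set X := corrected R p s y k
  set X' := corrected R p s y' k
  set r := remainder R p s y k
  set r' := remainder R p s y' k
  set T := ∑ j, s j + (k : ℝ)
  have hT : 0 < T := hτ.trans_le hτk
  have hB0 : 0 ≤ B := (Finset.sum_nonneg fun i _ => abs_nonneg _).trans (hB j)
  have hK0 : 0 ≤ K := (abs_nonneg _).trans (hK j)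
  set W := ∑ i, (ℓ i ⬝ᵥ X - ℓ i ⬝ᵥ X') ^ 2 with hW
  have hW0 : 0 ≤ W := Finset.sum_nonneg fun i _ => sq_nonneg _
  -- The eigencoordinates dominate the Euclidean norm, so `√W` bounds each coordinate of the
  -- difference.
  have hXX : ∀ i, |X i - X' i| ≤ √W := by
    intro i
    rw [← Real.sqrt_sq_eq_abs]
    apply Real.sqrt_le_sqrt
    have h1 := hnorm (X - X')
    simp only [dotProduct_sub] at h1
    refine le_trans ?_ h1
    exact Finset.single_le_sum (f := fun i => (X - X') i ^ 2) (fun i _ => sq_nonneg _)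
      (Finset.mem_univ i)
  have hXV : ∀ i, |X i - V i| ≤ C / T := abs_corrected_sub_le hs hloc hk
  have hXV' : ∀ i, |X' i - V' i| ≤ C / T := abs_corrected_sub_le hs hloc hk'
  have hCT : 0 < C / T := div_pos hC hT
  have hVV : ‖V - V'‖ ≤ √W + 2 * (C / T) := by
    rw [pi_norm_le_iff_of_nonneg (by positivity)]
    intro i
    rw [Pi.sub_apply, Real.norm_eq_abs, abs_le]
    have h1 := abs_le.1 (hXX i)
    have h2 := abs_le.1 (hXV i)
    have h3 := abs_le.1 (hXV' i)
    constructor <;> linarith [h1.1, h1.2, h2.1, h2.2, h3.1, h3.2]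
  have hlin : |ℓ j ⬝ᵥ (drift R V - drift R V' - jac R p *ᵥ (V - V'))|
      ≤ B * (ε * (√W + 2 * (C / T))) := by
    refine (abs_dotProduct_le fun i => (norm_le_pi_norm _ i).trans
      (hloc.linearize V hk V' hk')).trans ?_
    gcongr
    exact hB j
  have hr : |ℓ j ⬝ᵥ r| ≤ B * (2 * (C / T)) := by
    refine (abs_dotProduct_le fun i => abs_remainder_le hs hC hloc hk hk1 i).trans ?_
    rw [mul_div_assoc]
    gcongr
    exact hB j
  have hr' : |ℓ j ⬝ᵥ r'| ≤ B * (2 * (C / T)) := by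
    refine (abs_dotProduct_le fun i => abs_remainder_le hs hC hloc hk' hk1' i).trans ?_
    rw [mul_div_assoc]
    gcongr
    exact hB j
  have hx : |κ j * (ℓ j ⬝ᵥ (X - V))| ≤ K * (B * (C / T)) := by
    rw [abs_mul]
    have h1 : |ℓ j ⬝ᵥ (X - V)| ≤ B * (C / T) :=
      (abs_dotProduct_le hXV).trans (by gcongr; exact hB j)
    have h2 := hK j
    gcongr
  have hx' : |κ j * (ℓ j ⬝ᵥ (X' - V'))| ≤ K * (B * (C / T)) := by
    rw [abs_mul]
    have h1 : |ℓ j ⬝ᵥ (X' - V')| ≤ B * (C / T) :=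
      (abs_dotProduct_le hXV').trans (by gcongr; exact hB j)
    have h2 := hK j
    gcongr
  have heq : (ℓ j ⬝ᵥ drift R V + ℓ j ⬝ᵥ r) - (ℓ j ⬝ᵥ drift R V' + ℓ j ⬝ᵥ r')
      - κ j * (ℓ j ⬝ᵥ X - ℓ j ⬝ᵥ X')
      = ℓ j ⬝ᵥ (drift R V - drift R V' - jac R p *ᵥ (V - V')) + ℓ j ⬝ᵥ r - ℓ j ⬝ᵥ r'
        - κ j * (ℓ j ⬝ᵥ (X - V)) + κ j * (ℓ j ⬝ᵥ (X' - V')) := by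
    simp only [dotProduct_sub, heig]
    ring
  have hCτ : C / T ≤ C / τ := by gcongr
  -- In `6 + 2 K`, linearization contributes 2 (using `ε ≤ 1`), the two remainders 2 each, and
  -- replacing the corrected by the uncorrected vectors in the linear term `2 K`.
  have habs : |(ℓ j ⬝ᵥ drift R V + ℓ j ⬝ᵥ r) - (ℓ j ⬝ᵥ drift R V' + ℓ j ⬝ᵥ r')
      - κ j * (ℓ j ⬝ᵥ X - ℓ j ⬝ᵥ X')| ≤ B * ε * √W + B * C * (6 + 2 * K) / τ := by
    have hsmall : B * (ε * (2 * (C / T))) ≤ B * (2 * (C / T)) := by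
      have : ε * (2 * (C / T)) ≤ 1 * (2 * (C / T)) := by gcongr
      rw [one_mul] at this
      gcongr
    have hτ' : (6 + 2 * K) * (B * (C / T)) ≤ (6 + 2 * K) * (B * (C / τ)) := by gcongr
    have e1 : B * C * (6 + 2 * K) / τ = (6 + 2 * K) * (B * (C / τ)) := by ring
    rw [heq, e1, abs_le]
    rw [abs_le] at hlin hr hr' hx hx'
    constructor <;> nlinarith [hlin.1, hlin.2, hr.1, hr.2, hr'.1, hr'.2, hx.1, hx.2, hx'.1, hx'.2]
  have hfin := pow_le_pow_left₀ (abs_nonneg _) habs 2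
  rw [sq_abs] at hfin
  refine hfin.trans ?_
  have e2 : 2 * (B * ε) ^ 2 * W + 2 * (B * C * (6 + 2 * K)) ^ 2 / τ ^ 2
      = 2 * (B * ε * √W) ^ 2 + 2 * (B * C * (6 + 2 * K) / τ) ^ 2 := by
    rw [mul_pow (B * ε) (√W), Real.sq_sqrt hW0, div_pow]
    ring
  rw [e2]
  nlinarith [sq_nonneg (B * ε * √W - B * C * (6 + 2 * K) / τ)]

end Corrected

/-! ### The noise of the process: centering and conditional variance. -/

section ProcessNoise

variable {d : ℕ} {Ω : Type*} [mΩ : MeasurableSpace Ω] {R : Matrix (Fin d) (Fin d) ℝ}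
  {s p v : Fin d → ℝ} {y₀ : Fin d} {μ : Measure Ω} [IsProbabilityMeasure μ] {Y : ℕ → Ω → Fin d}
  {C σ ε δ : ℝ} {i₀ : Fin d}

/-- The increment of noise if the next state is `j`. -/
noncomputable def noiseAt (R : Matrix (Fin d) (Fin d) ℝ) (p s : Fin d → ℝ) (δ : ℝ) (ℓ : Fin d → ℝ)
    (y : ℕ → Fin d) (k : ℕ) (j : Fin d) : ℝ :=
  (Metric.ball p δ).indicator
    (fun v => (fund R p v *ᵥ ℓ) j - (fundStep R p v *ᵥ ℓ) (y k)) (occupation s y k)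

theorem noise_eq_noiseAt (δ : ℝ) (ℓ : Fin d → ℝ) (y : ℕ → Fin d) (k : ℕ) :
    noise R p s δ ℓ y k = noiseAt R p s δ ℓ y k (y (k + 1)) := rfl

theorem dependsOnPast_noiseAt {Ω : Type*} (Y : ℕ → Ω → Fin d) (ℓ : Fin d → ℝ) (k : ℕ) (j : Fin d) :
    DependsOnPast Y k (fun ω => noiseAt R p s δ ℓ (fun n => Y n ω) k j) :=
  (dependsOnPast_occupation s Y k).comp₂ (DependsOnPast.self le_rfl) fun v i =>
    (Metric.ball p δ).indicator (fun v => (fund R p v *ᵥ ℓ) j - (fundStep R p v *ᵥ ℓ) i) v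

theorem fundStep_mulVec (v ℓ : Fin d → ℝ) (i : Fin d) :
    (fundStep R p v *ᵥ ℓ) i = ∑ j, trans R v i j * (fund R p v *ᵥ ℓ) j := by
  rw [fundStep, ← mulVec_mulVec]
  rfl

/-- `fundStep` is the one-step mean of `fund`. The cutoff depends only on the past, so centering
holds on the whole space and moments can be computed on full atoms, although the paths of interest
stay in the ball. -/
theorem IsReinforcedProcess.isNoise (hsymm : R.IsSymm) (hnonneg : ∀ i j, 0 ≤ R i j)
    (hcol : ∀ j, 0 < ∑ i, R i j) (hY : IsReinforcedProcess R s y₀ μ Y) (hs : ∀ i, 0 < s i)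
    (hC : 0 < C) (hloc : LocalEstimates R p v C σ i₀ ε δ) (ℓ : Fin d → ℝ) {B : ℝ}
    (hB : ∑ i, |ℓ i| ≤ B) :
    IsNoise μ Y (fun k ω => noise R p s δ ℓ (fun n => Y n ω) k) (2 * C * B) where
  dep l := by
    intro ω ω' h
    have h1 := fun j => dependsOnPast_noiseAt (R := R) (p := p) (s := s) (δ := δ) Y ℓ l j ω ω'
      fun i hi => h i (hi.trans (Nat.le_succ l))
    simp only [noise_eq_noiseAt]
    rw [h (l + 1) le_rfl]
    exact h1 _
  bound l ω := (abs_noise_le hC hloc ℓ l).trans (by gcongr)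
  centered l G hG := by
    simp only [noise_eq_noiseAt]
    rw [hY.integral_step hs (F := fun j ω => G ω * noiseAt R p s δ ℓ (fun n => Y n ω) l j)
      fun j => hG.mul (dependsOnPast_noiseAt Y ℓ l j)]
    refine integral_eq_zero_of_ae (Filter.Eventually.of_forall fun ω => ?_)
    have hone := sum_trans_occupation (s := s) (y := fun n => Y n ω) hsymm hnonneg hcol hs l (Y l ω)
    simp only [Pi.zero_apply, noiseAt]
    by_cases hk : occupation s (fun n => Y n ω) l ∈ Metric.ball p δ
    · simp only [Set.indicator_of_mem hk]
      have h1 : ∀ j, trans R (occupation s (fun n => Y n ω) l) (Y l ω) j *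
          (G ω * ((fund R p (occupation s (fun n => Y n ω) l) *ᵥ ℓ) j
            - (fundStep R p (occupation s (fun n => Y n ω) l) *ᵥ ℓ) (Y l ω)))
          = G ω * (trans R (occupation s (fun n => Y n ω) l) (Y l ω) j
              * (fund R p (occupation s (fun n => Y n ω) l) *ᵥ ℓ) j)
            - G ω * (fundStep R p (occupation s (fun n => Y n ω) l) *ᵥ ℓ) (Y l ω)
              * trans R (occupation s (fun n => Y n ω) l) (Y l ω) j := fun j => by ring
      rw [Finset.sum_congr rfl fun j _ => h1 j, Finset.sum_sub_distrib, ← Finset.mul_sum,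
        ← Finset.mul_sum, hone, ← fundStep_mulVec]
      ring
    · simp [Set.indicator_of_notMem hk]

/-- Visits to `i₀` while the occupation vector is near `p` contribute to the conditional variance
of the noise. -/
theorem IsReinforcedProcess.le_integral_noise_sq (hsymm : R.IsSymm) (hnonneg : ∀ i j, 0 ≤ R i j)
    (hcol : ∀ j, 0 < ∑ i, R i j) (hY : IsReinforcedProcess R s y₀ μ Y) (hs : ∀ i, 0 < s i)
    {ℓ : Fin d → ℝ} (hloc : LocalEstimates R p ℓ C σ i₀ ε δ) {I : Ω → ℝ} {k : ℕ}
    (hI : DependsOnPast Y k I) (hI0 : ∀ ω, 0 ≤ I ω) :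
    σ * ∫ ω, I ω * (Metric.ball p δ).indicator (fun _ => if Y k ω = i₀ then (1 : ℝ) else 0)
        (occupation s (fun n => Y n ω) k) ∂μ
      ≤ ∫ ω, I ω * noise R p s δ ℓ (fun n => Y n ω) k ^ 2 ∂μ := by
  simp only [noise_eq_noiseAt]
  have hdn := fun j => dependsOnPast_noiseAt (R := R) (p := p) (s := s) (δ := δ) Y ℓ k j
  have hdt : ∀ j, DependsOnPast Y k
      (fun ω => trans R (occupation s (fun n => Y n ω) k) (Y k ω) j) := fun j =>
    (dependsOnPast_occupation s Y k).comp₂ (DependsOnPast.self le_rfl) fun v i => trans R v i j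
  have hdF : ∀ j, DependsOnPast Y k
      (fun ω => I ω * noiseAt R p s δ ℓ (fun n => Y n ω) k j ^ 2) := fun j =>
    hI.comp₂ (hdn j) fun x y => x * y ^ 2
  rw [hY.integral_step hs (F := fun j ω => I ω * noiseAt R p s δ ℓ (fun n => Y n ω) k j ^ 2) hdF,
    ← integral_const_mul]
  have hdB : DependsOnPast Y k (fun ω => (Metric.ball p δ).indicator
      (fun _ => if Y k ω = i₀ then (1 : ℝ) else 0) (occupation s (fun n => Y n ω) k)) :=
    (dependsOnPast_occupation s Y k).comp₂ (DependsOnPast.self le_rfl) fun v i =>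
      (Metric.ball p δ).indicator (fun _ => if i = i₀ then (1 : ℝ) else 0) v
  refine integral_mono (((hI.mul hdB).comp fun x => σ * x).integrable hY.measurable)
    ((DependsOnPast.sum fun j _ => (hdt j).mul (hdF j)).integrable hY.measurable) fun ω => ?_
  have hone := sum_trans_occupation (s := s) (y := fun n => Y n ω) hsymm hnonneg hcol hs k (Y k ω)
  have htn := fun j => trans_occupation_nonneg (y := fun n => Y n ω) hnonneg hs k (Y k ω) j
  simp only
  by_cases hk : occupation s (fun n => Y n ω) k ∈ Metric.ball p δ ∧ Y k ω = i₀
  · obtain ⟨hk1, hk2⟩ := hk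
    simp only [noiseAt, Set.indicator_of_mem hk1, if_pos hk2, mul_one]
    have hv := hloc.variance _ hk1
    rw [← hk2, sum_mul_sq_sub_sq hone] at hv
    simp only [fundStep_mulVec]
    have h1 := mul_le_mul_of_nonneg_left hv (hI0 ω)
    rw [Finset.mul_sum] at h1
    rw [mul_comm]
    refine h1.trans (le_of_eq (Finset.sum_congr rfl fun j _ => by ring))
  · have h0 : (Metric.ball p δ).indicator (fun _ => if Y k ω = i₀ then (1 : ℝ) else 0)
        (occupation s (fun n => Y n ω) k) = 0 := by
      rw [not_and_or] at hk
      rcases hk with hk | hk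
      · exact Set.indicator_of_notMem hk _
      · by_cases h : occupation s (fun n => Y n ω) k ∈ Metric.ball p δ
        · rw [Set.indicator_of_mem h, if_neg hk]
        · exact Set.indicator_of_notMem h _
    rw [h0, mul_zero, mul_zero]
    exact Finset.sum_nonneg fun j _ => mul_nonneg (htn j) (mul_nonneg (hI0 ω) (sq_nonneg _))

end ProcessNoise

end VRRW

namespace VRRW

open MeasureTheory Matrix

/-! ### Step sizes and visit counts. -/

section Steps

variable {d : ℕ} {s : Fin d → ℝ}

theorem stepSize_pos (hs : 0 < ∑ j, s j) (k : ℕ) : 0 < stepSize s k := by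
  unfold stepSize
  positivity

theorem sum_sq_stepSize_le (hs : 0 < ∑ j, s j) (n m : ℕ) :
    ∑ l ∈ Finset.Ico n m, stepSize s l ^ 2 ≤ 1 / (∑ j, s j + n) := by
  rcases le_or_gt n m with h | h
  · have key : ∑ l ∈ Finset.Ico n m, stepSize s l ^ 2 ≤
        1 / (∑ j, s j + n) - 1 / (∑ j, s j + m) := by
      induction m, h using Nat.le_induction with
      | base => simp
      | succ m h ih =>
        rw [Finset.sum_Ico_succ_top h]
        have h1 : stepSize s m ^ 2 ≤ 1 / (∑ j, s j + m) - 1 / (∑ j, s j + (m + 1)) := by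
          have h2 : 0 < ∑ j, s j + (m : ℝ) := by positivity
          have h3 : 0 < ∑ j, s j + ((m : ℝ) + 1) := by positivity
          rw [div_sub_div _ _ h2.ne' h3.ne', stepSize, div_pow, div_le_div_iff₀ (by positivity)
            (by positivity)]
          nlinarith
        push_cast
        linarith
    have : 0 ≤ 1 / (∑ j, s j + (m : ℝ)) := by positivity
    linarith
  · rw [Finset.Ico_eq_empty_of_le h.le, Finset.sum_empty]
    positivity

theorem tendsto_sum_stepSize (hs : 0 < ∑ j, s j) (k : ℕ) :
    Filter.Tendsto (fun m => ∑ i ∈ Finset.Ico k m, stepSize s i) Filter.atTop Filter.atTop := by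
  have h1 := (Real.tendsto_sum_range_one_div_nat_succ_atTop).const_mul_atTop
    (show 0 < 1 / (∑ j, s j + 1) by positivity)
  have h2 : Filter.Tendsto (fun m => ∑ i ∈ Finset.range m, stepSize s i)
      Filter.atTop Filter.atTop := by
    refine Filter.tendsto_atTop_mono (fun m => ?_) h1
    rw [Finset.mul_sum]
    refine Finset.sum_le_sum fun i _ => ?_
    rw [stepSize, div_mul_div_comm, one_mul]
    apply one_div_le_one_div_of_le (by positivity)
    have : (0 : ℝ) ≤ i := by positivity
    nlinarith
  have h3 := Filter.tendsto_atTop_add_const_right _ (- ∑ i ∈ Finset.range k, stepSize s i) h2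
  refine h3.congr' ?_
  filter_upwards [Filter.eventually_ge_atTop k] with m hm
  rw [Finset.sum_Ico_eq_sub _ hm, sub_eq_add_neg]

/-- There are at most `n + 1 ≤ 2 n` factors with step size at most `1 / n`. Discounting over a
doubling of time thus costs only a constant factor. -/
theorem growth_stepSize_le {κ : ℝ} (hκ : 0 ≤ κ) (hs : 0 < ∑ j, s j) {n m : ℕ} (hn : 1 ≤ n)
    (hm : m ≤ 2 * n + 1) : growth κ (stepSize s) n m ≤ Real.exp (2 * κ) := by
  have h1 : growth κ (stepSize s) n m ≤ ∏ i ∈ Finset.Ico n m, Real.exp (κ * stepSize s i) := by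
    refine Finset.prod_le_prod (fun i _ => ?_) fun i _ => ?_
    · have := (stepSize_pos hs i).le
      positivity
    · rw [add_comm]
      exact Real.add_one_le_exp _
  refine h1.trans ?_
  rw [← Real.exp_sum, ← Finset.mul_sum, mul_comm]
  apply Real.exp_le_exp.2
  refine mul_le_mul_of_nonneg_right ?_ hκ
  have hn0 : (0 : ℝ) < n := by exact_mod_cast hn
  have h2 : ∀ i ∈ Finset.Ico n m, stepSize s i ≤ 1 / n := by
    intro i hi
    have hi' : (n : ℝ) ≤ i := by exact_mod_cast (Finset.mem_Ico.1 hi).1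
    rw [stepSize]
    apply one_div_le_one_div_of_le hn0
    linarith
  refine (Finset.sum_le_card_nsmul _ _ _ h2).trans ?_
  rw [Nat.card_Ico, nsmul_eq_mul, mul_one_div, div_le_iff₀ hn0]
  have h3 : m - n ≤ 2 * n := by omega
  exact_mod_cast h3

theorem sum_visits (y : ℕ → Fin d) (i : Fin d) {n m : ℕ} (h : n ≤ m) :
    ∑ l ∈ Finset.Ico (n + 1) (m + 1), (if y l = i then (1 : ℝ) else 0)
      = weight s y m i - weight s y n i := by
  induction m, h using Nat.le_induction with
  | base => simp
  | succ m h ih =>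
    rw [Finset.sum_Ico_succ_top (by omega), ih, weight_succ]
    ring

/-- A path whose occupation vector is near `p` at times `n` and `2 n` visits each state often in
between. -/
theorem le_sum_visits {p : Fin d → ℝ} {y : ℕ → Fin d} {i : Fin d} {δ : ℝ} {n : ℕ}
    (hs : 0 < ∑ j, s j) (hn : ∑ j, s j ≤ n) (hδ : δ ≤ p i / 10)
    (h1 : occupation s y n ∈ Metric.ball p δ) (h2 : occupation s y (2 * n) ∈ Metric.ball p δ) :
    p i * n / 2 ≤ ∑ l ∈ Finset.Ico (n + 1) (2 * n + 1), (if y l = i then (1 : ℝ) else 0) := by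
  rw [sum_visits (s := s) y i (by omega)]
  have key : ∀ m, occupation s y m ∈ Metric.ball p δ →
      (p i - δ) * (∑ j, s j + m) ≤ weight s y m i ∧
        weight s y m i ≤ (p i + δ) * (∑ j, s j + m) := by
    intro m hm
    have h3 : |occupation s y m i - p i| < δ :=
      (dist_le_pi_dist (occupation s y m) p i).trans_lt hm
    have h4 : 0 < ∑ j, s j + (m : ℝ) := by positivity
    have h5 : weight s y m i = occupation s y m i * (∑ j, s j + m) := by
      rw [occupation_eq, div_mul_cancel₀ _ h4.ne']
    rw [abs_lt] at h3
    rw [h5]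
    constructor <;> refine mul_le_mul_of_nonneg_right ?_ h4.le <;> linarith
  -- The difference of the weights is at least `p i * n - δ (2 ∑ s + 3 n) ≥ p i * n - 5 δ n`, and `δ
  -- ≤ p i / 10`.
  have e1 := (key n h1).2
  have e2 := (key (2 * n) h2).1
  push_cast at e2
  have hn0 : (0 : ℝ) ≤ n := by positivity
  have hδ0 : 0 < δ := Metric.pos_of_mem_ball h1
  nlinarith

end Steps

section MainEstimate

variable {d : ℕ} {Ω : Type*} [mΩ : MeasurableSpace Ω] {R : Matrix (Fin d) (Fin d) ℝ}
  {s p : Fin d → ℝ} {y₀ : Fin d} {μ : Measure Ω} [IsProbabilityMeasure μ] {Y : ℕ → Ω → Fin d}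
  {C σ ε δ : ℝ} {i₀ : Fin d} {n : ℕ} {ω₀ : Ω} {F : Set Ω}

/-- By orthogonality the variances add, and only times `n < l ≤ 2 n` are kept. There the discount is
at least `exp (-2 κ)` and the step size at least `1 / (4 τ)`, and on `F` there are at least `p i₀ *
n / 2` visits, each worth `σ`. With `n ≥ τ / 2` this gives `64 = 16 * 2 * 2`. -/
theorem IsReinforcedProcess.le_setIntegral_noise_sq (hsymm : R.IsSymm)
    (hnonneg : ∀ i j, 0 ≤ R i j) (hcol : ∀ j, 0 < ∑ i, R i j)
    (hY : IsReinforcedProcess R s y₀ μ Y) (hs : ∀ i, 0 < s i) {ℓ : Fin d → ℝ} {κ : ℝ}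
    (hκ : 0 ≤ κ) (hσ : 0 < σ) (hC : 0 < C) (hloc : LocalEstimates R p ℓ C σ i₀ ε δ)
    (hF : MeasurableSet F) (hFE : F ⊆ atom Y n ω₀)
    (hstay : ∀ ω ∈ F, ∀ k, n ≤ k → occupation s (fun n => Y n ω) k ∈ Metric.ball p δ)
    (hn : 1 ≤ n) (hns : ∑ j, s j ≤ n) {m : ℕ} (hm : 2 * n + 1 ≤ m) :
    (Real.exp (2 * κ))⁻¹ ^ 2 * σ * p i₀ / 64 * μ.real F / (∑ j, s j + n)
      ≤ ∫ ω in atom Y n ω₀, (∑ l ∈ Finset.Ico n m, (growth κ (stepSize s) n (l + 1))⁻¹ *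
          stepSize s l * noise R p s δ ℓ (fun n => Y n ω) l) ^ 2 ∂μ := by
  have hT : 0 < ∑ j, s j := sum_pos_of_pos hs i₀
  have hEm : MeasurableSet (atom Y n ω₀) :=
    history_le hY.measurable n _ (measurableSet_history_atom Y n ω₀)
  have hI := dependsOnPast_indicator_atom Y n ω₀
  set I := (atom Y n ω₀).indicator fun _ => (1 : ℝ) with hIdef
  have hI0 : ∀ ω, 0 ≤ I ω := fun ω => Set.indicator_nonneg (fun _ _ => zero_le_one) ω
  have hnoise := hY.isNoise hsymm hnonneg hcol hs hC hloc ℓ le_rfl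
  set τ : ℝ := ∑ j, s j + n with hτ
  have hn0 : (0 : ℝ) < n := by exact_mod_cast hn
  have hn1 : (1 : ℝ) ≤ n := by exact_mod_cast hn
  have hτ0 : 0 < τ := by positivity
  set α : ℕ → ℝ := fun l => (growth κ (stepSize s) n (l + 1))⁻¹ * stepSize s l with hα
  rw [setIntegral_eq_integral_indicator_mul hEm]
  have hsq := hnoise.integral_sum_sq hY.measurable hI α le_rfl (show n ≤ m by omega)
  rw [show ∫ ω, I ω * (∑ l ∈ Finset.Ico n m, (growth κ (stepSize s) n (l + 1))⁻¹ *
          stepSize s l * noise R p s δ ℓ (fun n => Y n ω) l) ^ 2 ∂μ = _ from hsq]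
  have hstep0 : ∀ l, 0 < stepSize s l := stepSize_pos hT
  have hgpos : ∀ l, 0 < growth κ (stepSize s) n l := fun l =>
    lt_of_lt_of_le one_pos (one_le_growth hκ (fun k => (hstep0 k).le) n l)
  let V : ℕ → Ω → ℝ := fun l ω => (Metric.ball p δ).indicator
    (fun _ => if Y l ω = i₀ then (1 : ℝ) else 0) (occupation s (fun n => Y n ω) l)
  have hV0 : ∀ l ω, 0 ≤ V l ω := fun l ω =>
    Set.indicator_nonneg (fun _ _ => by split_ifs <;> simp) _
  have hVdep : ∀ l, DependsOnPast Y l (V l) := fun l =>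
    (dependsOnPast_occupation s Y l).comp₂ (DependsOnPast.self le_rfl) fun v i =>
      (Metric.ball p δ).indicator (fun _ => if i = i₀ then (1 : ℝ) else 0) v
  have hIV : ∀ l, n ≤ l → Integrable (fun ω => I ω * V l ω) μ := fun l hl =>
    ((hI.mono hl).mul (hVdep l)).integrable hY.measurable
  have hnn : ∀ l, 0 ≤ ∫ ω, I ω * noise R p s δ ℓ (fun n => Y n ω) l ^ 2 ∂μ := fun l =>
    integral_nonneg fun ω => mul_nonneg (hI0 ω) (sq_nonneg _)
  have hsub : Finset.Ico (n + 1) (2 * n + 1) ⊆ Finset.Ico n m :=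
    Finset.Ico_subset_Ico (Nat.le_succ n) hm
  refine le_trans ?_ (Finset.sum_le_sum_of_subset_of_nonneg hsub fun l _ _ =>
    mul_nonneg (sq_nonneg _) (hnn l))
  have hαlow : ∀ l ∈ Finset.Ico (n + 1) (2 * n + 1),
      (Real.exp (2 * κ))⁻¹ ^ 2 / (16 * τ ^ 2) ≤ α l ^ 2 := by
    intro l hl
    have hl' := Finset.mem_Ico.1 hl
    have h1 : growth κ (stepSize s) n (l + 1) ≤ Real.exp (2 * κ) :=
      growth_stepSize_le hκ hT hn (by omega)
    have h2 : 1 / (4 * τ) ≤ stepSize s l := by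
      rw [stepSize]
      apply one_div_le_one_div_of_le (by positivity)
      have : (l : ℝ) ≤ 2 * n := by exact_mod_cast (Nat.le_of_lt_succ hl'.2)
      linarith
    have h3 : (Real.exp (2 * κ))⁻¹ ≤ (growth κ (stepSize s) n (l + 1))⁻¹ :=
      inv_anti₀ (hgpos _) h1
    have h4 : (Real.exp (2 * κ))⁻¹ * (1 / (4 * τ)) ≤ α l :=
      mul_le_mul h3 h2 (by positivity) (inv_nonneg.2 (hgpos _).le)
    have h5 := pow_le_pow_left₀ (by positivity) h4 2
    refine le_trans (le_of_eq ?_) h5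
    rw [mul_pow, div_pow]
    ring
  have hlow : ∀ l ∈ Finset.Ico (n + 1) (2 * n + 1),
      (Real.exp (2 * κ))⁻¹ ^ 2 / (16 * τ ^ 2) * (σ * ∫ ω, I ω * V l ω ∂μ)
        ≤ α l ^ 2 * ∫ ω, I ω * noise R p s δ ℓ (fun n => Y n ω) l ^ 2 ∂μ := by
    intro l hl
    have hnl : n ≤ l := (Nat.le_succ n).trans (Finset.mem_Ico.1 hl).1
    have h1 := hY.le_integral_noise_sq hsymm hnonneg hcol hs hloc (hI.mono hnl) hI0
    have h2 : 0 ≤ ∫ ω, I ω * V l ω ∂μ :=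
      integral_nonneg fun ω => mul_nonneg (hI0 ω) (hV0 l ω)
    exact mul_le_mul (hαlow l hl) h1 (by positivity) (sq_nonneg _)
  refine le_trans ?_ (Finset.sum_le_sum hlow)
  rw [← Finset.mul_sum, ← Finset.mul_sum, ← integral_finsetSum _ fun l hl =>
    hIV l ((Nat.le_succ n).trans (Finset.mem_Ico.1 hl).1)]
  have hvis : p i₀ * n / 2 * μ.real F
      ≤ ∫ ω, ∑ l ∈ Finset.Ico (n + 1) (2 * n + 1), I ω * V l ω ∂μ := by
    have h1 : p i₀ * n / 2 * μ.real F = ∫ ω, F.indicator (fun _ => p i₀ * n / 2) ω ∂μ := by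
      rw [integral_indicator hF, setIntegral_const, smul_eq_mul, mul_comm]
    rw [h1]
    refine integral_mono ((integrable_const _).indicator hF)
      (integrable_finsetSum _ fun l hl =>
        hIV l ((Nat.le_succ n).trans (Finset.mem_Ico.1 hl).1)) fun ω => ?_
    by_cases hω : ω ∈ F
    · have hIω : I ω = 1 := Set.indicator_of_mem (hFE hω) _
      simp only [Set.indicator_of_mem hω, hIω, one_mul]
      refine (le_sum_visits hT hns hloc.le (hstay ω hω n le_rfl)
        (hstay ω hω (2 * n) (by omega))).trans (le_of_eq (Finset.sum_congr rfl fun l hl => ?_))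
      simp only [V]
      rw [Set.indicator_of_mem (hstay ω hω l ((Nat.le_succ n).trans (Finset.mem_Ico.1 hl).1))]
    · rw [Set.indicator_of_notMem hω]
      exact Finset.sum_nonneg fun l _ => mul_nonneg (hI0 ω) (hV0 l ω)
  have hz : 0 < (Real.exp (2 * κ))⁻¹ ^ 2 := by positivity
  have hp0 : 0 < p i₀ := by
    have := hloc.pos.trans_le hloc.le
    linarith
  have hf0 : 0 ≤ μ.real F := measureReal_nonneg
  refine le_trans ?_ (mul_le_mul_of_nonneg_left (mul_le_mul_of_nonneg_left hvis hσ.le)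
    (by positivity))
  have hnτ : τ / 2 ≤ n := by linarith
  have e1 : (Real.exp (2 * κ))⁻¹ ^ 2 * σ * p i₀ / 64 * μ.real F / τ
      = (Real.exp (2 * κ))⁻¹ ^ 2 / (16 * τ ^ 2) * (σ * (p i₀ * (τ / 2) / 2 * μ.real F)) := by
    field_simp
    ring
  rw [e1]
  gcongr

end MainEstimate

end VRRW

namespace VRRW

open MeasureTheory Matrix

/-! ### Differences of two copies form a Perron system. -/

section Main

variable {d : ℕ} {Ω : Type*} [mΩ : MeasurableSpace Ω] {R : Matrix (Fin d) (Fin d) ℝ}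
  {s p : Fin d → ℝ} {y₀ : Fin d} {μ : Measure Ω} [IsProbabilityMeasure μ] {Y : ℕ → Ω → Fin d}
  {C σ ε δ : ℝ} {i₀ : Fin d} {n : ℕ} {ω₀ : Ω} {F : Set Ω}

theorem ae_prod_restrict_mem (hF : MeasurableSet F) :
    ∀ᵐ x ∂((μ.restrict F).prod (μ.restrict F)), x.1 ∈ F ∧ x.2 ∈ F := by
  rw [Measure.prod_restrict]
  exact ae_restrict_mem (hF.prod hF)

theorem DependsOnPast.memLp_sub {G : Ω → ℝ} {k : ℕ} (hG : DependsOnPast Y k G)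
    (hY : ∀ n, Measurable (Y n)) (F : Set Ω) :
    MemLp (fun x : Ω × Ω => G x.1 - G x.2) 2 ((μ.restrict F).prod (μ.restrict F)) := by
  obtain ⟨c, hc⟩ := hG.exists_abs_le
  have hm := hG.measurable hY
  refine MemLp.of_bound ((hm.comp measurable_fst).sub (hm.comp measurable_snd)).aestronglyMeasurable
    (c + c) (Filter.Eventually.of_forall fun x => ?_)
  exact (norm_sub_le _ _).trans (add_le_add (hc _) (hc _))

theorem integral_le_of_ae_le {ν : Measure Ω} [IsFiniteMeasure ν] {f : Ω → ℝ} (hf : Integrable f ν)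
    {c : ℝ} (h : ∀ᵐ ω ∂ν, f ω ≤ c) : ∫ ω, f ω ∂ν ≤ c * ν.real Set.univ := by
  refine (integral_mono_ae hf (integrable_const c) h).trans (le_of_eq ?_)
  rw [integral_const, smul_eq_mul, mul_comm]

theorem dependsOnPast_corrected {Ω : Type*} (Y : ℕ → Ω → Fin d) (ℓ : Fin d → ℝ) (k : ℕ) :
    DependsOnPast Y k (fun ω => ℓ ⬝ᵥ corrected R p s (fun n => Y n ω) k) :=
  (dependsOnPast_occupation s Y k).comp₂ (DependsOnPast.self le_rfl) fun v i =>
    ℓ ⬝ᵥ fun j => v j + fundStep R p v i j / (∑ j, s j + k)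

/-- On an event where the occupation vector stays near `p`, the differences between two independent
copies of the corrected process, in eigencoordinates, form a Perron system. -/
theorem IsReinforcedProcess.perronSystem (hsymm : R.IsSymm)
    (hnonneg : ∀ i j, 0 ≤ R i j) (hcol : ∀ j, 0 < ∑ i, R i j)
    (hY : IsReinforcedProcess R s y₀ μ Y) (hs : ∀ i, 0 < s i) {v κ : Fin d → ℝ}
    {ℓ : Fin d → Fin d → ℝ} {B K L : ℝ} (hC : 0 < C) (hε : 0 < ε) (hε1 : ε ≤ 1)
    (hloc : LocalEstimates R p v C σ i₀ ε δ)
    (heig : ∀ j w, ℓ j ⬝ᵥ jac R p *ᵥ w = κ j * (ℓ j ⬝ᵥ w))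
    (hnorm : ∀ w : Fin d → ℝ, ∑ i, w i ^ 2 ≤ ∑ j, (ℓ j ⬝ᵥ w) ^ 2)
    (hB : ∀ j, ∑ i, |ℓ j i| ≤ B) (hK : ∀ j, |κ j| ≤ K) (hL : ∀ j, 1 ≤ L * |κ j|)
    (hF : MeasurableSet F) (hFE : F ⊆ atom Y n ω₀)
    (hstay : ∀ ω ∈ F, ∀ k, n ≤ k → occupation s (fun n => Y n ω) k ∈ Metric.ball p δ)
    (hKn : K < n) :
    PerronSystem ((μ.restrict F).prod (μ.restrict F)) n (stepSize s) κ L (2 * (B * ε) ^ 2)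
      (2 * (B * C * (6 + 2 * K)) ^ 2 / (∑ j, s j + n) ^ 2 * μ.real (atom Y n ω₀) ^ 2)
      (2 * (2 * C * B) ^ 2 * μ.real (atom Y n ω₀) ^ 2 / (∑ j, s j + n))
      (fun j k x => ℓ j ⬝ᵥ corrected R p s (fun n => Y n x.1) k
        - ℓ j ⬝ᵥ corrected R p s (fun n => Y n x.2) k)
      (fun j k x => ((ℓ j ⬝ᵥ corrected R p s (fun n => Y n x.1) (k + 1)
        - ℓ j ⬝ᵥ corrected R p s (fun n => Y n x.2) (k + 1))
        - (ℓ j ⬝ᵥ corrected R p s (fun n => Y n x.1) k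
        - ℓ j ⬝ᵥ corrected R p s (fun n => Y n x.2) k)) / stepSize s k
        - κ j * (ℓ j ⬝ᵥ corrected R p s (fun n => Y n x.1) k
        - ℓ j ⬝ᵥ corrected R p s (fun n => Y n x.2) k)
        - (noise R p s δ (ℓ j) (fun n => Y n x.1) k - noise R p s δ (ℓ j) (fun n => Y n x.2) k))
      (fun j k x => noise R p s δ (ℓ j) (fun n => Y n x.1) k
        - noise R p s δ (ℓ j) (fun n => Y n x.2) k) := by
  have hT : 0 < ∑ j, s j := sum_pos_of_pos hs i₀
  have hm := hY.measurable
  have hstep0 := stepSize_pos hT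
  set e := μ.real (atom Y n ω₀) with he
  set τ : ℝ := ∑ j, s j + n with hτ
  have hτ0 : 0 < τ := by positivity
  have hfe : μ.real F ≤ e := measureReal_mono hFE
  have hf0 : 0 ≤ μ.real F := measureReal_nonneg
  have hB0 : 0 ≤ B := (Finset.sum_nonneg fun i _ => abs_nonneg _).trans (hB i₀)
  have hK0 : 0 ≤ K := (abs_nonneg _).trans (hK i₀)
  have hnoise := fun j => hY.isNoise hsymm hnonneg hcol hs hC hloc (ℓ j) (hB j)
  set ν := (μ.restrict F).prod (μ.restrict F) with hν
  have hνuniv : ν.real Set.univ = μ.real F ^ 2 := by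
    rw [hν, ← Set.univ_prod_univ, measureReal_prod_prod, measureReal_restrict_apply_univ, sq]
  have hw : ∀ j k, MemLp (fun x : Ω × Ω => ℓ j ⬝ᵥ corrected R p s (fun n => Y n x.1) k
        - ℓ j ⬝ᵥ corrected R p s (fun n => Y n x.2) k) 2 ν := fun j k =>
    (dependsOnPast_corrected Y (ℓ j) k).memLp_sub hm F
  have hξ : ∀ j k, MemLp (fun x : Ω × Ω => noise R p s δ (ℓ j) (fun n => Y n x.1) k
        - noise R p s δ (ℓ j) (fun n => Y n x.2) k) 2 ν := fun j k =>
    ((hnoise j).dep k).memLp_sub hm F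
  refine ⟨hstep0, tendsto_sum_stepSize hT, hL, ?_, by positivity, by positivity, hw, hξ, ?_, ?_,
    ?_, ?_, ?_, ?_⟩
  · intro j k hk
    have hn0 : (0 : ℝ) < n := hK0.trans_lt hKn
    have h1 : stepSize s k ≤ 1 / n := by
      rw [stepSize]
      apply one_div_le_one_div_of_le hn0
      have : (n : ℝ) ≤ k := by exact_mod_cast hk
      linarith
    have h2 : K * stepSize s k < 1 := by
      calc K * stepSize s k ≤ K * (1 / n) := by gcongr
        _ < 1 := by rw [mul_one_div, div_lt_one hn0]; exact hKn
    have h3 := mul_le_mul_of_nonneg_right (neg_le_of_abs_le (hK j)) (hstep0 k).le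
    linarith
  · intro j k
    have h1 := (((hw j (k + 1)).sub (hw j k)).const_mul (stepSize s k)⁻¹).sub
      ((hw j k).const_mul (κ j)) |>.sub (hξ j k)
    refine h1.ae_eq (Filter.Eventually.of_forall fun x => ?_)
    simp only [Pi.sub_apply]
    ring
  · refine ⟨(2 * (B * (1 + C / ∑ j, s j))) ^ 2 * ν.real Set.univ, fun j k hk => ?_⟩
    refine integral_le_of_ae_le (hw j k).integrable_sq ?_
    filter_upwards [ae_prod_restrict_mem hF] with x hx
    have h1 : ∀ ω ∈ F, |ℓ j ⬝ᵥ corrected R p s (fun n => Y n ω) k|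
        ≤ B * (1 + C / ∑ j, s j) := by
      intro ω hω
      have hb : ∀ i, |corrected R p s (fun n => Y n ω) k i| ≤ 1 + C / ∑ j, s j := by
        intro i
        have h2 := abs_corrected_sub_le (y := fun n => Y n ω) hs hloc (hstay ω hω k hk) i
        have h3 := occupation_nonneg (y := fun n => Y n ω) hs k i
        have h4 := occupation_le_one (y := fun n => Y n ω) hs k i
        have h5 : C / (∑ j, s j + (k : ℝ)) ≤ C / ∑ j, s j := by
          gcongr
          have : (0 : ℝ) ≤ k := by positivity
          linarith
        rw [abs_le] at h2 ⊢
        constructor <;> linarith [h2.1, h2.2]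
      refine (abs_dotProduct_le hb).trans ?_
      gcongr
      exact hB j
    have h2 := (abs_sub _ _).trans (add_le_add (h1 x.1 hx.1) (h1 x.2 hx.2))
    have h3 := pow_le_pow_left₀ (abs_nonneg _) h2 2
    rw [sq_abs] at h3
    refine h3.trans (le_of_eq (by ring))
  -- Both copies lie in one atom, so they share their first `n + 1` states and their corrected
  -- vectors agree at time `n`.
  · intro j
    filter_upwards [ae_prod_restrict_mem hF] with x hx
    rw [sub_eq_zero]
    exact dependsOnPast_corrected Y (ℓ j) n x.1 x.2 fun i hi =>
      (hFE hx.1 i hi).symm.trans (hFE hx.2 i hi)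
  -- The coupling term was defined by solving the recursion for it, so the recursion is an identity;
  -- its smallness is proved only where both copies lie in `F`.
  · intro j k _ x
    have := (hstep0 k).ne'
    field_simp
    ring
  · intro j k hk
    set w := fun (i : Fin d) (x : Ω × Ω) => ℓ i ⬝ᵥ corrected R p s (fun n => Y n x.1) k
        - ℓ i ⬝ᵥ corrected R p s (fun n => Y n x.2) k with hwdef
    have hint : Integrable (fun x : Ω × Ω => 2 * (B * ε) ^ 2 * ∑ i, w i x ^ 2
        + 2 * (B * C * (6 + 2 * K)) ^ 2 / τ ^ 2) ν :=
      ((integrable_finsetSum _ fun i _ => (hw i k).integrable_sq).const_mul _).add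
        (integrable_const _)
    refine (integral_mono_of_nonneg (Filter.Eventually.of_forall fun x => sq_nonneg _) hint
      ?_).trans ?_
    · filter_upwards [ae_prod_restrict_mem hF] with x hx
      have hτk : τ ≤ ∑ j, s j + k := by
        have : (n : ℝ) ≤ k := by exact_mod_cast hk
        linarith
      have hk' := hk.trans (Nat.le_succ k)
      have h1 := sq_rest_le (y := fun n => Y n x.1) (y' := fun n => Y n x.2) hs hC hε hε1 hloc heig
        hnorm hB hK hτ0 hτk (hstay x.1 hx.1 k hk) (hstay x.1 hx.1 (k + 1) hk')
        (hstay x.2 hx.2 k hk) (hstay x.2 hx.2 (k + 1) hk') j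
      refine le_trans (le_of_eq ?_) h1
      have e1 := corrected_succ (y := fun n => Y n x.1) hs hloc (hstay x.1 hx.1 k hk) (ℓ j)
      have e2 := corrected_succ (y := fun n => Y n x.2) hs hloc (hstay x.2 hx.2 k hk) (ℓ j)
      have := (hstep0 k).ne'
      rw [e1, e2]
      congr 1
      field_simp
      ring
    · rw [integral_add ((integrable_finsetSum _ fun i _ => (hw i k).integrable_sq).const_mul _)
        (integrable_const _), integral_const_mul,
        integral_finsetSum _ fun i _ => (hw i k).integrable_sq, integral_const, smul_eq_mul, hνuniv]
      have h1 : μ.real F ^ 2 * (2 * (B * C * (6 + 2 * K)) ^ 2 / τ ^ 2)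
          ≤ e ^ 2 * (2 * (B * C * (6 + 2 * K)) ^ 2 / τ ^ 2) := by gcongr
      linarith
  · intro j c k m hk hc
    rcases lt_or_ge m k with hmk | hmk
    · rw [Finset.Ico_eq_empty_of_le hmk.le]
      simp only [Finset.sum_empty, ne_eq, OfNat.ofNat_ne_zero, not_false_eq_true, zero_pow,
        integral_zero]
      positivity
    have hM := (hnoise j).dep_sum (fun l => c l * stepSize s l) k m
    set M : Ω → ℝ := fun ω => ∑ l ∈ Finset.Ico k m,
      c l * stepSize s l * noise R p s δ (ℓ j) (fun n => Y n ω) l with hMdef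
    have i2 : Integrable (fun ω => M ω ^ 2) μ := (hM.comp fun x => x ^ 2).integrable hm
    have hML : MemLp M 2 (μ.restrict F) :=
      (memLp_two_iff_integrable_sq (hM.measurable hm).aestronglyMeasurable).2 i2.integrableOn
    have heq : ∀ x : Ω × Ω, ∑ l ∈ Finset.Ico k m, c l * stepSize s l *
        (noise R p s δ (ℓ j) (fun n => Y n x.1) l - noise R p s δ (ℓ j) (fun n => Y n x.2) l)
        = M x.1 - M x.2 := fun x => by
      simp only [hMdef, mul_sub, Finset.sum_sub_distrib]
    simp only [heq]
    refine (integral_prod_sub_sq_le hML).trans ?_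
    rw [measureReal_restrict_apply_univ]
    have hEm : MeasurableSet (atom Y n ω₀) := history_le hm n _ (measurableSet_history_atom Y n ω₀)
    -- Passing from `F` to the whole atom restores the martingale structure, which restriction to
    -- the future event `F` destroys.
    have h1 : ∫ ω in F, M ω ^ 2 ∂μ ≤ ∫ ω in atom Y n ω₀, M ω ^ 2 ∂μ :=
      setIntegral_mono_set i2.integrableOn (Filter.Eventually.of_forall fun ω => sq_nonneg _)
        hFE.eventuallyLE
    have h2 : ∫ ω in atom Y n ω₀, M ω ^ 2 ∂μ ≤ (2 * C * B) ^ 2 * (1 / τ) * e := by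
      have hIint : ∫ ω, (atom Y n ω₀).indicator (fun _ => (1 : ℝ)) ω ∂μ = e := by
        rw [integral_indicator hEm, setIntegral_const, smul_eq_mul, mul_one]
      have h3 := (hnoise j).integral_sum_sq_le hm (dependsOnPast_indicator_atom Y n ω₀)
        (fun ω => Set.indicator_nonneg (fun _ _ => zero_le_one) ω) (fun l => c l * stepSize s l)
        hk hmk
      rw [setIntegral_eq_integral_indicator_mul hEm]
      refine h3.trans ?_
      rw [hIint]
      gcongr
      refine le_trans (Finset.sum_le_sum fun l hl => ?_)
        ((sum_sq_stepSize_le hT k m).trans (one_div_le_one_div_of_le hτ0 (by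
          have : (n : ℝ) ≤ k := by exact_mod_cast hk
          linarith)))
      rw [mul_pow]
      have h4 : c l ^ 2 ≤ 1 := by
        rw [← sq_abs]
        exact pow_le_one₀ (abs_nonneg _) (hc l hl)
      exact mul_le_of_le_one_left (sq_nonneg _) h4
    have h5 : 0 ≤ (2 * C * B) ^ 2 * (1 / τ) * e := by positivity
    calc 2 * μ.real F * ∫ ω in F, M ω ^ 2 ∂μ ≤ 2 * e * ((2 * C * B) ^ 2 * (1 / τ) * e) := by
          refine mul_le_mul (by linarith) (h1.trans h2) (integral_nonneg fun ω => sq_nonneg _) ?_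
          positivity
      _ = 2 * (2 * C * B) ^ 2 * e ^ 2 / τ := by ring

end Main

end VRRW

namespace VRRW

open MeasureTheory Matrix

/-! ### Choice of constants and the contradiction. -/

section Nonconvergence

variable {d : ℕ} {Ω : Type*} [mΩ : MeasurableSpace Ω] {R : Matrix (Fin d) (Fin d) ℝ}
  {s p : Fin d → ℝ} {y₀ : Fin d} {μ : Measure Ω} [IsProbabilityMeasure μ] {Y : ℕ → Ω → Fin d}

/-- The event that the occupation vector stays in a ball from time `n` on. -/
def stays {Ω : Type*} (s p : Fin d → ℝ) (Y : ℕ → Ω → Fin d) (δ : ℝ) (n : ℕ) : Set Ω :=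
  {ω | ∀ k, n ≤ k → occupation s (fun n => Y n ω) k ∈ Metric.ball p δ}

theorem measurableSet_stays {Ω : Type*} (s p : Fin d → ℝ) (Y : ℕ → Ω → Fin d) (δ : ℝ) (n : ℕ) :
    MeasurableSet[⨆ n, history Y n] (stays s p Y δ n) := by
  have h1 : ∀ k, MeasurableSet[⨆ n, history Y n]
      {ω | occupation s (fun n => Y n ω) k ∈ Metric.ball p δ} := by
    intro k
    have hd : DependsOnPast Y k (fun ω => (Metric.ball p δ).indicator (fun _ => (1 : ℝ))
        (occupation s (fun n => Y n ω) k)) := (dependsOnPast_occupation s Y k).comp _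
    have h2 := le_iSup (history Y) k _ (hd.measurable_history (measurableSet_singleton 1))
    convert h2 using 1
    ext ω
    by_cases h : occupation s (fun n => Y n ω) k ∈ Metric.ball p δ
    · simp [h, -Metric.mem_ball]
    · simp [h, -Metric.mem_ball]
  have h3 : stays s p Y δ n
      = ⋂ k, ⋂ (_ : n ≤ k), {ω | occupation s (fun n => Y n ω) k ∈ Metric.ball p δ} := by
    ext ω
    simp [stays]
  rw [h3]
  exact @MeasurableSet.iInter _ _ (⨆ n, history Y n) _ _ fun k =>
    @MeasurableSet.iInter _ _ (⨆ n, history Y n) _ _ fun _ => h1 k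

theorem exists_small_coupling {G q : ℝ} (hG : 0 ≤ G) (hq : 0 < q) :
    ∃ ε, 0 < ε ∧ ε ≤ 1 ∧ G * ε ^ 2 ≤ q := by
  refine ⟨min 1 (q / (G + 1)), by positivity, min_le_left _ _, ?_⟩
  set ε := min 1 (q / (G + 1)) with hε
  have h0 : 0 < ε := by positivity
  have h1 : ε ≤ 1 := min_le_left _ _
  have h2 : ε * (G + 1) ≤ q := by
    rw [← le_div_iff₀ (by positivity)]
    exact min_le_right _ _
  nlinarith [mul_nonneg hG h0.le]

/-- `T / τ` is the truncation level. The choice of `T` makes the fourth-moment part at most `c /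
16`, and the bound on `ε` does the same for the other part. -/
theorem second_moment_error_le {c C T ε τ : ℝ} (hc : 0 < c) (hτ : 0 < τ)
    (hT : T = 44 * C ^ 4 / c + 1) (hε : 0 ≤ ε) (hεT : ε * (16 * (T + C ^ 2)) ≤ c) :
    T / τ * ε + 11 * C ^ 4 * (1 / τ) ^ 2 / (4 * (T / τ)) ≤ c / 8 / τ := by
  have hT0 : 0 < T := by rw [hT]; positivity
  have h1 : T / τ * ε + 11 * C ^ 4 * (1 / τ) ^ 2 / (4 * (T / τ))
      = (T * ε + 11 * C ^ 4 / (4 * T)) / τ := by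
    field_simp
  rw [h1]
  refine div_le_div_of_nonneg_right ?_ hτ.le
  have h2 : 11 * C ^ 4 / (4 * T) ≤ c / 16 := by
    rw [div_le_div_iff₀ (by positivity) (by positivity)]
    have h3 : c * T = 44 * C ^ 4 + c := by
      rw [hT]
      field_simp
    linarith
  have h4 : 0 ≤ ε * C ^ 2 := by positivity
  linarith

theorem le_noise_lower_bound {c C ε τ e f X : ℝ} (hc : 0 < c) (hτ : 0 < τ) (he : 0 < e)
    (hfe : 3 / 4 * e ≤ f) (hεC : ε * C ^ 2 ≤ c / 16) (hX : X ≤ c / 8 / τ) :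
    c / 2 * (e ^ 2 / τ) ≤
      2 * f * (c * f / τ - X * e) - 2 * (ε * (C ^ 2 * (1 / τ))) * e ^ 2 := by
  have hf0 : 0 ≤ f := le_trans (by positivity) hfe
  have h1 : c * f / τ - c / 8 / τ * e ≤ c * f / τ - X * e := by
    have := mul_le_mul_of_nonneg_right hX he.le
    linarith
  have h2 := mul_le_mul_of_nonneg_left h1 (show 0 ≤ 2 * f by positivity)
  have h3 : 2 * f * (c * f / τ - c / 8 / τ * e) = 2 * c * (f * (f - e / 8)) / τ := by ring
  have h4 : 3 / 4 * e * (5 / 8 * e) ≤ f * (f - e / 8) :=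
    mul_le_mul hfe (by linarith) (by positivity) hf0
  have h5 : 2 * c * (3 / 4 * e * (5 / 8 * e)) / τ ≤ 2 * c * (f * (f - e / 8)) / τ := by gcongr
  have h7 : 2 * (ε * (C ^ 2 * (1 / τ))) * e ^ 2 = 2 * (ε * C ^ 2) * (e ^ 2 / τ) := by ring
  have h8 : 2 * (ε * C ^ 2) * (e ^ 2 / τ) ≤ 2 * (c / 16) * (e ^ 2 / τ) := by gcongr
  have h9 : 2 * c * (3 / 4 * e * (5 / 8 * e)) / τ = 15 / 16 * (c * (e ^ 2 / τ)) := by ring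
  have h10 : 0 < c * (e ^ 2 / τ) := by positivity
  linarith

/-- The deterministic error is of order `τ⁻²`, negligible against `e ^ 2 / τ` once `τ` is large. The
noise fed back through the coupling has that order itself, so it needs a small `ε`. -/
theorem noise_upper_bound_le {c C D L τ e ε N : ℝ} (hc : 0 < c) (hτ : 0 < τ) (hD : 0 ≤ D)
    (hτD : 64 * L ^ 2 * D / c ≤ τ) (h₁ : ε * (8 * (L ^ 2 * N)) ≤ 1)
    (h₂ : ε * (32 * (L ^ 2 * N) * C ^ 2) ≤ c / 16) :
    2 * (L ^ 2 * (ε * (N * (8 * (L ^ 2 * (D / τ ^ 2 * e ^ 2) + 2 * C ^ 2 * e ^ 2 / τ)))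
      + D / τ ^ 2 * e ^ 2)) ≤ 2 * (c / 16 * (e ^ 2 / τ)) := by
  set a := D / τ ^ 2 * e ^ 2 with ha
  have h3 : 2 * (L ^ 2 * (ε * (N * (8 * (L ^ 2 * a + 2 * C ^ 2 * e ^ 2 / τ))) + a))
      = 2 * (ε * (8 * (L ^ 2 * N))) * (L ^ 2 * a)
        + ε * (32 * (L ^ 2 * N) * C ^ 2) * (e ^ 2 / τ) + 2 * (L ^ 2 * a) := by
    ring
  have hLa : 0 ≤ L ^ 2 * a := by positivity
  have h4 := mul_le_mul_of_nonneg_right h₁ hLa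
  have h5 : ε * (32 * (L ^ 2 * N) * C ^ 2) * (e ^ 2 / τ) ≤ c / 16 * (e ^ 2 / τ) := by gcongr
  have h6 : 4 * (L ^ 2 * a) ≤ c / 16 * (e ^ 2 / τ) := by
    rw [div_le_iff₀ hc] at hτD
    have h7 : 4 * (L ^ 2 * a) = 64 * L ^ 2 * D / τ / 16 * (e ^ 2 / τ) := by
      rw [ha]
      field_simp
      ring
    rw [h7]
    refine mul_le_mul_of_nonneg_right ?_ (by positivity)
    refine div_le_div_of_nonneg_right ?_ (by norm_num)
    rw [div_le_iff₀ hτ]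
    linarith
  rw [h3]
  linarith

set_option maxHeartbeats 800000 in
/-- An interior critical point where the quadratic form has a positive direction is almost surely
not a limit of the occupation vector. -/
theorem IsReinforcedProcess.measure_tendsto_eq_zero (hsymm : R.IsSymm)
    (hnonneg : ∀ i j, 0 ≤ R i j) (hcol : ∀ j, 0 < ∑ i, R i j) (hdet : R.det ≠ 0)
    (hp : IsInteriorCritical R p) (hdir : HasPositiveDirection R)
    (hY : IsReinforcedProcess R s y₀ μ Y) (hs : ∀ i, 0 < s i) :
    μ {ω | Filter.Tendsto (fun n => occupation s (fun k => Y k ω) n) Filter.atTop (𝓝 p)} = 0 := by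
  by_cases herg : IsErgodicAt R p
  swap
  · exact hY.measure_tendsto_of_not_isErgodicAt hsymm hnonneg hp hs herg
  obtain ⟨κ, ℓ, heig, hnorm, hκ0, hone, hright, hpos⟩ := hp.exists_eigencoordinates hsymm hdet
  obtain ⟨j₀, hj₀⟩ := hpos hdir
  obtain ⟨C, σ, hC, hσ, i₀, hloc⟩ :=
    hp.exists_localEstimates hsymm hnonneg herg hj₀ (hone j₀) (hright j₀)
  have hne : Nonempty (Fin d) := ⟨i₀⟩
  have hT : 0 < ∑ j, s j := sum_pos_of_pos hs i₀
  set B := ∑ j, ∑ i, |ℓ j i| with hBdef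
  set K := ∑ j, |κ j| with hKdef
  set L := ∑ j, 1 / |κ j| with hLdef
  have hB : ∀ j, ∑ i, |ℓ j i| ≤ B := fun j =>
    Finset.single_le_sum (f := fun j => ∑ i, |ℓ j i|)
      (fun j _ => Finset.sum_nonneg fun i _ => abs_nonneg _) (Finset.mem_univ j)
  have hK : ∀ j, |κ j| ≤ K := fun j =>
    Finset.single_le_sum (f := fun j => |κ j|) (fun j _ => abs_nonneg _) (Finset.mem_univ j)
  have hL : ∀ j, 1 ≤ L * |κ j| := fun j => by
    have h1 : 1 / |κ j| ≤ L :=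
      Finset.single_le_sum (f := fun j => 1 / |κ j|) (fun j _ => by positivity) (Finset.mem_univ j)
    have h2 : 0 < |κ j| := abs_pos.2 (hκ0 j)
    rwa [div_le_iff₀ h2] at h1
  set C₁ := 2 * C * B with hC₁
  set c₀ := (Real.exp (2 * κ j₀))⁻¹ ^ 2 * σ * p i₀ / 64 with hc₀
  have hp0 := hp.pos i₀
  have hc0 : 0 < c₀ := by positivity
  -- The coupling is `2 (B ε)²`. The two summands of `G` serve absorption in the Perron system and
  -- the final upper bound.
  obtain ⟨ε, hε0, hε1, hεG⟩ := exists_small_coupling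
    (G := 2 * B ^ 2 * (8 * (L ^ 2 * d) + 32 * (L ^ 2 * d) * C₁ ^ 2)) (q := min 1 (c₀ / 16))
    (by positivity) (by positivity)
  obtain ⟨δ, hloc⟩ := hloc ε hε0
  by_contra hne0
  obtain ⟨n₀, hn₀⟩ : ∃ n, μ (stays s p Y δ n) ≠ 0 := by
    by_contra! hall
    apply hne0
    refine measure_mono_null ?_ (measure_iUnion_null hall)
    intro ω hω
    obtain ⟨n, hn⟩ := Filter.eventually_atTop.1 (hω.eventually (Metric.ball_mem_nhds p hloc.pos))
    exact Set.mem_iUnion.2 ⟨n, fun k hk => hn k hk⟩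
  set T₀ := 44 * C₁ ^ 4 / c₀ + 1 with hT₀
  have hT₀pos : 0 < T₀ := by positivity
  set ε' := min (1 / 4) (c₀ / (16 * (T₀ + C₁ ^ 2))) with hε'
  have hε'0 : 0 < ε' := by positivity
  have hε'1 : ε' ≤ 1 / 4 := min_le_left _ _
  have hε'2 : ε' * (16 * (T₀ + C₁ ^ 2)) ≤ c₀ := by
    rw [← le_div_iff₀ (by positivity)]
    exact min_le_right _ _
  set D₂ := 2 * (B * C * (6 + 2 * K)) ^ 2 with hD₂
  -- Late times keep the growth factors positive (`K`), allow the visit count (`∑ s`) and make the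
  -- second-order error negligible (the quotient by `c₀`).
  obtain ⟨N, hN⟩ := exists_nat_gt (∑ j, s j + K + 64 * L ^ 2 * D₂ / c₀ + 1)
  have hK0 : 0 ≤ K := (abs_nonneg _).trans (hK j₀)
  have hq0 : 0 ≤ 64 * L ^ 2 * D₂ / c₀ := by positivity
  obtain ⟨n, hn, ω₀, hE0, hEA⟩ := exists_atom hY.measurable (measurableSet_stays s p Y δ n₀) hn₀
    hε'0 (max n₀ N)
  have hnn₀ : n₀ ≤ n := (le_max_left _ _).trans hn
  have hnN : (N : ℝ) ≤ n := by exact_mod_cast (le_max_right _ _).trans hn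
  have hn1 : 1 ≤ n := by
    have h : (1 : ℝ) ≤ n := by linarith
    exact_mod_cast h
  set E := atom Y n ω₀ with hE
  set F := E ∩ stays s p Y δ n₀ with hFdef
  have hAm : MeasurableSet (stays s p Y δ n₀) :=
    (iSup_le (history_le hY.measurable)) _ (measurableSet_stays s p Y δ n₀)
  have hEm : MeasurableSet E :=
    history_le hY.measurable n _ (measurableSet_history_atom Y n ω₀)
  have hFm : MeasurableSet F := hEm.inter hAm
  have hFE : F ⊆ E := Set.inter_subset_left
  have hstay : ∀ ω ∈ F, ∀ k, n ≤ k → occupation s (fun n => Y n ω) k ∈ Metric.ball p δ :=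
    fun ω hω k hk => hω.2 k (hnn₀.trans hk)
  have hEF : μ.real (E \ F) ≤ ε' * μ.real E := by
    rwa [hFdef, Set.sdiff_self_inter]
  have hfe : (3 / 4) * μ.real E ≤ μ.real F := by
    have h1 := measureReal_inter_add_sdiff (μ := μ) (s := E) hAm
    have h2 : ε' * μ.real E ≤ 1 / 4 * μ.real E := by gcongr
    rw [← hFdef] at h1
    linarith
  have hsys := hY.perronSystem hsymm hnonneg hcol hs hC hε0 hε1 hloc heig hnorm hB hK hL hFm hFE
    hstay (by linarith)
  set e := μ.real E with he
  set f := μ.real F with hf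
  set τ : ℝ := ∑ j, s j + n with hτ
  have hτ0 : 0 < τ := by positivity
  set ε₂ := 2 * (B * ε) ^ 2 with hε₂
  have hsmall : ε₂ * (8 * (L ^ 2 * d)) + ε₂ * (32 * (L ^ 2 * d) * C₁ ^ 2) ≤ min 1 (c₀ / 16) := by
    refine le_trans (le_of_eq ?_) hεG
    rw [hε₂]
    ring
  have hε₂0 : 0 ≤ ε₂ := by positivity
  have hsm1 : 0 ≤ ε₂ * (8 * (L ^ 2 * d)) := by positivity
  have hsm2 : 0 ≤ ε₂ * (32 * (L ^ 2 * d) * C₁ ^ 2) := by positivity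
  have hs1 : ε₂ * (8 * (L ^ 2 * d)) ≤ 1 := by
    have := hsmall.trans (min_le_left _ _)
    linarith
  have hs2 : ε₂ * (32 * (L ^ 2 * d) * C₁ ^ 2) ≤ c₀ / 16 := by
    have := hsmall.trans (min_le_right _ _)
    linarith
  have hη : 0 < c₀ / 16 * (e ^ 2 / τ) := by positivity
  have hev := hsys.eventually_noise_le (by positivity)
    (by rw [Fintype.card_fin]; linarith) hj₀ hη
  obtain ⟨m, hm, hm2⟩ := (hev.and (Filter.eventually_ge_atTop (2 * n + 1))).exists
  rw [Fintype.card_fin] at hm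
  have hlow := hY.le_setIntegral_noise_sq hsymm hnonneg hcol hs hj₀.le hσ hC hloc hFm hFE hstay hn1
    (by linarith) hm2
  have hnoise := hY.isNoise hsymm hnonneg hcol hs hC hloc (ℓ j₀) (hB j₀)
  have hαq : ∑ l ∈ Finset.Ico n m,
      ((growth (κ j₀) (stepSize s) n (l + 1))⁻¹ * stepSize s l) ^ 2 ≤ 1 / τ := by
    refine le_trans (Finset.sum_le_sum fun l _ => ?_) (sum_sq_stepSize_le hT n m)
    rw [mul_pow]
    have h1 := one_le_growth hj₀.le (fun k => (stepSize_pos hT k).le) n (l + 1)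
    exact mul_le_of_le_one_left (sq_nonneg _)
      (pow_le_one₀ (inv_nonneg.2 (zero_le_one.trans h1)) (inv_le_one_of_one_le₀ h1))
  have hcopies := hnoise.le_integral_prod_sub_sq hY.measurable hFm hFE
    (α := fun l => (growth (κ j₀) (stepSize s) n (l + 1))⁻¹ * stepSize s l)
    (show n ≤ m by omega) (t := T₀ / τ) (by positivity) hε'0 hE0 hαq hEF hlow
  simp only [mul_sub, Finset.sum_sub_distrib] at hm
  have hD := hcopies.trans hm
  have hX := second_moment_error_le hc0 hτ0 hT₀ hε'0.le hε'2
  have hlower := le_noise_lower_bound hc0 hτ0 hE0 hfe (show ε' * C₁ ^ 2 ≤ c₀ / 16 by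
    have : 0 ≤ ε' * T₀ := by positivity
    nlinarith) hX
  have hupper := noise_upper_bound_le (L := L) (e := e) hc0 hτ0 (show 0 ≤ D₂ by positivity)
    (show 64 * L ^ 2 * D₂ / c₀ ≤ τ by linarith) hs1 hs2
  -- In units of `c₀ * (e ^ 2 / τ)` the lower bound is 1/2 and the upper bound 1/16 + 2/16.
  have hfin := (hlower.trans hD).trans (add_le_add_right hupper _)
  linarith

end Nonconvergence

end VRRW

theorem theorem2 {d : ℕ} (R : Matrix (Fin d) (Fin d) ℝ) (hsymm : R.IsSymm)
    (hnonneg : ∀ i j, 0 ≤ R i j) (hcol : ∀ j, 0 < ∑ i, R i j) (hdet : R.det ≠ 0)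
    (p : Fin d → ℝ) (hp : VRRW.IsInteriorCritical R p) :
    (∀ q, VRRW.IsInteriorCritical R q → q = p) ∧
    (¬ IsMaxOn (VRRW.H R) (stdSimplex ℝ (Fin d)) p →
      ∀ {Ω : Type*} [MeasurableSpace Ω] (μ : MeasureTheory.Measure Ω)
        [MeasureTheory.IsProbabilityMeasure μ] (s : Fin d → ℝ) (y₀ : Fin d) (Y : ℕ → Ω → Fin d),
        (∀ i, 0 < s i) → VRRW.IsReinforcedProcess R s y₀ μ Y →
        μ {ω | Filter.Tendsto (fun n => VRRW.occupation s (fun k => Y k ω) n)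
          Filter.atTop (𝓝 p)} = 0) ∧
    (¬ IsMaxOn (VRRW.H R) (stdSimplex ℝ (Fin d)) p ↔ 1 < VRRW.numPosEigenvalues R) ∧
    DifferentiableAt ℝ (VRRW.drift R) p ∧
    ∃ hW : ∀ w ∈ VRRW.directions d, (fderiv ℝ (VRRW.drift R) p).toLinearMap w ∈ VRRW.directions d,
      (1 < VRRW.numPosEigenvalues R ↔
        ∃ c : ℝ, 0 < c ∧ Module.End.HasEigenvalue
          ((fderiv ℝ (VRRW.drift R) p).toLinearMap.restrict hW) c) := by
  have hmax := hp.not_isMaxOn_iff hsymm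
  have hnum := hp.one_lt_numPosEigenvalues_iff hsymm
  refine ⟨fun q hq => hp.eq_of_isInteriorCritical hdet hq, ?_, hmax.trans hnum.symm,
    (hp.hasStrictFDerivAt_drift hsymm).hasFDerivAt.differentiableAt,
    hp.fderiv_drift_mem_directions hsymm,
    hnum.trans (hp.hasPositiveDirection_iff_hasEigenvalue hsymm hdet _)⟩
  intro hnot Ω _ μ _ s y₀ Y hs hY
  exact hY.measure_tendsto_eq_zero hsymm hnonneg hcol hdet hp (hmax.1 hnot) hs
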